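/- Let $\bar S$ be the compact one-holed torus (a torus with an open disc removed). For $b>0$ let $\mathcal{T}(S_{1,1},b)$ be the Teichmüller space of marked hyperbolic structures on $\bar S$ whose boundary $\partial\bar S$ is a geodesic of length $b$, up to isometries compatible with the markings up to homotopy; equivalently, passing to convex cores, of complete hyperbolic structures on the interior of $\bar S$ for which the geodesic representative of the boundary has length $b$. Let $\mathcal{S}$ be the set of free homotopy classes of essential simple closed curves on $\bar S$ (simple closed curves that are neither null-homotopic nor homotopic into $\partial\bar S$), and let $\mathcal{A}$ be the set of homotopy classes, with endpoints staying on $\partial\bar S$, of essential simple arcs (simple paths with endpoints on $\partial\bar S$ that are not homotopic, through paths with endpoints on $\partial\bar S$, to a path in $\partial\bar S$). For $h\in\mathcal{T}(S_{1,1},b)$ let $\ell_h(\alpha)$ be the length of the geodesic representative of $\alpha\in\mathcal{S}$, respectively of the orthogeodesic representative of $\alpha\in\mathcal{A}$, that is, the infimum of the $h$-lengths of the curves in the class $\alpha$. Define the curve metric (Thurston metric) and the arc metric by $$K(h_0,h_1)=\sup_{\gamma\in\mathcal{S}}\log\frac{\ell_{h_1}(\gamma)}{\ell_{h_0}(\gamma)},\qquad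 A(h_0,h_1)=\sup_{\alpha\in\mathcal{A}\cup\mathcal{S}}\log\frac{\ell_{h_1}(\alpha)}{\ell_{h_0}(\alpha)}.$$ Then there is $B>0$ such that for every $b\ge B$ there exist $h_0,h_1\in\mathcal{T}(S_{1,1},b)$ with $$K(h_0,h_1)<A(h_0,h_1).$$ -/

import Mathlib

open scoped ENNReal UpperHalfPlane

noncomputable section

namespace TorusMetrics

/-! ### The compact one-holed torus -/

/-- The compact one-holed torus: the torus `(ℝ/ℤ)²` with the open round disc of radius `1/4`
about the origin removed. (`‖x‖` is the distance from `x` to `0` in `ℝ/ℤ`.) -/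
def OneHoledTorus : Type :=
  {p : UnitAddCircle × UnitAddCircle // (1 / 4 : ℝ) ^ 2 ≤ ‖p.1‖ ^ 2 + ‖p.2‖ ^ 2}

instance : TopologicalSpace OneHoledTorus :=
  inferInstanceAs (TopologicalSpace
    {p : UnitAddCircle × UnitAddCircle // (1 / 4 : ℝ) ^ 2 ≤ ‖p.1‖ ^ 2 + ‖p.2‖ ^ 2})

/-- The boundary circle of the one-holed torus. -/
def bdry : Set OneHoledTorus := {p | ‖p.1.1‖ ^ 2 + ‖p.1.2‖ ^ 2 = (1 / 4 : ℝ) ^ 2}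

theorem norm_coe_of_abs_le_one {s : ℝ} (hs : |s| ≤ 1) :
    ‖((s / 4 : ℝ) : UnitAddCircle)‖ = |s| / 4 := by
  have h4 : |s / 4| = |s| / 4 := by rw [abs_div]; norm_num
  rw [← h4]
  refine (AddCircle.norm_coe_eq_abs_iff (1 : ℝ) one_ne_zero).2 ?_
  rw [h4, abs_one]
  linarith

theorem boundary_equation (z : Circle) :
    ‖(((z : ℂ).re / 4 : ℝ) : UnitAddCircle)‖ ^ 2 + ‖(((z : ℂ).im / 4 : ℝ) : UnitAddCircle)‖ ^ 2
      = (1 / 4 : ℝ) ^ 2 := by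
  have hz : ‖(z : ℂ)‖ = 1 := z.norm_coe
  have hre : |(z : ℂ).re| ≤ 1 := hz ▸ Complex.abs_re_le_norm _
  have him : |(z : ℂ).im| ≤ 1 := hz ▸ Complex.abs_im_le_norm _
  rw [norm_coe_of_abs_le_one hre, norm_coe_of_abs_le_one him, div_pow, div_pow, sq_abs, sq_abs]
  have h : (z : ℂ).re * (z : ℂ).re + (z : ℂ).im * (z : ℂ).im = 1 := by
    rw [← Complex.normSq_apply, Complex.normSq_eq_norm_sq, hz, one_pow]
  linarith

/-- The boundary circle as a loop, traversed once: `z ↦ (Re z / 4, Im z / 4)`. -/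
def boundaryLoop : C(Circle, OneHoledTorus) where
  toFun z := ⟨(((z : ℂ).re / 4 : ℝ), ((z : ℂ).im / 4 : ℝ)), (boundary_equation z).ge⟩
  continuous_toFun := by
    refine Continuous.subtype_mk (Continuous.prodMk ?_ ?_) _
    · exact (AddCircle.continuous_mk' (1 : ℝ)).comp
        ((Complex.continuous_re.comp continuous_subtype_val).div_const 4)
    · exact (AddCircle.continuous_mk' (1 : ℝ)).comp
        ((Complex.continuous_im.comp continuous_subtype_val).div_const 4)

/-! ### Homotopy classes of curves and arcs -/

/-- A simple closed curve that is essential: neither null-homotopic nor freely homotopic into the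
boundary. -/
def IsEssentialSimpleClosedCurve (γ : C(Circle, OneHoledTorus)) : Prop :=
  Function.Injective γ ∧ ¬ γ.Nullhomotopic ∧
    ¬ ∃ γ' : C(Circle, OneHoledTorus), γ.Homotopic γ' ∧ ∀ z, γ' z ∈ bdry

/-- Homotopy of paths whose two endpoints stay on the boundary (and may slide along it). -/
def BoundaryHomotopic (a a' : C(unitInterval, OneHoledTorus)) : Prop :=
  a.HomotopicWith a' fun k => k 0 ∈ bdry ∧ k 1 ∈ bdry

/-- A simple path with endpoints on the boundary that is not homotopic, relative to the boundary,
to a path in the boundary. -/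
def IsEssentialSimpleArc (a : C(unitInterval, OneHoledTorus)) : Prop :=
  Function.Injective a ∧ a 0 ∈ bdry ∧ a 1 ∈ bdry ∧
    ¬ ∃ a' : C(unitInterval, OneHoledTorus), BoundaryHomotopic a a' ∧ ∀ t, a' t ∈ bdry

/-! ### Hyperbolic structures with geodesic boundary -/

/-- The length of a closed curve in a metric space. -/
def loopLength {X : Type} [PseudoEMetricSpace X] (c : Circle → X) : ℝ≥0∞ :=
  eVariationOn (fun t : ℝ => c (Circle.exp t)) (Set.Icc 0 (2 * Real.pi))

/-- The length of a path in a metric space. -/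
def pathLength {X : Type} [PseudoEMetricSpace X] (a : unitInterval → X) : ℝ≥0∞ :=
  eVariationOn a Set.univ

/-- Some ball about `x` is isometric to the ball of the same radius in the subset `M` of the
hyperbolic plane about the point `i`, by an isometry that sends `x` to `i`. -/
def IsModeledAt {X : Type} [MetricSpace X] (M : Set ℍ) (x : X) : Prop :=
  ∃ r > 0, ∃ φ : X → ℍ, φ x = UpperHalfPlane.I ∧
    (∀ y ∈ Metric.ball x r, ∀ z ∈ Metric.ball x r, dist (φ y) (φ z) = dist y z) ∧
    φ '' Metric.ball x r = Metric.ball UpperHalfPlane.I r ∩ M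

/-- The closed half-plane of the hyperbolic plane to the right of the geodesic `Re z = 0`, which
passes through `i`. -/
def halfPlane : Set ℍ := {z | 0 ≤ z.re}

/-- A marked hyperbolic one-holed torus with geodesic boundary of length `b`: a length metric
space which is locally isometric to the hyperbolic plane at interior points and to a closed
hyperbolic half-plane at boundary points, with a homeomorphism from `OneHoledTorus`. -/
structure MarkedTorus (b : ℝ) where
  carrier : Type
  [metric : MetricSpace carrier]
  marking : OneHoledTorus ≃ₜ carrier
  exists_short_path : ∀ x y : carrier, ∀ ε > 0,
    ∃ γ : Path x y, pathLength γ ≤ ENNReal.ofReal (dist x y + ε)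
  interior_hyperbolic : ∀ p, p ∉ bdry → IsModeledAt Set.univ (marking p)
  boundary_geodesic : ∀ p, p ∈ bdry → IsModeledAt halfPlane (marking p)
  boundary_length : loopLength (fun z => marking (boundaryLoop z)) = ENNReal.ofReal b

attribute [instance] MarkedTorus.metric

/-- The self-map of `OneHoledTorus` that an isometry of the underlying surfaces induces through
the markings. -/
def transition {b : ℝ} (h h' : MarkedTorus b) (φ : h.carrier ≃ᵢ h'.carrier) :
    C(OneHoledTorus, OneHoledTorus) :=
  ⟨fun p => h'.marking.symm (φ (h.marking p)), by fun_prop⟩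

/-- Two marked tori are equivalent if there is an isometry between them which commutes with the
markings up to homotopy through maps of the pair `(OneHoledTorus, bdry)`. -/
def TeichEquiv {b : ℝ} (h h' : MarkedTorus b) : Prop :=
  ∃ φ : h.carrier ≃ᵢ h'.carrier, (∀ p, transition h h' φ p ∈ bdry ↔ p ∈ bdry) ∧
    (transition h h' φ).HomotopicWith (ContinuousMap.id _) fun k => Set.MapsTo k bdry bdry

theorem TeichEquiv.refl {b : ℝ} (h : MarkedTorus b) : TeichEquiv h h := by
  have e : transition h h (IsometryEquiv.refl _) = ContinuousMap.id _ := by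
    ext1 p
    exact h.marking.symm_apply_apply p
  refine ⟨IsometryEquiv.refl _, ?_, ?_⟩
  · intro p
    rw [e]
    rfl
  · rw [e]
    exact ContinuousMap.HomotopicWith.refl _ fun p hp => hp

theorem TeichEquiv.symm {b : ℝ} {h h' : MarkedTorus b} (H : TeichEquiv h h') :
    TeichEquiv h' h := by
  obtain ⟨φ, hφ, ⟨F⟩⟩ := H
  have e : ∀ p, transition h h' φ (transition h' h φ.symm p) = p := by
    intro p
    simp [transition]
  have hb : ∀ p, transition h' h φ.symm p ∈ bdry ↔ p ∈ bdry := by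
    intro p
    rw [← hφ, e]
  refine ⟨φ.symm, hb, ContinuousMap.HomotopicWith.symm ⟨?_⟩⟩
  refine
    { toFun := fun q => F (q.1, transition h' h φ.symm q.2)
      continuous_toFun := by fun_prop
      map_zero_left := fun p => by simp [e]
      map_one_left := fun p => by simp
      prop' := fun t p hp => F.prop t ((hb p).2 hp) }

theorem TeichEquiv.trans {b : ℝ} {h h' h'' : MarkedTorus b} (H : TeichEquiv h h')
    (H' : TeichEquiv h' h'') : TeichEquiv h h'' := by
  obtain ⟨φ, hφ, ⟨F⟩⟩ := H
  obtain ⟨ψ, hψ, hF'⟩ := H'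
  have e : ∀ p, transition h h'' (φ.trans ψ) p
      = transition h' h'' ψ (transition h h' φ p) := by
    intro p
    simp [transition]
  refine ⟨φ.trans ψ, fun p => by rw [e, hψ, hφ], ContinuousMap.HomotopicWith.trans ⟨?_⟩ hF'⟩
  refine
    { toFun := fun q => transition h' h'' ψ (F q)
      continuous_toFun := by fun_prop
      map_zero_left := fun p => by simp [e]
      map_one_left := fun p => by simp
      prop' := fun t p hp => (hψ _).2 (F.prop t hp) }

instance teichSetoid (b : ℝ) : Setoid (MarkedTorus b) :=
  ⟨TeichEquiv, TeichEquiv.refl, TeichEquiv.symm, TeichEquiv.trans⟩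

/-- The Teichmüller space of hyperbolic one-holed tori with geodesic boundary of length `b`. -/
def Teich (b : ℝ) : Type 1 := Quotient (teichSetoid b)

/-! ### Lengths of homotopy classes -/

/-- The length of the geodesic representative of the closed curve `γ`: the infimum of the lengths
of the closed curves freely homotopic to `γ`. -/
def curveLength {b : ℝ} (h : MarkedTorus b) (γ : C(Circle, OneHoledTorus)) : ℝ≥0∞ :=
  ⨅ (c : C(Circle, OneHoledTorus)) (_ : γ.Homotopic c), loopLength fun z => h.marking (c z)

/-- The length of the orthogeodesic representative of the arc `a`: the infimum of the lengths of
the paths homotopic to `a` relative to the boundary. -/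
def arcLength {b : ℝ} (h : MarkedTorus b) (a : C(unitInterval, OneHoledTorus)) : ℝ≥0∞ :=
  ⨅ (c : C(unitInterval, OneHoledTorus)) (_ : BoundaryHomotopic a c),
    pathLength fun t => h.marking (c t)

theorem marking_transition {b : ℝ} (h h' : MarkedTorus b) (φ : h.carrier ≃ᵢ h'.carrier)
    (p : OneHoledTorus) : h'.marking (transition h h' φ p) = φ (h.marking p) := by
  simp [transition]

theorem eVariationOn_isometry {α X Y : Type} [LinearOrder α] [PseudoEMetricSpace X]
    [PseudoEMetricSpace Y] {φ : X → Y} (hφ : Isometry φ) (f : α → X) (s : Set α) :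
    eVariationOn (fun t => φ (f t)) s = eVariationOn f s := by
  simp only [eVariationOn, hφ.edist_eq]

theorem curveLength_le {b : ℝ} {h h' : MarkedTorus b} (H : TeichEquiv h h')
    (γ : C(Circle, OneHoledTorus)) : curveLength h' γ ≤ curveLength h γ := by
  obtain ⟨φ, -, ⟨F⟩⟩ := H
  refine le_iInf₂ fun c hc => ?_
  have hc' : γ.Homotopic ((transition h h' φ).comp c) := by
    have h1 : ((transition h h' φ).comp c).Homotopic ((ContinuousMap.id _).comp c) :=
      ContinuousMap.Homotopic.comp ⟨F.toHomotopy⟩ (ContinuousMap.Homotopic.refl c)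
    rw [ContinuousMap.id_comp] at h1
    exact hc.trans h1.symm
  refine (iInf₂_le _ hc').trans (le_of_eq ?_)
  simp only [ContinuousMap.comp_apply, marking_transition]
  exact eVariationOn_isometry φ.isometry _ _

theorem arcLength_le {b : ℝ} {h h' : MarkedTorus b} (H : TeichEquiv h h')
    (a : C(unitInterval, OneHoledTorus)) : arcLength h' a ≤ arcLength h a := by
  obtain ⟨φ, -, ⟨F⟩⟩ := H
  refine le_iInf₂ fun c hc => ?_
  have hend : c 0 ∈ bdry ∧ c 1 ∈ bdry := by
    obtain ⟨G⟩ := hc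
    simpa using G.prop 1
  have hc' : BoundaryHomotopic a ((transition h h' φ).comp c) := by
    refine ContinuousMap.HomotopicWith.trans hc (ContinuousMap.HomotopicWith.symm ⟨?_⟩)
    refine
      { toFun := fun q => F (q.1, c q.2)
        continuous_toFun := by fun_prop
        map_zero_left := fun p => by simp
        map_one_left := fun p => by simp
        prop' := fun t => ⟨F.prop t hend.1, F.prop t hend.2⟩ }
  refine (iInf₂_le _ hc').trans (le_of_eq ?_)
  simp only [ContinuousMap.comp_apply, marking_transition]
  exact eVariationOn_isometry φ.isometry _ _

/-- The length of a closed curve as a function on Teichmüller space. -/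
def Teich.curveLength {b : ℝ} (h : Teich b) (γ : C(Circle, OneHoledTorus)) : ℝ≥0∞ :=
  Quotient.lift (fun h => TorusMetrics.curveLength h γ)
    (fun _ _ H => le_antisymm (curveLength_le (TeichEquiv.symm H) γ) (curveLength_le H γ)) h

/-- The length of an arc as a function on Teichmüller space. -/
def Teich.arcLength {b : ℝ} (h : Teich b) (a : C(unitInterval, OneHoledTorus)) : ℝ≥0∞ :=
  Quotient.lift (fun h => TorusMetrics.arcLength h a)
    (fun _ _ H => le_antisymm (arcLength_le (TeichEquiv.symm H) a) (arcLength_le H a)) h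

/-! ### The two metrics -/

/-- The curve metric: the supremum, over the essential simple closed curves, of the logarithm of
the ratio of lengths. -/
def curveMetric {b : ℝ} (h₀ h₁ : Teich b) : EReal :=
  ⨆ (γ : C(Circle, OneHoledTorus)) (_ : IsEssentialSimpleClosedCurve γ),
    ENNReal.log (h₁.curveLength γ / h₀.curveLength γ)

/-- The arc metric: the supremum, over the essential simple arcs and the essential simple closed
curves, of the logarithm of the ratio of lengths. -/
def arcMetric {b : ℝ} (h₀ h₁ : Teich b) : EReal :=
  (⨆ (a : C(unitInterval, OneHoledTorus)) (_ : IsEssentialSimpleArc a),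
    ENNReal.log (h₁.arcLength a / h₀.arcLength a)) ⊔
  ⨆ (γ : C(Circle, OneHoledTorus)) (_ : IsEssentialSimpleClosedCurve γ),
    ENNReal.log (h₁.curveLength γ / h₀.curveLength γ)

end TorusMetrics

end

/-!
Fix `p, q > 0` with `tanh p ^ 2 + tanh q ^ 2 > 1`. In hyperboloid coordinates `T, X, Y` of the
hyperbolic plane, with `s = tanh p` and `t = tanh q`, the walls `|X| = s * T`, `|Y| = t * T` and the
four geodesics `s * |X| + t * |Y| = T` bound a right-angled octagon, and the translations along the
two coordinate axes glue opposite walls. The result is a hyperbolic one-holed torus whose boundary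
length `b` is given by `cosh (b / 4) = sinh p * sinh q`. The same boundary length is obtained from
the swapped pair `(q, p)`.

Curves: since `s ^ 2 + t ^ 2 > 1`, cut-offs `c < s`, `d < t` with `s * c + t * d ≥ 1` exist, and the
parts `|X| > c * T` and `|Y| > d * T` of the octagon are disjoint. Collapsing everything outside
them to the centre maps the torus into the union of the two axes of the swapped torus, in the
homotopy class of the markings, with Lipschitz constant `2 * (q / (s - c) + p / (t - d))`. For fixed
`q` and large `p` this is linear in `p`, so it bounds the growth of all curve lengths by `O(p)`.

Arcs: the arc running along a wall `|X| = s * T` has length at most `4 / cosh p` in the torus of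
`(p, q)`, but at least `1 / 2` in that of `(q, p)`. The growth of its length is therefore
exponential in `p`, and it exceeds the growth of every curve length once `p`, or equivalently `b`,
is large.
-/

noncomputable section

namespace TorusMetrics

open Real (cosh sinh tanh arsinh)

/-! ### Hyperboloid coordinates on the upper half-plane -/

/-- The timelike hyperboloid coordinate of a point of the upper half-plane. -/
def cT (z : ℍ) : ℝ := (z.re ^ 2 + z.im ^ 2 + 1) / (2 * z.im)

/-- The first spacelike hyperboloid coordinate. -/
def cX (z : ℍ) : ℝ := (z.re ^ 2 + z.im ^ 2 - 1) / (2 * z.im)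

/-- The second spacelike hyperboloid coordinate. -/
def cY (z : ℍ) : ℝ := z.re / z.im

lemma cT_pos (z : ℍ) : 0 < cT z := by
  have := z.im_pos
  unfold cT
  positivity

lemma cT_sq (z : ℍ) : cT z ^ 2 = 1 + cX z ^ 2 + cY z ^ 2 := by
  have := z.im_pos.ne'
  unfold cT cX cY
  field_simp
  ring

lemma one_le_cT (z : ℍ) : 1 ≤ cT z := by
  nlinarith [cT_sq z, cT_pos z, sq_nonneg (cX z), sq_nonneg (cY z)]

lemma cosh_dist_eq (z w : ℍ) :
    cosh (dist z w) = cT z * cT w - cX z * cX w - cY z * cY w := by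
  have hz := z.im_pos.ne'
  have hw := w.im_pos.ne'
  rw [UpperHalfPlane.cosh_dist']
  unfold cT cX cY
  field_simp
  ring

lemma cosh_dist_le_cosh_dist {α β : Type*} [PseudoMetricSpace α] [PseudoMetricSpace β]
    {x y : α} {z w : β} : cosh (dist x y) ≤ cosh (dist z w) ↔ dist x y ≤ dist z w := by
  rw [Real.cosh_le_cosh, abs_of_nonneg dist_nonneg, abs_of_nonneg dist_nonneg]

lemma dist_eq_abs_of_cosh_dist_eq {α : Type*} [PseudoMetricSpace α] {x y : α} {a : ℝ}
    (h : cosh (dist x y) = cosh a) : dist x y = |a| := by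
  have hle := Real.cosh_le_cosh.1 h.le
  have hge := Real.cosh_le_cosh.1 h.ge
  rw [abs_of_nonneg dist_nonneg] at hle hge
  exact le_antisymm hle hge

lemma continuous_cT : Continuous cT := by
  unfold cT
  refine Continuous.div ?_ ?_ fun z => (mul_pos two_pos z.im_pos).ne'
  all_goals have := UpperHalfPlane.continuous_re; have := UpperHalfPlane.continuous_im; fun_prop

lemma continuous_cX : Continuous cX := by
  unfold cX
  refine Continuous.div ?_ ?_ fun z => (mul_pos two_pos z.im_pos).ne'
  all_goals have := UpperHalfPlane.continuous_re; have := UpperHalfPlane.continuous_im; fun_prop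

lemma continuous_cY : Continuous cY :=
  UpperHalfPlane.continuous_re.div UpperHalfPlane.continuous_im fun z => z.im_pos.ne'

lemma im_eq_one_div_cT_sub_cX (z : ℍ) : z.im = 1 / (cT z - cX z) := by
  have hz := z.im_pos.ne'
  have hsub : cT z - cX z = 1 / z.im := by
    unfold cT cX
    field_simp
    ring
  rw [hsub, one_div_one_div]

lemma ext_cX_cY {z w : ℍ} (hX : cX z = cX w) (hY : cY z = cY w) : z = w := by
  have hT : cT z = cT w := by
    have h := cT_sq z
    rw [hX, hY, ← cT_sq w] at h
    exact (pow_left_inj₀ (cT_pos z).le (cT_pos w).le two_ne_zero).1 h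
  have him : z.im = w.im := by rw [im_eq_one_div_cT_sub_cX, im_eq_one_div_cT_sub_cX, hX, hT]
  have hre : z.re = w.re := by
    rw [cY, cY, him] at hY
    exact (div_left_inj' w.im_pos.ne').1 hY
  exact UpperHalfPlane.ext (Complex.ext hre him)

lemma sqrt_one_add_sq_add_sq_sub_pos (x y : ℝ) : 0 < √(1 + x ^ 2 + y ^ 2) - x := by
  rw [sub_pos]
  refine lt_of_abs_lt ?_
  rw [← Real.sqrt_sq_eq_abs]
  exact Real.sqrt_lt_sqrt (sq_nonneg x) (by nlinarith only [sq_nonneg y])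

/-- The point of the upper half-plane with given spacelike hyperboloid coordinates. -/
def ofCoords (x y : ℝ) : ℍ :=
  UpperHalfPlane.mk ⟨y / (√(1 + x ^ 2 + y ^ 2) - x), 1 / (√(1 + x ^ 2 + y ^ 2) - x)⟩
    (one_div_pos.2 (sqrt_one_add_sq_add_sq_sub_pos x y))

lemma re_ofCoords (x y : ℝ) : (ofCoords x y).re = y / (√(1 + x ^ 2 + y ^ 2) - x) := rfl

lemma im_ofCoords (x y : ℝ) : (ofCoords x y).im = 1 / (√(1 + x ^ 2 + y ^ 2) - x) := rfl

@[simp] lemma cX_ofCoords (x y : ℝ) : cX (ofCoords x y) = x := by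
  have h := (sqrt_one_add_sq_add_sq_sub_pos x y).ne'
  have hsqrt : √(1 + x ^ 2 + y ^ 2) ^ 2 = 1 + x ^ 2 + y ^ 2 := Real.sq_sqrt (by positivity)
  rw [cX, re_ofCoords, im_ofCoords]
  field_simp
  linear_combination -hsqrt

@[simp] lemma cY_ofCoords (x y : ℝ) : cY (ofCoords x y) = y := by
  have h := (sqrt_one_add_sq_add_sq_sub_pos x y).ne'
  rw [cY, re_ofCoords, im_ofCoords]
  field_simp

lemma cT_ofCoords {x y c : ℝ} (hc : 0 ≤ c) (h : c ^ 2 = 1 + x ^ 2 + y ^ 2) :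
    cT (ofCoords x y) = c := by
  refine (pow_left_inj₀ (cT_pos _).le hc two_ne_zero).1 ?_
  rw [cT_sq, h, cX_ofCoords, cY_ofCoords]

lemma ofCoords_cX_cY (z : ℍ) : ofCoords (cX z) (cY z) = z :=
  ext_cX_cY (cX_ofCoords _ _) (cY_ofCoords _ _)

lemma continuous_ofCoords : Continuous fun v : ℝ × ℝ => ofCoords v.1 v.2 := by
  have h : Continuous fun v : ℝ × ℝ => √(1 + v.1 ^ 2 + v.2 ^ 2) - v.1 := by fun_prop
  have hne : ∀ v : ℝ × ℝ, √(1 + v.1 ^ 2 + v.2 ^ 2) - v.1 ≠ 0 := fun v =>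
    (sqrt_one_add_sq_add_sq_sub_pos _ _).ne'
  refine Continuous.upperHalfPlaneMk (f := fun v : ℝ × ℝ =>
    (⟨v.2 / (√(1 + v.1 ^ 2 + v.2 ^ 2) - v.1), 1 / (√(1 + v.1 ^ 2 + v.2 ^ 2) - v.1)⟩ : ℂ)) ?_ _
  exact Complex.equivRealProdCLM.symm.continuous.comp
    ((continuous_snd.div h hne).prodMk (continuous_const.div h hne))

@[simp] lemma cX_I : cX UpperHalfPlane.I = 0 := by simp [cX]

@[simp] lemma cY_I : cY UpperHalfPlane.I = 0 := by simp [cY]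

lemma mem_halfPlane_iff (z : ℍ) : z ∈ halfPlane ↔ 0 ≤ cY z := by
  rw [halfPlane, Set.mem_ofPred_eq, cY, le_div_iff₀ z.im_pos, zero_mul]

lemma abs_cX_lt_cT (z : ℍ) : |cX z| < cT z :=
  abs_lt_of_sq_lt_sq (by nlinarith [cT_sq z, sq_nonneg (cY z)]) (cT_pos z).le

lemma abs_cY_lt_cT (z : ℍ) : |cY z| < cT z :=
  abs_lt_of_sq_lt_sq (by nlinarith [cT_sq z, sq_nonneg (cX z)]) (cT_pos z).le

/-! ### Isometries in hyperboloid coordinates -/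

lemma isometry_of_coords {f : ℍ → ℍ} (h : ∀ z w,
    cT (f z) * cT (f w) - cX (f z) * cX (f w) - cY (f z) * cY (f w)
      = cT z * cT w - cX z * cX w - cY z * cY w) : Isometry f := by
  refine Isometry.of_dist_eq fun z w => ?_
  rw [dist_eq_abs_of_cosh_dist_eq (a := dist z w) (by rw [cosh_dist_eq, cosh_dist_eq, h]),
    abs_of_nonneg dist_nonneg]

/-- The Lorentz boost of rapidity `a` in the direction of `cX`, as a map of the upper
half-plane. -/
def boostFun (a : ℝ) (z : ℍ) : ℍ := ofCoords (cosh a * cX z + sinh a * cT z) (cY z)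

lemma cX_boostFun (a : ℝ) (z : ℍ) : cX (boostFun a z) = cosh a * cX z + sinh a * cT z :=
  cX_ofCoords _ _

lemma cY_boostFun (a : ℝ) (z : ℍ) : cY (boostFun a z) = cY z := cY_ofCoords _ _

lemma cT_boostFun (a : ℝ) (z : ℍ) : cT (boostFun a z) = cosh a * cT z + sinh a * cX z := by
  refine cT_ofCoords ?_ (by linear_combination cT_sq z + (cT z ^ 2 - cX z ^ 2) * Real.cosh_sq a)
  have hsinh : |sinh a| ≤ cosh a :=
    abs_le_of_sq_le_sq (by linarith [Real.cosh_sq a]) (Real.cosh_pos a).le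
  have hmul : |sinh a * cX z| ≤ cosh a * cT z := by
    rw [abs_mul]
    exact mul_le_mul hsinh (abs_cX_lt_cT z).le (abs_nonneg _) (Real.cosh_pos a).le
  linarith [neg_abs_le (sinh a * cX z)]

lemma boostFun_neg_boostFun (a : ℝ) (z : ℍ) : boostFun (-a) (boostFun a z) = z := by
  refine ext_cX_cY ?_ ?_
  · rw [cX_boostFun, cX_boostFun, cT_boostFun, Real.cosh_neg, Real.sinh_neg]
    linear_combination cX z * Real.cosh_sq a
  · rw [cY_boostFun, cY_boostFun]

/-- The translation by `a` along the geodesic `cY = 0`. -/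
def boostX (a : ℝ) : ℍ ≃ᵢ ℍ where
  toFun := boostFun a
  invFun := boostFun (-a)
  left_inv := boostFun_neg_boostFun a
  right_inv z := by simpa using boostFun_neg_boostFun (-a) z
  isometry_toFun := isometry_of_coords fun z w => by
    rw [cT_boostFun, cX_boostFun, cY_boostFun, cT_boostFun, cX_boostFun, cY_boostFun]
    linear_combination (cT z * cT w - cX z * cX w) * Real.cosh_sq a

@[simp] lemma cX_boostX (a : ℝ) (z : ℍ) : cX (boostX a z) = cosh a * cX z + sinh a * cT z :=
  cX_boostFun a z

@[simp] lemma cY_boostX (a : ℝ) (z : ℍ) : cY (boostX a z) = cY z := cY_boostFun a z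

@[simp] lemma cT_boostX (a : ℝ) (z : ℍ) : cT (boostX a z) = cosh a * cT z + sinh a * cX z :=
  cT_boostFun a z

lemma boostX_inv (a : ℝ) : (boostX a)⁻¹ = boostX (-a) :=
  inv_eq_of_mul_eq_one_left (IsometryEquiv.ext fun z => boostFun_neg_boostFun a z)

/-- The rotation by `a` in the plane of the two spacelike coordinates, as a map of the upper
half-plane. -/
def rotFun (a : ℝ) (z : ℍ) : ℍ :=
  ofCoords (Real.cos a * cX z - Real.sin a * cY z) (Real.sin a * cX z + Real.cos a * cY z)

lemma cX_rotFun (a : ℝ) (z : ℍ) : cX (rotFun a z) = Real.cos a * cX z - Real.sin a * cY z :=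
  cX_ofCoords _ _

lemma cY_rotFun (a : ℝ) (z : ℍ) : cY (rotFun a z) = Real.sin a * cX z + Real.cos a * cY z :=
  cY_ofCoords _ _

lemma cT_rotFun (a : ℝ) (z : ℍ) : cT (rotFun a z) = cT z :=
  cT_ofCoords (cT_pos z).le
    (by linear_combination cT_sq z - (cX z ^ 2 + cY z ^ 2) * Real.sin_sq_add_cos_sq a)

lemma rotFun_neg_rotFun (a : ℝ) (z : ℍ) : rotFun (-a) (rotFun a z) = z := by
  refine ext_cX_cY ?_ ?_
  · rw [cX_rotFun, cX_rotFun, cY_rotFun, Real.cos_neg, Real.sin_neg]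
    linear_combination cX z * Real.sin_sq_add_cos_sq a
  · rw [cY_rotFun, cX_rotFun, cY_rotFun, Real.cos_neg, Real.sin_neg]
    linear_combination cY z * Real.sin_sq_add_cos_sq a

/-- The rotation about `I` by the angle `a`. -/
def rotXY (a : ℝ) : ℍ ≃ᵢ ℍ where
  toFun := rotFun a
  invFun := rotFun (-a)
  left_inv := rotFun_neg_rotFun a
  right_inv z := by simpa using rotFun_neg_rotFun (-a) z
  isometry_toFun := isometry_of_coords fun z w => by
    rw [cT_rotFun, cX_rotFun, cY_rotFun, cT_rotFun, cX_rotFun, cY_rotFun]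
    linear_combination -(cX z * cX w + cY z * cY w) * Real.sin_sq_add_cos_sq a

@[simp] lemma cX_rotXY (a : ℝ) (z : ℍ) :
    cX (rotXY a z) = Real.cos a * cX z - Real.sin a * cY z := cX_rotFun a z

@[simp] lemma cY_rotXY (a : ℝ) (z : ℍ) :
    cY (rotXY a z) = Real.sin a * cX z + Real.cos a * cY z := cY_rotFun a z

@[simp] lemma cT_rotXY (a : ℝ) (z : ℍ) : cT (rotXY a z) = cT z := cT_rotFun a z

/-- The reflection in the geodesic `cX = cY`. -/
def swapXY : ℍ ≃ᵢ ℍ where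
  toFun z := ofCoords (cY z) (cX z)
  invFun z := ofCoords (cY z) (cX z)
  left_inv z := ext_cX_cY (by simp) (by simp)
  right_inv z := ext_cX_cY (by simp) (by simp)
  isometry_toFun := isometry_of_coords fun z w => by
    have h : ∀ z, cT (ofCoords (cY z) (cX z)) = cT z := fun z =>
      cT_ofCoords (cT_pos z).le (by linear_combination cT_sq z)
    simp only [h, cX_ofCoords, cY_ofCoords]
    ring

@[simp] lemma cX_swapXY (z : ℍ) : cX (swapXY z) = cY z := cX_ofCoords _ _

@[simp] lemma cY_swapXY (z : ℍ) : cY (swapXY z) = cX z := cY_ofCoords _ _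

@[simp] lemma cT_swapXY (z : ℍ) : cT (swapXY z) = cT z :=
  cT_ofCoords (cT_pos z).le (by linear_combination cT_sq z)

lemma swapXY_swapXY (z : ℍ) : swapXY (swapXY z) = z := ext_cX_cY (by simp) (by simp)

/-- The reflection in the geodesic `cX = 0`. -/
def reflX : ℍ ≃ᵢ ℍ := swapXY.trans (rotXY (Real.pi / 2))

@[simp] lemma cX_reflX (z : ℍ) : cX (reflX z) = -cX z := by simp [reflX]

@[simp] lemma cY_reflX (z : ℍ) : cY (reflX z) = cY z := by simp [reflX]

@[simp] lemma cT_reflX (z : ℍ) : cT (reflX z) = cT z := by simp [reflX]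

lemma reflX_reflX (z : ℍ) : reflX (reflX z) = z := ext_cX_cY (by simp) (by simp)

/-- The reflection in the geodesic `cY = 0`. -/
def reflY : ℍ ≃ᵢ ℍ := (rotXY (Real.pi / 2)).trans swapXY

@[simp] lemma cX_reflY (z : ℍ) : cX (reflY z) = cX z := by simp [reflY]

@[simp] lemma cY_reflY (z : ℍ) : cY (reflY z) = -cY z := by simp [reflY]

@[simp] lemma cT_reflY (z : ℍ) : cT (reflY z) = cT z := by simp [reflY]

/-- The translation by `a` along the geodesic `cX = 0`. -/
def boostY (a : ℝ) : ℍ ≃ᵢ ℍ := swapXY * boostX a * swapXY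

@[simp] lemma cX_boostY (a : ℝ) (z : ℍ) : cX (boostY a z) = cX z := by simp [boostY]

@[simp] lemma cY_boostY (a : ℝ) (z : ℍ) : cY (boostY a z) = cosh a * cY z + sinh a * cT z := by
  simp [boostY]

/-! ### Distance estimates and geodesics -/

/-- The function `arsinh ∘ cX` is the signed distance to the geodesic `cX = 0`. -/
lemma abs_arsinh_cX_sub_le_dist (z w : ℍ) : |arsinh (cX z) - arsinh (cX w)| ≤ dist z w := by
  rw [← abs_of_nonneg (dist_nonneg (x := z) (y := w)), ← Real.cosh_le_cosh, cosh_dist_eq,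
    Real.cosh_sub, Real.cosh_arsinh, Real.cosh_arsinh, Real.sinh_arsinh, Real.sinh_arsinh,
    ← Real.sqrt_mul (by positivity)]
  have hY : cY z * cY w ≤ cT z * cT w := by
    refine (le_abs_self _).trans ?_
    rw [abs_mul]
    exact mul_le_mul (abs_cY_lt_cT z).le (abs_cY_lt_cT w).le (abs_nonneg _) (cT_pos z).le
  have hsqrt : √((1 + cX z ^ 2) * (1 + cX w ^ 2)) ≤ cT z * cT w - cY z * cY w := by
    have hz : 1 + cX z ^ 2 = cT z ^ 2 - cY z ^ 2 := by linear_combination -cT_sq z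
    have hw : 1 + cX w ^ 2 = cT w ^ 2 - cY w ^ 2 := by linear_combination -cT_sq w
    rw [Real.sqrt_le_left (by linarith), hz, hw]
    nlinarith only [sq_nonneg (cT z * cY w - cY z * cT w)]
  linarith

lemma abs_arsinh_cY_sub_le_dist (z w : ℍ) : |arsinh (cY z) - arsinh (cY w)| ≤ dist z w := by
  simpa [swapXY.isometry.dist_eq] using abs_arsinh_cX_sub_le_dist (swapXY z) (swapXY w)

lemma dist_eq_abs_arsinh_cX_sub {z w : ℍ} (hz : cY z = 0) (hw : cY w = 0) :
    dist z w = |arsinh (cX z) - arsinh (cX w)| := by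
  refine dist_eq_abs_of_cosh_dist_eq ?_
  have hTz : 1 + cX z ^ 2 = cT z ^ 2 := by rw [cT_sq, hz]; ring
  have hTw : 1 + cX w ^ 2 = cT w ^ 2 := by rw [cT_sq, hw]; ring
  rw [cosh_dist_eq, Real.cosh_sub, Real.cosh_arsinh, Real.cosh_arsinh, Real.sinh_arsinh,
    Real.sinh_arsinh, hTz, hTw, Real.sqrt_sq (cT_pos z).le, Real.sqrt_sq (cT_pos w).le, hz]
  ring

/-- The coefficient with which an end point of a geodesic segment of length `D` enters the point
that divides the segment in the ratio `τ : 1 - τ`, in the hyperboloid model. -/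
def geodesicWeight (D τ : ℝ) : ℝ := sinh (τ * D) / sinh D

lemma geodesicWeight_nonneg {D τ : ℝ} (hD : 0 ≤ D) (hτ : 0 ≤ τ) : 0 ≤ geodesicWeight D τ :=
  div_nonneg (Real.sinh_nonneg_iff.2 (mul_nonneg hτ hD)) (Real.sinh_nonneg_iff.2 hD)

lemma geodesicWeight_zero (D : ℝ) : geodesicWeight D 0 = 0 := by simp [geodesicWeight]

lemma geodesicWeight_one {D : ℝ} (hD : D ≠ 0) : geodesicWeight D 1 = 1 := by
  rw [geodesicWeight, one_mul, div_self (Real.sinh_ne_zero.2 hD)]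

lemma geodesicWeight_form {D : ℝ} (hD : D ≠ 0) (σ τ : ℝ) :
    geodesicWeight D (1 - σ) * geodesicWeight D (1 - τ) + geodesicWeight D σ * geodesicWeight D τ
      + (geodesicWeight D (1 - σ) * geodesicWeight D τ
        + geodesicWeight D σ * geodesicWeight D (1 - τ)) * cosh D = cosh ((σ - τ) * D) := by
  have hS : sinh D ≠ 0 := Real.sinh_ne_zero.2 hD
  simp only [geodesicWeight, sub_mul, one_mul, Real.sinh_sub, Real.cosh_sub]
  generalize σ * D = x
  generalize τ * D = y
  field_simp
  linear_combination (-sinh x * sinh y) * Real.cosh_sq D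

/-- The geodesic from `u` to `v`, parametrized by `[0, 1]` with constant speed. For `u = v` both
weights are `0 / 0 = 0`, so that this is not the constant path at `u`. -/
def geodesic (u v : ℍ) (τ : ℝ) : ℍ :=
  ofCoords (geodesicWeight (dist u v) (1 - τ) * cX u + geodesicWeight (dist u v) τ * cX v)
    (geodesicWeight (dist u v) (1 - τ) * cY u + geodesicWeight (dist u v) τ * cY v)

lemma geodesic_zero {u v : ℍ} (huv : u ≠ v) : geodesic u v 0 = u := by
  simp [geodesic, geodesicWeight_zero, geodesicWeight_one (dist_ne_zero.2 huv), ofCoords_cX_cY]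

lemma geodesic_one {u v : ℍ} (huv : u ≠ v) : geodesic u v 1 = v := by
  simp [geodesic, geodesicWeight_zero, geodesicWeight_one (dist_ne_zero.2 huv), ofCoords_cX_cY]

lemma cT_geodesic {u v : ℍ} (huv : u ≠ v) {τ : ℝ} (hτ : τ ∈ Set.Icc (0 : ℝ) 1) :
    cT (geodesic u v τ)
      = geodesicWeight (dist u v) (1 - τ) * cT u + geodesicWeight (dist u v) τ * cT v := by
  refine cT_ofCoords ?_ ?_
  · exact add_nonneg
      (mul_nonneg (geodesicWeight_nonneg dist_nonneg (sub_nonneg.2 hτ.2)) (cT_pos u).le)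
      (mul_nonneg (geodesicWeight_nonneg dist_nonneg hτ.1) (cT_pos v).le)
  · have hform := geodesicWeight_form (dist_ne_zero.2 huv) τ τ
    rw [sub_self, zero_mul, Real.cosh_zero] at hform
    linear_combination hform + geodesicWeight (dist u v) (1 - τ) ^ 2 * cT_sq u
      + geodesicWeight (dist u v) τ ^ 2 * cT_sq v
      - 2 * geodesicWeight (dist u v) (1 - τ) * geodesicWeight (dist u v) τ * cosh_dist_eq u v

lemma dist_geodesic {u v : ℍ} (huv : u ≠ v) {σ τ : ℝ} (hσ : σ ∈ Set.Icc (0 : ℝ) 1)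
    (hτ : τ ∈ Set.Icc (0 : ℝ) 1) :
    dist (geodesic u v σ) (geodesic u v τ) = |σ - τ| * dist u v := by
  have habs : |σ - τ| * dist u v = |(σ - τ) * dist u v| := by
    rw [abs_mul, abs_of_nonneg (dist_nonneg (x := u) (y := v))]
  rw [habs]
  refine dist_eq_abs_of_cosh_dist_eq ?_
  rw [cosh_dist_eq, cT_geodesic huv hσ, cT_geodesic huv hτ,
    ← geodesicWeight_form (dist_ne_zero.2 huv)]
  simp only [geodesic, cX_ofCoords, cY_ofCoords]
  linear_combination
    geodesicWeight (dist u v) (1 - σ) * geodesicWeight (dist u v) (1 - τ) * cT_sq u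
      + geodesicWeight (dist u v) σ * geodesicWeight (dist u v) τ * cT_sq v
      - (geodesicWeight (dist u v) (1 - σ) * geodesicWeight (dist u v) τ
        + geodesicWeight (dist u v) σ * geodesicWeight (dist u v) (1 - τ)) * cosh_dist_eq u v

lemma exists_geodesic (u v : ℍ) : ∃ γ : ℝ → ℍ, γ 0 = u ∧ γ 1 = v ∧
    (∀ σ ∈ Set.Icc (0 : ℝ) 1, ∀ τ ∈ Set.Icc (0 : ℝ) 1,
      dist (γ σ) (γ τ) = |σ - τ| * dist u v) ∧
    ∀ τ ∈ Set.Icc (0 : ℝ) 1, ∃ a b : ℝ, 0 ≤ a ∧ 0 ≤ b ∧ cT (γ τ) = a * cT u + b * cT v ∧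
      cX (γ τ) = a * cX u + b * cX v ∧ cY (γ τ) = a * cY u + b * cY v := by
  rcases eq_or_ne u v with rfl | huv
  · exact ⟨fun _ => u, rfl, rfl, by simp, fun τ _ => ⟨1, 0, by simp⟩⟩
  · exact ⟨geodesic u v, geodesic_zero huv, geodesic_one huv,
      fun σ hσ τ hτ => dist_geodesic huv hσ hτ, fun τ hτ =>
        ⟨_, _, geodesicWeight_nonneg dist_nonneg (sub_nonneg.2 hτ.2),
          geodesicWeight_nonneg dist_nonneg hτ.1, cT_geodesic huv hτ, cX_ofCoords _ _,
          cY_ofCoords _ _⟩⟩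

/-! ### Gluing a domain by finitely many isometries -/

lemma pathLength_trans_le {X : Type} [PseudoEMetricSpace X] {x y z : X} (γ : Path x y)
    (γ' : Path y z) : pathLength (γ.trans γ') ≤ pathLength γ + pathLength γ' := by
  let m : unitInterval := ⟨1 / 2, by norm_num, by norm_num⟩
  have hu : (Set.univ : Set unitInterval) = Set.Iic m ∪ Set.Ici m := Set.Iic_union_Ici.symm
  rw [pathLength, hu, eVariationOn.union _ isGreatest_Iic isLeast_Ici]
  refine add_le_add ?_ ?_
  · refine le_trans (le_of_eq ?_) (eVariationOn.comp_le_of_monotoneOn (γ : unitInterval → X)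
      (t := Set.Iic m) (fun t => Set.projIcc 0 1 zero_le_one (2 * (t : ℝ))) ?_
      (Set.mapsTo_univ _ _))
    · refine eVariationOn.eq_of_eqOn fun t ht => ?_
      have ht : (t : ℝ) ≤ 1 / 2 := ht
      simp only [Path.trans, Path.coe_mk_mk, Function.comp_apply, if_pos ht]
      rfl
    · intro a _ b _ hab
      exact Set.monotone_projIcc _ (mul_le_mul_of_nonneg_left hab two_pos.le)
  · refine le_trans (le_of_eq ?_) (eVariationOn.comp_le_of_monotoneOn (γ' : unitInterval → X)
      (t := Set.Ici m) (fun t => Set.projIcc 0 1 zero_le_one (2 * (t : ℝ) - 1)) ?_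
      (Set.mapsTo_univ _ _))
    · refine eVariationOn.eq_of_eqOn fun t ht => ?_
      have ht : (1 / 2 : ℝ) ≤ t := ht
      rcases eq_or_lt_of_le ht with hmid | hlt
      · have h_one : (2 : ℝ) * t = 1 := by rw [← hmid]; norm_num
        simp [Path.trans, h_one]
      · simp only [Path.trans, Path.coe_mk_mk, Function.comp_apply, if_neg hlt.not_ge]
        rfl
    · intro a _ b _ hab
      have hab : (a : ℝ) ≤ b := hab
      exact Set.monotone_projIcc _ (by linarith)

lemma dist_inv_apply {H : Type} [MetricSpace H] (g : H ≃ᵢ H) (x y : H) :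
    dist x (g⁻¹ y) = dist y (g x) := by
  rw [← g.dist_eq, IsometryEquiv.apply_inv_self, dist_comm]

/-- A subset of a metric space with a finite set of isometries that glue it to its neighbours,
in such a way that the neighbours of any point fit together at the scale `ε`. The set `G` need not
be a group: it is closed only under those products that occur among neighbours of one point. -/
structure Gluing (H : Type) [MetricSpace H] where
  dom : Set H
  G : Set (H ≃ᵢ H)
  finite : G.Finite
  one_mem : 1 ∈ G
  inv_mem : ∀ g ∈ G, g⁻¹ ∈ G
  ε : ℝ
  ε_pos : 0 < ε
  mul_mem : ∀ x ∈ dom, ∀ y ∈ dom, ∀ z ∈ dom, ∀ g ∈ G, ∀ h ∈ G,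
    dist x (g y) < ε → dist y (h z) < ε → g * h ∈ G
  eq_one : ∀ z ∈ dom, ∀ g ∈ G, dist z (g z) < ε → g = 1

namespace Gluing

variable {H : Type} [MetricSpace H] (D : Gluing H)

/-- The distance between two points through one of the gluing isometries. -/
def preDist (x y : D.dom) : NNReal := ⨅ g : D.G, nndist x.1 (g.1 y.1)

lemma preDist_le (x y : D.dom) {g : H ≃ᵢ H} (hg : g ∈ D.G) :
    (D.preDist x y : ℝ) ≤ dist x.1 (g y.1) := by
  rw [← coe_nndist]
  exact NNReal.coe_le_coe.2 (ciInf_le (OrderBot.bddBelow _) (⟨g, hg⟩ : D.G))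

lemma exists_preDist_eq (x y : D.dom) : ∃ g ∈ D.G, (D.preDist x y : ℝ) = dist x.1 (g y.1) := by
  have : Finite D.G := D.finite
  have : Nonempty D.G := ⟨⟨1, D.one_mem⟩⟩
  obtain ⟨g, hg⟩ := exists_eq_ciInf_of_finite (f := fun g : D.G => nndist x.1 (g.1 y.1))
  exact ⟨g.1, g.2, by rw [preDist, ← hg, coe_nndist]⟩

lemma preDist_self (x : D.dom) : D.preDist x x = 0 := by
  refine le_antisymm (NNReal.coe_le_coe.1 ((D.preDist_le x x D.one_mem).trans ?_)) bot_le
  simp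

lemma preDist_comm (x y : D.dom) : D.preDist x y = D.preDist y x := by
  have hle : ∀ x y, D.preDist x y ≤ D.preDist y x := by
    intro x y
    obtain ⟨g, hg, hyx⟩ := D.exists_preDist_eq y x
    rw [← NNReal.coe_le_coe, hyx]
    exact (D.preDist_le x y (D.inv_mem g hg)).trans_eq (dist_inv_apply _ _ _)
  exact le_antisymm (hle x y) (hle y x)

/-- The glued pseudometric on the domain: the infimum of the lengths of chains, in which each link
is measured by `preDist`. -/
@[reducible] def gluedPseudoMetric : PseudoMetricSpace D.dom :=
  PseudoMetricSpace.ofPreNNDist D.preDist D.preDist_self D.preDist_comm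

/-- The length of a chain from `x` to `y` through the points of `l`. -/
def chainSum (x : D.dom) (l : List D.dom) (y : D.dom) : NNReal :=
  ((x :: l).zipWith D.preDist (l ++ [y])).sum

lemma chainSum_nil (x y : D.dom) : D.chainSum x [] y = D.preDist x y := by simp [chainSum]

lemma chainSum_cons (x a : D.dom) (l : List D.dom) (y : D.dom) :
    D.chainSum x (a :: l) y = D.preDist x a + D.chainSum a l y := by
  rw [chainSum, List.cons_append, List.zipWith_cons_cons, List.sum_cons]
  rfl

/-- The glued space: the metric quotient of the glued pseudometric. -/
def Space : Type :=
  @SeparationQuotient D.dom D.gluedPseudoMetric.toUniformSpace.toTopologicalSpace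

instance : MetricSpace D.Space :=
  @SeparationQuotient.instMetricSpace D.dom D.gluedPseudoMetric

/-- The projection of the domain to the glued space. -/
def proj (x : D.dom) : D.Space :=
  @SeparationQuotient.mk D.dom D.gluedPseudoMetric.toUniformSpace.toTopologicalSpace x

lemma proj_surjective : Function.Surjective D.proj :=
  @SeparationQuotient.surjective_mk D.dom D.gluedPseudoMetric.toUniformSpace.toTopologicalSpace

lemma dist_proj (x y : D.dom) : dist (D.proj x) (D.proj y) =
    ((⨅ l : List D.dom, D.chainSum x l y : NNReal) : ℝ) := rfl

lemma dist_proj_le {g : H ≃ᵢ H} (hg : g ∈ D.G) (x y : D.dom) :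
    dist (D.proj x) (D.proj y) ≤ dist x.1 (g y.1) :=
  (PseudoMetricSpace.dist_ofPreNNDist_le _ D.preDist_self D.preDist_comm _ _).trans
    (D.preDist_le x y hg)

lemma dist_proj_le_dist (x y : D.dom) : dist (D.proj x) (D.proj y) ≤ dist x.1 y.1 :=
  D.dist_proj_le D.one_mem x y

lemma continuous_proj : Continuous D.proj :=
  (LipschitzWith.of_dist_le_mul (K := 1) fun x y => by
    rw [NNReal.coe_one, one_mul]
    exact D.dist_proj_le_dist x y).continuous

lemma exists_chainSum_lt {x y : D.dom} {c : ℝ} (hc : dist (D.proj x) (D.proj y) < c) :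
    ∃ l, (D.chainSum x l y : ℝ) < c := by
  rw [dist_proj, NNReal.coe_iInf] at hc
  exact exists_lt_of_ciInf_lt hc

lemma le_dist_proj {ρ : D.dom → D.dom → ℝ} (htri : ∀ x y z, ρ x z ≤ ρ x y + ρ y z)
    (hG : ∀ x y : D.dom, ∀ g ∈ D.G, ρ x y ≤ dist x.1 (g y.1)) (x y : D.dom) :
    ρ x y ≤ dist (D.proj x) (D.proj y) := by
  have hpre : ∀ x y : D.dom, ρ x y ≤ D.preDist x y := fun x y => by
    obtain ⟨g, hg, hxy⟩ := D.exists_preDist_eq x y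
    exact (hG x y g hg).trans hxy.ge
  have hchain : ∀ (l : List D.dom) (x : D.dom), ρ x y ≤ D.chainSum x l y := by
    intro l
    induction l with
    | nil => intro x; rw [chainSum_nil]; exact hpre x y
    | cons a l ih =>
      intro x
      rw [chainSum_cons, NNReal.coe_add]
      exact (htri x a y).trans (add_le_add (hpre x a) (ih a))
  rw [dist_proj, NNReal.coe_iInf]
  exact le_ciInf fun l => hchain l x

/-- Below the scale `ε` the isometries of two consecutive links compose inside `G`, so that chains
cannot be shorter than single links. -/
lemma preDist_le_chainSum {y : D.dom} (l : List D.dom) :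
    ∀ x : D.dom, (D.chainSum x l y : ℝ) < D.ε → (D.preDist x y : ℝ) ≤ D.chainSum x l y := by
  induction l with
  | nil => intro x _; rw [chainSum_nil]
  | cons a l ih =>
    intro x hx
    rw [chainSum_cons, NNReal.coe_add] at hx ⊢
    have hxa : (D.preDist x a : ℝ) < D.ε := by linarith [(D.chainSum a l y).coe_nonneg]
    have hchain := ih a (by linarith [(D.preDist x a).coe_nonneg])
    refine le_trans ?_ (add_le_add_right hchain _)
    have hay : (D.preDist a y : ℝ) < D.ε := by linarith [(D.preDist x a).coe_nonneg]
    obtain ⟨g, hg, hgdist⟩ := D.exists_preDist_eq x a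
    obtain ⟨k, hk, hkdist⟩ := D.exists_preDist_eq a y
    have hgk := D.mul_mem x.1 x.2 a.1 a.2 y.1 y.2 g hg k hk (hgdist ▸ hxa) (hkdist ▸ hay)
    refine (D.preDist_le x y hgk).trans ?_
    rw [hgdist, hkdist, ← g.dist_eq a.1]
    exact dist_triangle _ _ _

lemma exists_dist_proj_eq {x y : D.dom} (hxy : dist (D.proj x) (D.proj y) < D.ε) :
    ∃ g ∈ D.G, dist (D.proj x) (D.proj y) = dist x.1 (g y.1) := by
  obtain ⟨g, hg, hgdist⟩ := D.exists_preDist_eq x y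
  refine ⟨g, hg, le_antisymm (D.dist_proj_le hg x y) ?_⟩
  rw [← hgdist]
  refine le_of_forall_gt fun c hc => ?_
  obtain ⟨l, hl⟩ := D.exists_chainSum_lt (lt_min hxy hc)
  exact (D.preDist_le_chainSum l x (hl.trans_le (min_le_left _ _))).trans_lt
    (hl.trans_le (min_le_right _ _))

lemma proj_eq_iff {x y : D.dom} : D.proj x = D.proj y ↔ ∃ g ∈ D.G, x.1 = g y.1 := by
  constructor
  · intro h
    have hzero : dist (D.proj x) (D.proj y) = 0 := dist_eq_zero.2 h
    obtain ⟨g, hg, hgdist⟩ := D.exists_dist_proj_eq (hzero ▸ D.ε_pos)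
    exact ⟨g, hg, dist_eq_zero.1 (hgdist ▸ hzero)⟩
  · rintro ⟨g, hg, hxy⟩
    refine dist_le_zero.1 ((D.dist_proj_le hg x y).trans_eq ?_)
    rw [hxy, dist_self]

section LengthMetric

variable (hpath : ∀ x y : D.dom, ∀ g ∈ D.G, ∃ γ : Path (D.proj x) (D.proj y),
  pathLength γ ≤ ENNReal.ofReal (dist x.1 (g y.1)))
include hpath

lemma exists_path_le_chainSum {y : D.dom} (l : List D.dom) :
    ∀ x : D.dom, ∃ γ : Path (D.proj x) (D.proj y),
      pathLength γ ≤ ENNReal.ofReal (D.chainSum x l y) := by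
  induction l with
  | nil =>
    intro x
    obtain ⟨g, hg, hgdist⟩ := D.exists_preDist_eq x y
    obtain ⟨γ, hγ⟩ := hpath x y g hg
    exact ⟨γ, hγ.trans_eq (by rw [chainSum_nil, hgdist])⟩
  | cons a l ih =>
    intro x
    obtain ⟨g, hg, hgdist⟩ := D.exists_preDist_eq x a
    obtain ⟨γ, hγ⟩ := hpath x a g hg
    obtain ⟨γ', hγ'⟩ := ih a
    refine ⟨γ.trans γ', (pathLength_trans_le γ γ').trans ?_⟩
    rw [chainSum_cons, NNReal.coe_add,
      ENNReal.ofReal_add (NNReal.coe_nonneg _) (NNReal.coe_nonneg _), hgdist]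
    exact add_le_add hγ hγ'

lemma exists_path_le_dist_add (x y : D.Space) {η : ℝ} (hη : 0 < η) :
    ∃ γ : Path x y, pathLength γ ≤ ENNReal.ofReal (dist x y + η) := by
  obtain ⟨x, rfl⟩ := D.proj_surjective x
  obtain ⟨y, rfl⟩ := D.proj_surjective y
  obtain ⟨l, hl⟩ := D.exists_chainSum_lt (lt_add_of_pos_right (dist (D.proj x) (D.proj y)) hη)
  obtain ⟨γ, hγ⟩ := D.exists_path_le_chainSum hpath l x
  exact ⟨γ, hγ.trans (ENNReal.ofReal_le_ofReal hl.le)⟩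

end LengthMetric

/-- The union of the domain and its neighbouring copies. -/
def star : Set H := {u | ∃ g ∈ D.G, ∃ y ∈ D.dom, g y = u}

section Chart

variable {r : ℝ} (hr : 4 * r ≤ D.ε)
include hr

lemma mul_eq_of_dist_lt {x y z : D.dom} {g h k : H ≃ᵢ H} (hg : g ∈ D.G) (hh : h ∈ D.G)
    (hk : k ∈ D.G) (hxy : dist x.1 (g y.1) < r) (hxz : dist x.1 (h z.1) < r)
    (hyz : dist y.1 (k z.1) < 2 * r) : g * k = h := by
  have hr0 : 0 < r := dist_nonneg.trans_lt hxy
  have hgk := D.mul_mem x.1 x.2 y.1 y.2 z.1 z.2 g hg k hk (by linarith) (by linarith)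
  have hxgk : dist x.1 ((g * k) z.1) < 3 * r := by
    have htri := dist_triangle x.1 (g y.1) (g (k z.1))
    rw [g.dist_eq] at htri
    rw [IsometryEquiv.mul_apply]
    linarith
  have hzx : dist z.1 (h⁻¹ x.1) < D.ε := by
    rw [dist_inv_apply]
    linarith
  have hmem := D.mul_mem z.1 z.2 x.1 x.2 z.1 z.2 _ (D.inv_mem h hh) _ hgk hzx (by linarith)
  refine (inv_mul_eq_one.1 (D.eq_one z.1 z.2 _ hmem ?_)).symm
  rw [IsometryEquiv.mul_apply, dist_inv_apply, dist_comm]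
  linarith [dist_triangle_left (h z.1) ((g * k) z.1) x.1]

lemma dist_proj_eq_of_dist_lt {x y z : D.dom} {g h : H ≃ᵢ H} (hg : g ∈ D.G) (hh : h ∈ D.G)
    (hxy : dist x.1 (g y.1) < r) (hxz : dist x.1 (h z.1) < r) :
    dist (D.proj y) (D.proj z) = dist (g y.1) (h z.1) := by
  have hr0 : 0 < r := dist_nonneg.trans_lt hxy
  have hyx : dist y.1 (g⁻¹ x.1) < D.ε := by
    rw [dist_inv_apply]
    linarith
  have hgh : dist (g y.1) (h z.1) < 2 * r := by
    linarith [dist_triangle_left (g y.1) (h z.1) x.1]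
  have hle : dist (D.proj y) (D.proj z) ≤ dist (g y.1) (h z.1) := by
    refine (D.dist_proj_le (D.mul_mem y.1 y.2 x.1 x.2 z.1 z.2 _ (D.inv_mem g hg) h hh hyx
      (by linarith)) y z).trans_eq ?_
    rw [IsometryEquiv.mul_apply, dist_inv_apply, dist_comm]
  obtain ⟨k, hk, hkdist⟩ := D.exists_dist_proj_eq (x := y) (y := z) (by linarith)
  rw [hkdist, ← D.mul_eq_of_dist_lt hr hg hh hk hxy hxz (by linarith), IsometryEquiv.mul_apply,
    g.dist_eq]

lemma exists_chart (hr0 : 0 < r) (x : D.dom) :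
    ∃ φ : D.Space → H, φ (D.proj x) = x.1 ∧
      (∀ y ∈ Metric.ball (D.proj x) r, ∀ z ∈ Metric.ball (D.proj x) r,
        dist (φ y) (φ z) = dist y z) ∧
      φ '' Metric.ball (D.proj x) r = Metric.ball x.1 r ∩ D.star := by
  have hlift : ∀ y : D.Space, ∃ u : H, y ∈ Metric.ball (D.proj x) r →
      dist x.1 u < r ∧ ∃ g ∈ D.G, ∃ y' : D.dom, D.proj y' = y ∧ u = g y'.1 := by
    intro y
    by_cases hy : y ∈ Metric.ball (D.proj x) r
    · obtain ⟨y', rfl⟩ := D.proj_surjective y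
      rw [Metric.mem_ball, dist_comm] at hy
      obtain ⟨g, hg, hgdist⟩ := D.exists_dist_proj_eq (x := x) (y := y') (by linarith)
      exact ⟨g y'.1, fun _ => ⟨hgdist ▸ hy, g, hg, y', rfl, rfl⟩⟩
    · exact ⟨x.1, fun h => absurd h hy⟩
  choose φ hφ using hlift
  have hφ_proj : ∀ (y : D.dom), ∀ g ∈ D.G, dist x.1 (g y.1) < r → φ (D.proj y) = g y.1 := by
    intro y g hg hxy
    have hmem : D.proj y ∈ Metric.ball (D.proj x) r := by
      rw [Metric.mem_ball, dist_comm]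
      exact (D.dist_proj_le hg x y).trans_lt hxy
    obtain ⟨hlt, h, hh, z, hzy, hφz⟩ := hφ _ hmem
    have hdist := D.dist_proj_eq_of_dist_lt hr hg hh hxy (hφz ▸ hlt)
    rw [hzy, dist_self] at hdist
    rw [hφz]
    exact (dist_eq_zero.1 hdist.symm).symm
  refine ⟨φ, hφ_proj x 1 D.one_mem (by simpa using hr0), ?_, Set.Subset.antisymm ?_ ?_⟩
  · intro y hy z hz
    obtain ⟨hylt, g, hg, y', rfl, hφy⟩ := hφ y hy
    obtain ⟨hzlt, h, hh, z', rfl, hφz⟩ := hφ z hz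
    rw [hφy, hφz, D.dist_proj_eq_of_dist_lt hr hg hh (hφy ▸ hylt) (hφz ▸ hzlt)]
  · rintro _ ⟨y, hy, rfl⟩
    obtain ⟨hlt, g, hg, y', -, hφy⟩ := hφ y hy
    exact ⟨by rwa [Metric.mem_ball, dist_comm], g, hg, y'.1, y'.2, hφy.symm⟩
  · rintro _ ⟨hball, g, hg, y, hy, rfl⟩
    rw [Metric.mem_ball, dist_comm] at hball
    refine ⟨D.proj ⟨y, hy⟩, ?_, hφ_proj ⟨y, hy⟩ g hg hball⟩
    rw [Metric.mem_ball, dist_comm]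
    exact (D.dist_proj_le hg x ⟨y, hy⟩).trans_lt hball

end Chart

end Gluing

/-! ### The right-angled octagon -/

lemma tanh_pos {a : ℝ} (ha : 0 < a) : 0 < tanh a := by
  rw [Real.tanh_eq_sinh_div_cosh]
  exact div_pos (Real.sinh_pos_iff.2 ha) (Real.cosh_pos a)

lemma abs_mul_add_mul_le {a b : ℝ} (ha : 0 ≤ a) (hb : 0 ≤ b) (x y : ℝ) :
    |a * x + b * y| ≤ a * |x| + b * |y| := by
  refine (abs_add_le _ _).trans (le_of_eq ?_)
  rw [abs_mul, abs_mul, abs_of_nonneg ha, abs_of_nonneg hb]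

/-- The shape of a rectangular one-holed torus. Opposite walls of its fundamental octagon are
paired by translations of length `2 * p` along the horizontal axis and `2 * q` along the vertical
one; `one_lt` says that adjacent walls do not meet. -/
structure Shape where
  p : ℝ
  q : ℝ
  p_pos : 0 < p
  q_pos : 0 < q
  one_lt : 1 < tanh p ^ 2 + tanh q ^ 2

namespace Shape

variable (S : Shape)

/-- The shape with the two translation lengths exchanged. -/
def swap : Shape := ⟨S.q, S.p, S.q_pos, S.p_pos, by rw [add_comm]; exact S.one_lt⟩

/-- The Klein coordinate of the right wall. -/
def s : ℝ := tanh S.p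

/-- The Klein coordinate of the upper wall. -/
def t : ℝ := tanh S.q

lemma swap_p : S.swap.p = S.q := rfl
lemma swap_s : S.swap.s = S.t := rfl
lemma swap_t : S.swap.t = S.s := rfl

lemma s_pos : 0 < S.s := tanh_pos S.p_pos
lemma t_pos : 0 < S.t := tanh_pos S.q_pos
lemma s_lt_one : S.s < 1 := Real.tanh_lt_one _
lemma t_lt_one : S.t < 1 := Real.tanh_lt_one _
lemma one_lt_sq_add_sq : 1 < S.s ^ 2 + S.t ^ 2 := S.one_lt

lemma sinh_p : sinh S.p = S.s * cosh S.p := by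
  rw [s, Real.tanh_eq_sinh_div_cosh, div_mul_cancel₀ _ (Real.cosh_pos _).ne']

lemma cosh_two_p : cosh (2 * S.p) = 1 + S.s * sinh (2 * S.p) := by
  rw [Real.cosh_two_mul, Real.sinh_two_mul]
  linear_combination Real.cosh_sq S.p + 2 * sinh S.p * S.sinh_p

lemma sinh_two_p : sinh (2 * S.p) = S.s * (1 + cosh (2 * S.p)) := by
  rw [Real.cosh_two_mul, Real.sinh_two_mul]
  linear_combination 2 * cosh S.p * S.sinh_p + S.s * Real.cosh_sq S.p

/-- The right-angled octagon bounded by the four walls `|X| = s * T`, `|Y| = t * T` and the four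
boundary geodesics `s * |X| + t * |Y| = T`. -/
def oct : Set ℍ :=
  {z | |cX z| ≤ S.s * cT z ∧ |cY z| ≤ S.t * cT z ∧ S.s * |cX z| + S.t * |cY z| ≤ cT z}

lemma reflX_mem_oct {z : ℍ} : reflX z ∈ S.oct ↔ z ∈ S.oct := by
  simp [oct]

lemma swapXY_mem_oct {z : ℍ} : swapXY z ∈ S.swap.oct ↔ z ∈ S.oct := by
  simp only [oct, Set.mem_ofPred_eq, cX_swapXY, cY_swapXY, cT_swapXY, swap_s, swap_t]
  rw [add_comm (S.t * |cY z|)]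
  tauto

lemma exists_geodesic_oct {u v : ℍ} (hu : u ∈ S.oct) (hv : v ∈ S.oct) : ∃ γ : ℝ → ℍ,
    γ 0 = u ∧ γ 1 = v ∧ (∀ σ ∈ Set.Icc (0 : ℝ) 1, ∀ τ ∈ Set.Icc (0 : ℝ) 1,
      dist (γ σ) (γ τ) = |σ - τ| * dist u v) ∧ ∀ τ ∈ Set.Icc (0 : ℝ) 1, γ τ ∈ S.oct := by
  obtain ⟨γ, hγ0, hγ1, hdist, hcomb⟩ := exists_geodesic u v
  refine ⟨γ, hγ0, hγ1, hdist, fun τ hτ => ?_⟩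
  obtain ⟨a, b, ha, hb, eT, eX, eY⟩ := hcomb τ hτ
  have hX : |cX (γ τ)| ≤ a * |cX u| + b * |cX v| := eX ▸ abs_mul_add_mul_le ha hb _ _
  have hY : |cY (γ τ)| ≤ a * |cY u| + b * |cY v| := eY ▸ abs_mul_add_mul_le ha hb _ _
  refine ⟨?_, ?_, ?_⟩ <;> rw [eT]
  · linarith [mul_le_mul_of_nonneg_left hu.1 ha, mul_le_mul_of_nonneg_left hv.1 hb]
  · linarith [mul_le_mul_of_nonneg_left hu.2.1 ha, mul_le_mul_of_nonneg_left hv.2.1 hb]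
  · linarith [mul_le_mul_of_nonneg_left hu.2.2 ha, mul_le_mul_of_nonneg_left hv.2.2 hb,
      mul_le_mul_of_nonneg_left hX S.s_pos.le, mul_le_mul_of_nonneg_left hY S.t_pos.le]

/-! ### The side pairings -/

/-- The translation that pairs the left wall with the right wall. -/
def trA : ℍ ≃ᵢ ℍ := boostX (2 * S.p)

/-- The translation that pairs the lower wall with the upper wall. -/
def trB : ℍ ≃ᵢ ℍ := boostY (2 * S.q)

lemma trB_apply (z : ℍ) : S.trB z = swapXY (S.swap.trA (swapXY z)) := rfl

lemma dist_trB (x y : ℍ) : dist x (S.trB y) = dist (swapXY x) (S.swap.trA (swapXY y)) := by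
  rw [trB_apply, ← swapXY.dist_eq, swapXY_swapXY]

lemma cY_trA (z : ℍ) : cY (S.trA z) = cY z := cY_boostX _ _

lemma cX_sub_trA (z : ℍ) : cX (S.trA z) - S.s * cT (S.trA z) = cX z + S.s * cT z := by
  rw [trA, cX_boostX, cT_boostX]
  linear_combination cX z * S.cosh_two_p + cT z * S.sinh_two_p

lemma cT_sub_trA (z : ℍ) : cT (S.trA z) - S.s * cX (S.trA z) = cT z + S.s * cX z := by
  rw [trA, cX_boostX, cT_boostX]
  linear_combination cT z * S.cosh_two_p + cX z * S.sinh_two_p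

lemma trA_reflX_eq {z : ℍ} (hz : cX z = S.s * cT z) : S.trA (reflX z) = z := by
  refine ext_cX_cY ?_ ?_
  · rw [trA, cX_boostX, cX_reflX, cT_reflX]
    linear_combination cT z * S.sinh_two_p - (1 + cosh (2 * S.p)) * hz
  · rw [cY_trA, cY_reflX]

/-- The four side pairings: the first entry of the index selects the axis, the second one the
direction. -/
def pairing : Bool × Bool → ℍ ≃ᵢ ℍ
  | (false, true) => S.trA
  | (false, false) => S.trA⁻¹
  | (true, true) => S.trB
  | (true, false) => S.trB⁻¹

/-- The index of the inverse side pairing, hence of the opposite wall. -/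
def opp (i : Bool × Bool) : Bool × Bool := (i.1, !i.2)

/-- A function that is nonnegative on the inner side of a wall and vanishes on the wall. -/
def gap : Bool × Bool → ℍ → ℝ
  | (false, true), z => S.s * cT z - cX z
  | (false, false), z => S.s * cT z + cX z
  | (true, true), z => S.t * cT z - cY z
  | (true, false), z => S.t * cT z + cY z

lemma pairing_opp (i : Bool × Bool) : S.pairing (opp i) = (S.pairing i)⁻¹ := by
  rcases i with ⟨_ | _, _ | _⟩ <;> simp [pairing, opp]

lemma opp_ne (i : Bool × Bool) : opp i ≠ i := by
  rcases i with ⟨_ | _, _ | _⟩ <;> simp [opp]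

lemma gap_nonneg (i : Bool × Bool) {z : ℍ} (hz : z ∈ S.oct) : 0 ≤ S.gap i z := by
  have hX := abs_le.1 hz.1
  have hY := abs_le.1 hz.2.1
  rcases i with ⟨_ | _, _ | _⟩ <;> simp only [gap] <;> linarith

lemma gap_pairing (i : Bool × Bool) (z : ℍ) : S.gap i (S.pairing i z) = -S.gap (opp i) z := by
  have hA := S.cX_sub_trA
  have hB := fun z => S.swap.cX_sub_trA (swapXY z)
  rcases i with ⟨_ | _, _ | _⟩ <;> simp only [gap, pairing, opp, Bool.not_true, Bool.not_false]
  · have := hA (S.trA⁻¹ z)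
    rw [IsometryEquiv.apply_inv_self] at this
    linarith
  · linarith [hA z]
  · have := hB (S.trB⁻¹ z)
    have hz : S.swap.trA (swapXY (S.trB⁻¹ z)) = swapXY z := by
      rw [← swapXY_swapXY (S.swap.trA (swapXY (S.trB⁻¹ z))), ← trB_apply,
        IsometryEquiv.apply_inv_self]
    rw [hz] at this
    simp only [cX_swapXY, cT_swapXY, swap_s] at this
    linarith
  · have := hB z
    simp only [trB_apply, cY_swapXY, cT_swapXY, cX_swapXY, swap_s] at this ⊢
    linarith

lemma abs_arsinh_gap_right_sub_le_dist (z w : ℍ) :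
    |arsinh (cosh S.p * (S.s * cT z - cX z)) -
      arsinh (cosh S.p * (S.s * cT w - cX w))| ≤ dist z w := by
  have hgap : ∀ z, cosh S.p * (S.s * cT z - cX z) = -cX (boostX (-S.p) z) := fun z => by
    rw [cX_boostX, Real.cosh_neg, Real.sinh_neg, S.sinh_p]
    ring
  have := abs_arsinh_cX_sub_le_dist (boostX (-S.p) z) (boostX (-S.p) w)
  rw [(boostX (-S.p)).dist_eq] at this
  rw [hgap, hgap, Real.arsinh_neg, Real.arsinh_neg, neg_sub_neg, abs_sub_comm]
  exact this

lemma exists_abs_arsinh_mul_gap_sub_le_dist (i : Bool × Bool) : ∃ c : ℝ, 1 ≤ c ∧ ∀ z w,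
    |arsinh (c * S.gap i z) - arsinh (c * S.gap i w)| ≤ dist z w := by
  rcases i with ⟨_ | _, _ | _⟩ <;> simp only [gap]
  · refine ⟨_, Real.one_le_cosh S.p, fun z w => ?_⟩
    have := S.abs_arsinh_gap_right_sub_le_dist (reflX z) (reflX w)
    simpa only [cX_reflX, cT_reflX, sub_neg_eq_add, reflX.dist_eq] using this
  · exact ⟨_, Real.one_le_cosh S.p, S.abs_arsinh_gap_right_sub_le_dist⟩
  · refine ⟨_, Real.one_le_cosh S.q, fun z w => ?_⟩
    have := S.swap.abs_arsinh_gap_right_sub_le_dist (reflX (swapXY z)) (reflX (swapXY w))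
    rw [swap_s, swap_p] at this
    simpa only [cX_reflX, cT_reflX, sub_neg_eq_add, reflX.dist_eq, swapXY.dist_eq, cX_swapXY,
      cT_swapXY] using this
  · refine ⟨_, Real.one_le_cosh S.q, fun z w => ?_⟩
    have := S.swap.abs_arsinh_gap_right_sub_le_dist (swapXY z) (swapXY w)
    rw [swap_s, swap_p] at this
    simpa only [swapXY.dist_eq, cX_swapXY, cT_swapXY] using this

/-- The excess of the shape: a lower bound for the sum of two distinct gaps on the octagon, which
is positive because the walls are pairwise disjoint. -/
def excess : ℝ := S.s ^ 2 + S.t ^ 2 - 1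

lemma excess_pos : 0 < S.excess := sub_pos.2 S.one_lt_sq_add_sq

lemma gap_lt_of_dist_pairing_lt (i : Bool × Bool) {x y : ℍ} (hx : x ∈ S.oct) (hy : y ∈ S.oct)
    (h : dist x (S.pairing i y) < arsinh (S.excess / 2)) : S.gap i x < S.excess / 2 := by
  obtain ⟨c, hc, hlip⟩ := S.exists_abs_arsinh_mul_gap_sub_le_dist i
  have hle := (le_abs_self _).trans (hlip x (S.pairing i y))
  have hbeyond : arsinh (c * S.gap i (S.pairing i y)) ≤ 0 := by
    rw [Real.arsinh_nonpos_iff, gap_pairing]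
    have := S.gap_nonneg (opp i) hy
    nlinarith
  have hlt : c * S.gap i x < S.excess / 2 := Real.arsinh_lt_arsinh.1 (by linarith)
  exact (le_mul_of_one_le_left (S.gap_nonneg i hx) hc).trans_lt hlt

lemma excess_le_gap_add_gap {i j : Bool × Bool} (hij : i ≠ j) {x : ℍ} (hx : x ∈ S.oct) :
    S.excess ≤ S.gap i x + S.gap j x := by
  have hs := S.s_pos
  have ht := S.t_pos
  have hs1 := S.s_lt_one
  have ht1 := S.t_lt_one
  have hT := one_le_cT x
  have hX := abs_le.1 hx.1
  have hY := abs_le.1 hx.2.1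
  have hcorner := hx.2.2
  have hexcess : S.excess = S.s ^ 2 + S.t ^ 2 - 1 := rfl
  have hleT : S.excess ≤ S.excess * cT x := le_mul_of_one_le_right S.excess_pos.le hT
  have hle_s : S.excess ≤ S.s * cT x := by nlinarith
  have hle_t : S.excess ≤ S.t * cT x := by nlinarith
  have hadjacent : S.excess * cT x ≤ S.s * (S.s * cT x - |cX x|) + S.t * (S.t * cT x - |cY x|) := by
    rw [hexcess]
    linarith
  have hgapX : S.s * (S.s * cT x - |cX x|) ≤ S.s * cT x - |cX x| :=
    mul_le_of_le_one_left (sub_nonneg.2 hx.1) hs1.le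
  have hgapY : S.t * (S.t * cT x - |cY x|) ≤ S.t * cT x - |cY x| :=
    mul_le_of_le_one_left (sub_nonneg.2 hx.2.1) ht1.le
  have hX_le := abs_le.1 (le_refl |cX x|)
  have hY_le := abs_le.1 (le_refl |cY x|)
  rcases i with ⟨_ | _, _ | _⟩ <;> rcases j with ⟨_ | _, _ | _⟩ <;> simp only [gap] <;>
    first | exact absurd rfl hij | linarith

lemma eq_of_gap_lt {i j : Bool × Bool} {x : ℍ} (hx : x ∈ S.oct) (hi : S.gap i x < S.excess / 2)
    (hj : S.gap j x < S.excess / 2) : i = j := by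
  by_contra hij
  linarith [S.excess_le_gap_add_gap hij hx]

/-- The gluing of the octagon by its side pairings. -/
def gluing : Gluing ℍ where
  dom := S.oct
  G := insert 1 (Set.range S.pairing)
  finite := (Set.finite_range _).insert _
  one_mem := Set.mem_insert _ _
  inv_mem := by
    rintro g (rfl | ⟨i, rfl⟩)
    · exact Or.inl inv_one
    · exact Or.inr ⟨opp i, S.pairing_opp i⟩
  ε := arsinh (S.excess / 2)
  ε_pos := Real.arsinh_pos_iff.2 (half_pos S.excess_pos)
  mul_mem := by
    rintro x hx y hy z hz g (rfl | ⟨i, rfl⟩) h hh hxy hyz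
    · rwa [one_mul]
    rcases hh with rfl | ⟨j, rfl⟩
    · exact Or.inr ⟨i, (mul_one _).symm⟩
    have hi := S.gap_lt_of_dist_pairing_lt (opp i) hy hx (by rwa [pairing_opp, dist_inv_apply])
    have hj := S.gap_lt_of_dist_pairing_lt j hy hz hyz
    rw [← S.eq_of_gap_lt hy hi hj, pairing_opp, mul_inv_cancel]
    exact Or.inl rfl
  eq_one := by
    rintro z hz g (rfl | ⟨i, rfl⟩) h
    · rfl
    have hi := S.gap_lt_of_dist_pairing_lt i hz hz h
    have hopp := S.gap_lt_of_dist_pairing_lt (opp i) hz hz (by rwa [pairing_opp, dist_inv_apply])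
    exact absurd (S.eq_of_gap_lt hz hopp hi) (opp_ne i)

/-- The hyperbolic one-holed torus of the given shape. -/
abbrev Surface : Type := S.gluing.Space

lemma gluing_induction {P : Shape → ℍ → ℍ → (ℍ ≃ᵢ ℍ) → Prop}
    (one : ∀ S x y, x ∈ S.oct → y ∈ S.oct → P S x y 1)
    (trA : ∀ S x y, x ∈ S.oct → y ∈ S.oct → P S x y S.trA)
    (inv : ∀ S x y g, P S x y g → P S y x g⁻¹)
    (swap : ∀ S x y, P S.swap (swapXY x) (swapXY y) S.swap.trA → P S x y S.trB)
    (S : Shape) {x y : ℍ} (hx : x ∈ S.oct) (hy : y ∈ S.oct) {g : ℍ ≃ᵢ ℍ} (hg : g ∈ S.gluing.G) :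
    P S x y g := by
  have hB : ∀ S x y, x ∈ S.oct → y ∈ S.oct → P S x y S.trB := fun S x y hx hy =>
    swap S x y (trA _ _ _ (S.swapXY_mem_oct.2 hx) (S.swapXY_mem_oct.2 hy))
  rcases hg with rfl | ⟨⟨_ | _, _ | _⟩, rfl⟩
  · exact one S x y hx hy
  · exact inv _ _ _ _ (trA S y x hy hx)
  · exact trA S x y hx hy
  · exact inv _ _ _ _ (hB S y x hy hx)
  · exact hB S x y hx hy

lemma continuousOn_of_dist_eq_abs_sub_mul {X : Type*} [PseudoMetricSpace X] {γ : ℝ → X}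
    {I : Set ℝ} {d : ℝ} (hγ : ∀ σ ∈ I, ∀ τ ∈ I, dist (γ σ) (γ τ) = |σ - τ| * d) :
    ContinuousOn γ I := by
  refine (LipschitzOnWith.of_dist_le_mul (K := d.toNNReal) fun σ hσ τ hτ => ?_).continuousOn
  rw [hγ σ hσ τ hτ, mul_comm, Real.dist_eq]
  exact mul_le_mul_of_nonneg_right (Real.le_coe_toNNReal d) (abs_nonneg _)

lemma abs_cY_lt_of_cX_eq {z : ℍ} (hX : cX z = S.s * cT z)
    (hcorner : S.s * cX z + S.t * |cY z| ≤ cT z) : |cY z| < S.t * cT z := by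
  rw [hX] at hcorner
  have := S.one_lt_sq_add_sq
  have := cT_pos z
  refine lt_of_mul_lt_mul_left ?_ S.t_pos.le
  nlinarith

lemma mem_oct_of_cX_eq {z : ℍ} (hX : cX z = S.s * cT z)
    (hcorner : S.s * cX z + S.t * |cY z| ≤ cT z) : z ∈ S.oct := by
  have habs : |cX z| = S.s * cT z := by rw [hX, abs_of_pos (mul_pos S.s_pos (cT_pos z))]
  exact ⟨habs.le, (S.abs_cY_lt_of_cX_eq hX hcorner).le, by rwa [habs, ← hX]⟩

lemma conic_comb_trA_mem_oct {x y w : ℍ} (hx : x ∈ S.oct) (hy : y ∈ S.oct) {a b : ℝ} (ha : 0 ≤ a)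
    (hb : 0 ≤ b) (eT : cT w = a * cT x + b * cT (S.trA y))
    (eX : cX w = a * cX x + b * cX (S.trA y)) (eY : cY w = a * cY x + b * cY (S.trA y))
    (hw : cX w = S.s * cT w) : w ∈ S.oct := by
  refine S.mem_oct_of_cX_eq hw ?_
  have hs := S.s_pos
  have hY : |cY w| ≤ a * |cY x| + b * |cY y| := by
    rw [eY, cY_trA]
    exact abs_mul_add_mul_le ha hb _ _
  have hcorner_x : S.s * cX x + S.t * |cY x| ≤ cT x := by
    linarith [hx.2.2, mul_le_mul_of_nonneg_left (le_abs_self (cX x)) hs.le]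
  have hcorner_y : S.s * cX (S.trA y) + S.t * |cY y| ≤ cT (S.trA y) := by
    linarith [hy.2.2, mul_le_mul_of_nonneg_left (neg_abs_le (cX y)) hs.le, S.cT_sub_trA y]
  rw [eX, eT]
  linarith [mul_le_mul_of_nonneg_left hY S.t_pos.le, mul_le_mul_of_nonneg_left hcorner_x ha,
    mul_le_mul_of_nonneg_left hcorner_y hb]

lemma exists_crossing_trA {x y : ℍ} (hx : x ∈ S.oct) (hy : y ∈ S.oct) :
    ∃ w ∈ S.oct, ∃ w' ∈ S.oct, w = S.trA w' ∧
      dist x (S.trA y) = dist x w + dist w' y := by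
  obtain ⟨γ, hγ0, hγ1, hdist, hcomb⟩ := exists_geodesic x (S.trA y)
  have hgap : ContinuousOn (fun τ => S.s * cT (γ τ) - cX (γ τ)) (Set.Icc 0 1) :=
    ((continuous_const.mul continuous_cT).sub continuous_cX).comp_continuousOn
      (continuousOn_of_dist_eq_abs_sub_mul hdist)
  have hsign : (0 : ℝ) ∈ Set.Icc (S.s * cT (γ 1) - cX (γ 1)) (S.s * cT (γ 0) - cX (γ 0)) := by
    rw [hγ0, hγ1]
    constructor
    · linarith [S.cX_sub_trA y, (abs_le.1 hy.1).1]
    · linarith [(abs_le.1 hx.1).2]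
  obtain ⟨τ, hτ, hwall⟩ := intermediate_value_Icc' zero_le_one hgap hsign
  have hX : cX (γ τ) = S.s * cT (γ τ) := (sub_eq_zero.1 hwall).symm
  obtain ⟨a, b, ha, hb, eT, eX, eY⟩ := hcomb τ hτ
  have hmem : γ τ ∈ S.oct := S.conic_comb_trA_mem_oct hx hy ha hb eT eX eY hX
  have hγτ : S.trA (reflX (γ τ)) = γ τ := S.trA_reflX_eq hX
  have hleft := hdist 0 ⟨le_rfl, zero_le_one⟩ τ hτ
  have hright := hdist τ hτ 1 ⟨zero_le_one, le_rfl⟩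
  rw [hγ0, zero_sub, abs_neg, abs_of_nonneg hτ.1] at hleft
  rw [hγ1, abs_sub_comm, abs_of_nonneg (sub_nonneg.2 hτ.2)] at hright
  refine ⟨γ τ, hmem, reflX (γ τ), S.reflX_mem_oct.2 hmem, hγτ.symm, ?_⟩
  rw [← S.trA.dist_eq (reflX (γ τ)) y, hγτ, hleft, hright]
  ring

lemma exists_crossing {x y : ℍ} (hx : x ∈ S.oct) (hy : y ∈ S.oct) {g : ℍ ≃ᵢ ℍ}
    (hg : g ∈ S.gluing.G) : ∃ w ∈ S.oct, ∃ w' ∈ S.oct, w = g w' ∧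
      dist x (g y) = dist x w + dist w' y := by
  refine gluing_induction (P := fun S x y g => ∃ w ∈ S.oct, ∃ w' ∈ S.oct, w = g w' ∧
      dist x (g y) = dist x w + dist w' y) ?_ (fun S _ _ => S.exists_crossing_trA) ?_ ?_ S hx hy hg
  · intro S x y hx _
    exact ⟨x, hx, x, hx, rfl, by simp⟩
  · rintro S x y g ⟨w, hw, w', hw', e, h⟩
    refine ⟨w', hw', w, hw, by rw [e, IsometryEquiv.inv_apply_self], ?_⟩
    rw [dist_inv_apply, h, dist_comm x w, dist_comm w' y, add_comm]
  · rintro S x y ⟨w, hw, w', hw', e, h⟩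
    refine ⟨swapXY w, ?_, swapXY w', ?_, ?_, ?_⟩
    · rwa [← S.swapXY_mem_oct, swapXY_swapXY]
    · rwa [← S.swapXY_mem_oct, swapXY_swapXY]
    · rw [trB_apply, swapXY_swapXY, e]
    · rw [dist_trB, h, ← swapXY.dist_eq x, ← swapXY.dist_eq _ y, swapXY_swapXY, swapXY_swapXY]

end Shape

/-! ### Folding -/

/-- The folding of the hyperbolic plane onto the first quadrant. It does not increase distances and
is compatible with the side pairings, hence gives lower bounds for the glued distance. -/
def fold (z : ℍ) : ℍ := ofCoords |cX z| |cY z|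

@[simp] lemma cX_fold (z : ℍ) : cX (fold z) = |cX z| := cX_ofCoords _ _
@[simp] lemma cY_fold (z : ℍ) : cY (fold z) = |cY z| := cY_ofCoords _ _
@[simp] lemma cT_fold (z : ℍ) : cT (fold z) = cT z :=
  cT_ofCoords (cT_pos z).le (by rw [sq_abs, sq_abs, cT_sq])

lemma dist_fold_le (z w : ℍ) : dist (fold z) (fold w) ≤ dist z w := by
  refine cosh_dist_le_cosh_dist.1 ?_
  rw [cosh_dist_eq, cosh_dist_eq]
  simp only [cX_fold, cY_fold, cT_fold, ← abs_mul]
  linarith [le_abs_self (cX z * cX w), le_abs_self (cY z * cY w)]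

lemma dist_fold_eq {z w : ℍ} (hX : 0 ≤ cX z * cX w) (hY : 0 ≤ cY z * cY w) :
    dist (fold z) (fold w) = dist z w := by
  rw [← abs_of_nonneg (dist_nonneg (x := z) (y := w))]
  refine dist_eq_abs_of_cosh_dist_eq ?_
  rw [cosh_dist_eq, cosh_dist_eq]
  simp only [cX_fold, cY_fold, cT_fold, ← abs_mul, abs_of_nonneg hX, abs_of_nonneg hY]

lemma fold_reflX (z : ℍ) : fold (reflX z) = fold z := ext_cX_cY (by simp) (by simp)

lemma fold_swapXY (z : ℍ) : fold (swapXY z) = swapXY (fold z) := ext_cX_cY (by simp) (by simp)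

namespace Shape

variable (S : Shape)

lemma dist_reflX_le_dist_trA {x y : ℍ} (hx : x ∈ S.oct) (hy : y ∈ S.oct) :
    dist x (reflX y) ≤ dist x (S.trA y) := by
  refine cosh_dist_le_cosh_dist.1 ?_
  rw [cosh_dist_eq, cosh_dist_eq, cX_reflX, cY_reflX, cT_reflX, cY_trA, trA, cX_boostX, cT_boostX,
    ← sub_nonneg]
  have hgap : 0 ≤ (1 + cosh (2 * S.p)) * ((S.s * cT x - cX x) * (S.s * cT y + cX y)) := by
    have := abs_le.1 hx.1
    have := abs_le.1 hy.1
    have := Real.cosh_pos (2 * S.p)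
    exact mul_nonneg (by linarith) (mul_nonneg (by linarith) (by linarith))
  refine hgap.trans (le_of_eq ?_)
  linear_combination (S.s * cT x * cT y - (cX x * cT y - cT x * cX y)) * (-S.sinh_two_p) -
    cT x * cT y * S.cosh_two_p

lemma dist_fold_le_dist_gluing {x y : ℍ} (hx : x ∈ S.oct) (hy : y ∈ S.oct) {g : ℍ ≃ᵢ ℍ}
    (hg : g ∈ S.gluing.G) : dist (fold x) (fold y) ≤ dist x (g y) := by
  refine gluing_induction (P := fun _ x y g => dist (fold x) (fold y) ≤ dist x (g y))
    ?_ ?_ ?_ ?_ S hx hy hg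
  · exact fun _ x y _ _ => dist_fold_le x y
  · intro S x y hx hy
    rw [← fold_reflX y]
    exact (dist_fold_le x _).trans (S.dist_reflX_le_dist_trA hx hy)
  · intro _ x y g h
    rwa [dist_inv_apply, dist_comm]
  · intro _ x y h
    rwa [fold_swapXY, fold_swapXY, swapXY.dist_eq, ← dist_trB] at h

lemma dist_fold_le_dist_proj (x y : S.gluing.dom) :
    dist (fold x.1) (fold y.1) ≤ dist (S.gluing.proj x) (S.gluing.proj y) :=
  S.gluing.le_dist_proj (ρ := fun x y => dist (fold x.1) (fold y.1))
    (fun _ _ _ => dist_triangle _ _ _)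
    (fun x y _ hg => S.dist_fold_le_dist_gluing x.2 y.2 hg) x y

lemma dist_proj_eq {x y : S.gluing.dom} (hX : 0 ≤ cX x.1 * cX y.1) (hY : 0 ≤ cY x.1 * cY y.1) :
    dist (S.gluing.proj x) (S.gluing.proj y) = dist x.1 y.1 :=
  le_antisymm (S.gluing.dist_proj_le_dist x y)
    ((dist_fold_eq hX hY).ge.trans (S.dist_fold_le_dist_proj x y))

end Shape

/-! ### The length structure -/

lemma eVariationOn_unitInterval_of_monotone {f : unitInterval → ℝ} (hf : Monotone f) :
    eVariationOn f Set.univ = ENNReal.ofReal (f 1 - f 0) := by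
  have hIcc : (Set.univ : Set unitInterval) ∩ Set.Icc 0 1 = Set.univ :=
    Set.inter_eq_left.2 fun _ _ => ⟨unitInterval.nonneg', unitInterval.le_one'⟩
  have hvar := (hf.monotoneOn Set.univ).eVariationOn_eq (Set.mem_univ 0) (Set.mem_univ 1)
  rwa [hIcc] at hvar

lemma pathLength_le_of_lipschitzWith {X : Type} [PseudoEMetricSpace X] {K : NNReal}
    {γ : unitInterval → X} (hγ : LipschitzWith K γ) : pathLength γ ≤ K := by
  have hle := (hγ.lipschitzOnWith (s := Set.univ)).comp_eVariationOn_le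
    (g := fun τ : unitInterval => τ) (s := Set.univ) (Set.mapsTo_univ _ _)
  refine hle.trans ?_
  have hid : eVariationOn (fun τ : unitInterval => τ) Set.univ = 1 := by
    have hmono : Monotone fun τ : unitInterval => (τ : ℝ) := fun _ _ hle => hle
    exact (eVariationOn_unitInterval_of_monotone hmono).trans (by simp)
  rw [hid, mul_one]

namespace Shape

variable (S : Shape)

lemma exists_path_of_oct (x y : S.gluing.dom) :
    ∃ γ : Path (S.gluing.proj x) (S.gluing.proj y),
      pathLength γ ≤ ENNReal.ofReal (dist x.1 y.1) := by
  obtain ⟨γ, hγ0, hγ1, hdist, hmem⟩ := S.exists_geodesic_oct x.2 y.2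
  have hlip : LipschitzWith (Real.toNNReal (dist x.1 y.1))
      fun τ : unitInterval => S.gluing.proj ⟨γ τ, hmem τ τ.2⟩ := by
    refine LipschitzWith.of_dist_le_mul fun σ τ => ?_
    refine (S.gluing.dist_proj_le_dist _ _).trans (le_of_eq ?_)
    rw [hdist σ σ.2 τ τ.2, Real.coe_toNNReal _ dist_nonneg, mul_comm, Subtype.dist_eq, Real.dist_eq]
  exact ⟨⟨⟨_, hlip.continuous⟩, by simp [hγ0], by simp [hγ1]⟩, pathLength_le_of_lipschitzWith hlip⟩

lemma exists_path_of_gluing (x y : S.gluing.dom) (g : ℍ ≃ᵢ ℍ) (hg : g ∈ S.gluing.G) :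
    ∃ γ : Path (S.gluing.proj x) (S.gluing.proj y),
      pathLength γ ≤ ENNReal.ofReal (dist x.1 (g y.1)) := by
  obtain ⟨w, hw, w', hw', e, h⟩ := S.exists_crossing x.2 y.2 hg
  obtain ⟨γ, hγ⟩ := S.exists_path_of_oct x ⟨w, hw⟩
  obtain ⟨γ', hlen⟩ := S.exists_path_of_oct ⟨w', hw'⟩ y
  have he : S.gluing.proj ⟨w, hw⟩ = S.gluing.proj ⟨w', hw'⟩ :=
    S.gluing.proj_eq_iff.2 ⟨g, hg, e⟩
  refine ⟨γ.trans (γ'.cast he rfl), (pathLength_trans_le _ _).trans ?_⟩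
  rw [h, ENNReal.ofReal_add dist_nonneg dist_nonneg]
  exact add_le_add hγ hlen

/-! ### The local structure -/

end Shape

lemma Gluing.apply_mem_star {H : Type} [MetricSpace H] {D D' : Gluing H} {k : H ≃ᵢ H}
    (hdom : ∀ z ∈ D.dom, k z ∈ D'.dom) (hG : ∀ g ∈ D.G, ∃ g' ∈ D'.G, SemiconjBy k g g') {u : H}
    (hu : u ∈ D.star) : k u ∈ D'.star := by
  obtain ⟨g, hg, y, hy, rfl⟩ := hu
  obtain ⟨g', hg', hconj⟩ := hG g hg
  exact ⟨g', hg', k y, hdom y hy, (DFunLike.congr_fun hconj.eq y).symm⟩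

namespace Shape

variable (S : Shape)

/-- The quadrilateral bounded by the four boundary geodesics. -/
def diamond : Set ℍ := {z | S.s * |cX z| + S.t * |cY z| ≤ cT z}

lemma mem_star_iff (u : ℍ) :
    u ∈ S.gluing.star ↔ u ∈ S.oct ∨ ∃ i, (S.pairing i)⁻¹ u ∈ S.oct := by
  constructor
  · rintro ⟨g, rfl | ⟨i, rfl⟩, y, hy, rfl⟩
    · exact Or.inl hy
    · exact Or.inr ⟨i, by rwa [IsometryEquiv.inv_apply_self]⟩
  · rintro (h | ⟨i, h⟩)
    · exact ⟨1, Or.inl rfl, u, h, rfl⟩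
    · exact ⟨_, Or.inr ⟨i, rfl⟩, _, h, IsometryEquiv.apply_inv_self _ _⟩

lemma gap_nonpos {i : Bool × Bool} {u : ℍ} (h : (S.pairing i)⁻¹ u ∈ S.oct) : S.gap i u ≤ 0 := by
  have hpairing := S.gap_pairing i ((S.pairing i)⁻¹ u)
  rw [IsometryEquiv.apply_inv_self] at hpairing
  linarith [S.gap_nonneg (opp i) h]

lemma mem_oct_of_mem_star {u : ℍ} (hu : u ∈ S.gluing.star) (hX : |cX u| < S.s * cT u)
    (hY : |cY u| < S.t * cT u) : u ∈ S.oct := by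
  refine ((S.mem_star_iff u).1 hu).resolve_right ?_
  rintro ⟨i, hi⟩
  have hgap := S.gap_nonpos hi
  have := abs_lt.1 hX
  have := abs_lt.1 hY
  rcases i with ⟨_ | _, _ | _⟩ <;> simp only [gap] at hgap <;> linarith

lemma semiconjBy_reflX_trA : SemiconjBy reflX S.trA S.trA⁻¹ := by
  rw [trA, boostX_inv]
  refine IsometryEquiv.ext fun z => ext_cX_cY ?_ ?_
  · simp only [IsometryEquiv.mul_apply, cX_reflX, cX_boostX, cT_reflX, Real.cosh_neg,
      Real.sinh_neg]
    ring
  · simp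

lemma semiconjBy_reflX_trB : SemiconjBy reflX S.trB S.trB := by
  rw [trB]
  exact IsometryEquiv.ext fun z => ext_cX_cY (by simp) (by simp)

lemma semiconjBy_swapXY_trB : SemiconjBy swapXY S.trB S.swap.trA :=
  IsometryEquiv.ext fun z => by
    rw [IsometryEquiv.mul_apply, IsometryEquiv.mul_apply, trB_apply, swapXY_swapXY]

lemma semiconjBy_swapXY_trA : SemiconjBy swapXY S.trA S.swap.trB :=
  IsometryEquiv.ext fun z => by
    rw [IsometryEquiv.mul_apply, IsometryEquiv.mul_apply, trB_apply, swapXY_swapXY]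
    rfl

lemma reflX_mem_star_of_mem {u : ℍ} (hu : u ∈ S.gluing.star) : reflX u ∈ S.gluing.star := by
  refine Gluing.apply_mem_star (fun z hz => S.reflX_mem_oct.2 hz) ?_ hu
  rintro g (rfl | ⟨⟨_ | _, _ | _⟩, rfl⟩)
  · exact ⟨1, Or.inl rfl, SemiconjBy.one_right _⟩
  · exact ⟨_, Or.inr ⟨(false, true), rfl⟩, by
      simpa only [pairing, inv_inv] using S.semiconjBy_reflX_trA.inv_right⟩
  · exact ⟨_, Or.inr ⟨(false, false), rfl⟩, S.semiconjBy_reflX_trA⟩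
  · exact ⟨_, Or.inr ⟨(true, false), rfl⟩, S.semiconjBy_reflX_trB.inv_right⟩
  · exact ⟨_, Or.inr ⟨(true, true), rfl⟩, S.semiconjBy_reflX_trB⟩

lemma reflX_mem_star {u : ℍ} : reflX u ∈ S.gluing.star ↔ u ∈ S.gluing.star := by
  refine ⟨fun hu => ?_, S.reflX_mem_star_of_mem⟩
  rw [← reflX_reflX u]
  exact S.reflX_mem_star_of_mem hu

lemma swapXY_mem_star_of_mem {u : ℍ} (hu : u ∈ S.gluing.star) :
    swapXY u ∈ S.swap.gluing.star := by
  refine Gluing.apply_mem_star (fun z hz => S.swapXY_mem_oct.2 hz) ?_ hu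
  rintro g (rfl | ⟨⟨_ | _, _ | _⟩, rfl⟩)
  · exact ⟨1, Or.inl rfl, SemiconjBy.one_right _⟩
  · exact ⟨_, Or.inr ⟨(true, false), rfl⟩, S.semiconjBy_swapXY_trA.inv_right⟩
  · exact ⟨_, Or.inr ⟨(true, true), rfl⟩, S.semiconjBy_swapXY_trA⟩
  · exact ⟨_, Or.inr ⟨(false, false), rfl⟩, S.semiconjBy_swapXY_trB.inv_right⟩
  · exact ⟨_, Or.inr ⟨(false, true), rfl⟩, S.semiconjBy_swapXY_trB⟩

lemma swap_swap : S.swap.swap = S := rfl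

lemma swapXY_mem_star {u : ℍ} : swapXY u ∈ S.swap.gluing.star ↔ u ∈ S.gluing.star := by
  refine ⟨fun hu => ?_, S.swapXY_mem_star_of_mem⟩
  rw [← swapXY_swapXY u, ← S.swap_swap]
  exact S.swap.swapXY_mem_star_of_mem hu

lemma reflX_mem_diamond {u : ℍ} : reflX u ∈ S.diamond ↔ u ∈ S.diamond := by
  simp [diamond]

lemma swapXY_mem_diamond {u : ℍ} : swapXY u ∈ S.swap.diamond ↔ u ∈ S.diamond := by
  simp only [diamond, Set.mem_ofPred_eq, cX_swapXY, cY_swapXY, cT_swapXY, swap_s, swap_t]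
  rw [add_comm]

lemma mem_star_iff_mem_diamond_near_right {u : ℍ} (hX : 0 < cX u) (hY : |cY u| < S.t * cT u)
    (hX' : cX (S.trA⁻¹ u) < 0) (hY' : |cY (S.trA⁻¹ u)| < S.t * cT (S.trA⁻¹ u)) :
    u ∈ S.gluing.star ↔ u ∈ S.diamond := by
  have eX := S.cX_sub_trA (S.trA⁻¹ u)
  have eT := S.cT_sub_trA (S.trA⁻¹ u)
  have eY := S.cY_trA (S.trA⁻¹ u)
  rw [IsometryEquiv.apply_inv_self] at eX eT eY
  constructor
  · intro hu
    have := abs_lt.1 hY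
    rcases (S.mem_star_iff u).1 hu with h | ⟨⟨_ | _, _ | _⟩, hi⟩
    · exact h.2.2
    · have := S.gap_nonpos hi
      simp only [gap] at this
      linarith [mul_pos S.s_pos (cT_pos u)]
    · have hcorner := hi.2.2
      simp only [pairing] at hcorner
      rw [← eY, abs_of_neg hX'] at hcorner
      change S.s * |cX u| + S.t * |cY u| ≤ cT u
      rw [abs_of_pos hX]
      linarith
    all_goals
      have := S.gap_nonpos hi
      simp only [gap] at this
      linarith
  · intro (hu : S.s * |cX u| + S.t * |cY u| ≤ cT u)
    rw [mem_star_iff]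
    rcases le_or_gt (cX u) (S.s * cT u) with hle | hgt
    · exact Or.inl ⟨by rwa [abs_of_pos hX], hY.le, hu⟩
    · refine Or.inr ⟨(false, true), ?_, hY'.le, ?_⟩ <;> simp only [pairing]
      · rw [abs_of_neg hX']
        linarith
      · rw [← eY, abs_of_neg hX']
        rw [abs_of_pos hX] at hu
        linarith

lemma eventually_mem_star_iff_of_cX_eq {x : ℍ} (hx : x ∈ S.oct) (hwall : cX x = S.s * cT x) :
    ∀ᶠ u in nhds x, (u ∈ S.gluing.star ↔ u ∈ S.diamond) := by
  have hXx : 0 < cX x := hwall ▸ mul_pos S.s_pos (cT_pos x)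
  have hYx : |cY x| < S.t * cT x :=
    S.abs_cY_lt_of_cX_eq hwall (by simpa only [abs_of_pos hXx] using hx.2.2)
  have hcont : Continuous fun u => S.trA⁻¹ u := S.trA⁻¹.continuous
  have hinv : S.trA⁻¹ x = reflX x := by
    rw [← S.trA.injective.eq_iff, IsometryEquiv.apply_inv_self, S.trA_reflX_eq hwall]
  have hX' : ∀ᶠ u in nhds x, cX (S.trA⁻¹ u) < 0 := by
    refine (continuous_cX.comp hcont).continuousAt.eventually (gt_mem_nhds ?_)
    simpa only [Function.comp_apply, hinv, cX_reflX, Left.neg_neg_iff] using hXx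
  have hY' : ∀ᶠ u in nhds x, |cY (S.trA⁻¹ u)| < S.t * cT (S.trA⁻¹ u) := by
    refine (continuous_cY.comp hcont).abs.continuousAt.eventually_lt
      (continuous_const.mul (continuous_cT.comp hcont)).continuousAt ?_
    simpa only [Function.comp_apply, hinv, cY_reflX, cT_reflX] using hYx
  filter_upwards [continuous_cX.continuousAt.eventually (lt_mem_nhds hXx),
    continuous_cY.abs.continuousAt.eventually_lt
      (continuous_const.mul continuous_cT).continuousAt hYx, hX', hY'] with u hu₁ hu₂ hu₃ hu₄
  exact S.mem_star_iff_mem_diamond_near_right hu₁ hu₂ hu₃ hu₄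

lemma eventually_mem_star_iff_of_abs_cX_eq {x : ℍ} (hx : x ∈ S.oct)
    (hwall : |cX x| = S.s * cT x) : ∀ᶠ u in nhds x, (u ∈ S.gluing.star ↔ u ∈ S.diamond) := by
  rcases abs_cases (cX x) with ⟨habs, -⟩ | ⟨habs, -⟩
  · exact S.eventually_mem_star_iff_of_cX_eq hx (habs ▸ hwall)
  · have := S.eventually_mem_star_iff_of_cX_eq (S.reflX_mem_oct.2 hx)
      (by rw [cX_reflX, cT_reflX, ← hwall, habs])
    filter_upwards [reflX.continuous.continuousAt.eventually this] with u hu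
    rwa [reflX_mem_star, reflX_mem_diamond] at hu

lemma eventually_mem_star_iff {x : ℍ} (hx : x ∈ S.oct) :
    ∀ᶠ u in nhds x, (u ∈ S.gluing.star ↔ u ∈ S.diamond) := by
  rcases eq_or_lt_of_le hx.1 with hX | hX
  · exact S.eventually_mem_star_iff_of_abs_cX_eq hx hX
  rcases eq_or_lt_of_le hx.2.1 with hY | hY
  · have := S.swap.eventually_mem_star_iff_of_abs_cX_eq (S.swapXY_mem_oct.2 hx)
      (by rw [cX_swapXY, cT_swapXY, hY, swap_s])
    filter_upwards [swapXY.continuous.continuousAt.eventually this] with u hu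
    rwa [swapXY_mem_star, swapXY_mem_diamond] at hu
  · filter_upwards [continuous_cX.abs.continuousAt.eventually_lt
        (continuous_const.mul continuous_cT).continuousAt hX,
      continuous_cY.abs.continuousAt.eventually_lt
        (continuous_const.mul continuous_cT).continuousAt hY] with u huX huY
    exact ⟨fun hu => (S.mem_oct_of_mem_star hu huX huY).2.2,
      fun hu => (S.mem_star_iff u).2 (Or.inl ⟨huX.le, huY.le, hu⟩)⟩

lemma isModeledAt_proj (x : S.gluing.dom) {M : Set ℍ} (k : ℍ ≃ᵢ ℍ)
    (hk : k x.1 = UpperHalfPlane.I)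
    (hM : ∀ᶠ u in nhds x.1, (u ∈ S.diamond ↔ k u ∈ M)) : IsModeledAt M (S.gluing.proj x) := by
  obtain ⟨r₀, hr₀, hball⟩ :=
    Metric.eventually_nhds_iff_ball.1 ((S.eventually_mem_star_iff x.2).and hM)
  have hε := S.gluing.ε_pos
  set r := min r₀ (S.gluing.ε / 4)
  have hr_le : r ≤ r₀ := min_le_left _ _
  have hr_le_ε : r ≤ S.gluing.ε / 4 := min_le_right _ _
  have hr_pos : 0 < r := lt_min hr₀ (by linarith)
  obtain ⟨φ, hφx, hiso, himage⟩ := S.gluing.exists_chart (r := r) (by linarith) hr_pos x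
  refine ⟨r, hr_pos, fun y => k (φ y), by simp only [hφx, hk], fun y hy z hz => ?_, ?_⟩
  · rw [k.dist_eq, hiso y hy z hz]
  · rw [← Set.image_image k φ, himage]
    ext v
    obtain ⟨u, rfl⟩ := k.surjective v
    rw [k.injective.mem_set_image, ← hk, Set.mem_inter_iff, Set.mem_inter_iff, Metric.mem_ball,
      Metric.mem_ball, k.dist_eq]
    refine and_congr_right fun hu => ?_
    have := hball u (Metric.ball_subset_ball hr_le hu)
    exact this.1.trans this.2

end Shape

/-! ### Moving points and geodesics to standard position -/

lemma boostY_eq_I {z : ℍ} (hz : cX z = 0) :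
    boostY (-arsinh (cY z)) z = UpperHalfPlane.I := by
  have hT := cT_sq z
  rw [hz, zero_pow two_ne_zero, add_zero] at hT
  refine ext_cX_cY (by simp [hz]) ?_
  rw [cY_boostY, cY_I, Real.cosh_neg, Real.sinh_neg, Real.cosh_arsinh, Real.sinh_arsinh, ← hT,
    Real.sqrt_sq (cT_pos z).le]
  ring

lemma exists_sinh_eq_mul_cosh {y : ℝ} (hy : y ∈ Set.Ioo (-1 : ℝ) 1) :
    ∃ a, sinh a = y * cosh a := by
  refine ⟨Real.artanh y, ?_⟩
  rw [← div_eq_iff (Real.cosh_pos _).ne', ← Real.tanh_eq_sinh_div_cosh, Real.tanh_artanh hy]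

lemma exists_apply_eq_I (z : ℍ) : ∃ k : ℍ ≃ᵢ ℍ, k z = UpperHalfPlane.I := by
  have hT := cT_pos z
  have hlt := abs_lt.1 (abs_cX_lt_cT z)
  obtain ⟨a, ha⟩ := exists_sinh_eq_mul_cosh (y := cX z / cT z)
    ⟨by rw [lt_div_iff₀ hT]; linarith, by rw [div_lt_iff₀ hT]; linarith⟩
  have hX : cX (boostX (-a) z) = 0 := by
    rw [cX_boostX, Real.cosh_neg, Real.sinh_neg, ha]
    field_simp
    ring
  refine ⟨(boostX (-a)).trans (boostY (-arsinh (cY (boostX (-a) z)))), ?_⟩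
  rw [IsometryEquiv.trans_apply, boostY_eq_I hX]

lemma exists_cX_apply_eq {s t : ℝ} (hst : 1 < s ^ 2 + t ^ 2) : ∃ k : ℍ ≃ᵢ ℍ, ∃ c > 0,
    ∀ u, cX (k u) = c * (s * cX u + t * cY u - cT u) := by
  let w : ℂ := ⟨s, t⟩
  set R := ‖w‖
  have hR_sq : R ^ 2 = s ^ 2 + t ^ 2 := by
    rw [Complex.sq_norm, Complex.normSq_apply]
    simp only [w]
    ring
  have hR : 1 < R := by nlinarith [norm_nonneg w]
  have hR0 : R ≠ 0 := by positivity
  have hcos : Real.cos w.arg = s / R := Complex.cos_arg (norm_ne_zero_iff.1 hR0)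
  have hsin : Real.sin w.arg = t / R := Complex.sin_arg w
  obtain ⟨a, ha⟩ := exists_sinh_eq_mul_cosh (y := 1 / R)
    ⟨by linarith [show 0 < 1 / R by positivity], (div_lt_one (by linarith)).2 hR⟩
  refine ⟨(rotXY (-w.arg)).trans (boostX (-a)), cosh a / R,
    div_pos (Real.cosh_pos a) (by linarith), fun u => ?_⟩
  rw [IsometryEquiv.trans_apply, cX_boostX, cX_rotXY, cT_rotXY, Real.cos_neg, Real.sin_neg,
    Real.cosh_neg, Real.sinh_neg, hcos, hsin, ha]
  field_simp
  ring

lemma exists_apply_eq_I_and_mem_halfPlane_iff {s t : ℝ} (hst : 1 < s ^ 2 + t ^ 2) {z : ℍ}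
    (hz : s * cX z + t * cY z = cT z) :
    ∃ k : ℍ ≃ᵢ ℍ, k z = UpperHalfPlane.I ∧
      ∀ u, k u ∈ halfPlane ↔ s * cX u + t * cY u ≤ cT u := by
  obtain ⟨k₀, c, hc, hk₀⟩ := exists_cX_apply_eq hst
  have hz0 : cX (k₀ z) = 0 := by rw [hk₀, hz, sub_self, mul_zero]
  refine ⟨(k₀.trans (boostY (-arsinh (cY (k₀ z))))).trans (rotXY (-(Real.pi / 2))), ?_,
    fun u => ?_⟩
  · rw [IsometryEquiv.trans_apply, IsometryEquiv.trans_apply, boostY_eq_I hz0]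
    exact ext_cX_cY (by simp) (by simp)
  · rw [IsometryEquiv.trans_apply, IsometryEquiv.trans_apply, mem_halfPlane_iff, cY_rotXY,
      cX_boostY, Real.sin_neg, Real.cos_neg, Real.sin_pi_div_two, Real.cos_pi_div_two, hk₀,
      zero_mul, add_zero, neg_one_mul, neg_nonneg, ← sub_nonpos (a := s * cX u + t * cY u)]
    exact smul_nonpos_iff_nonpos_of_pos_left hc

lemma exists_reflection_abs (z : ℍ) : ∃ k : ℍ ≃ᵢ ℍ, ∃ a b : ℝ, |a| = 1 ∧ |b| = 1 ∧
    (∀ u, cX (k u) = a * cX u) ∧ (∀ u, cY (k u) = b * cY u) ∧ (∀ u, cT (k u) = cT u) ∧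
    a * cX z = |cX z| ∧ b * cY z = |cY z| := by
  rcases abs_cases (cX z) with ⟨hX, -⟩ | ⟨hX, -⟩ <;>
    rcases abs_cases (cY z) with ⟨hY, -⟩ | ⟨hY, -⟩
  · exact ⟨1, 1, 1, by simp, by simp, by simp, by simp, by simp, by simp [hX], by simp [hY]⟩
  · exact ⟨reflY, 1, -1, by simp, by simp, by simp, by simp, by simp, by simp [hX], by simp [hY]⟩
  · exact ⟨reflX, -1, 1, by simp, by simp, by simp, by simp, by simp, by simp [hX], by simp [hY]⟩
  · exact ⟨reflX * reflY, -1, -1, by simp, by simp, by simp, by simp, by simp, by simp [hX],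
      by simp [hY]⟩

namespace Shape

variable (S : Shape)

lemma isModeledAt_of_lt (x : S.gluing.dom)
    (hx : S.s * |cX x.1| + S.t * |cY x.1| < cT x.1) : IsModeledAt Set.univ (S.gluing.proj x) := by
  obtain ⟨k, hk⟩ := exists_apply_eq_I x.1
  refine S.isModeledAt_proj x k hk ?_
  have : ∀ᶠ u in nhds x.1, S.s * |cX u| + S.t * |cY u| < cT u :=
    ((continuous_const.mul continuous_cX.abs).add
      (continuous_const.mul continuous_cY.abs)).continuousAt.eventually_lt
      continuous_cT.continuousAt hx
  filter_upwards [this] with u hu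
  exact ⟨fun _ => Set.mem_univ _, fun _ => hu.le⟩

lemma abs_cX_pos_of_eq {z : ℍ} (hz : z ∈ S.oct) (hcorner : S.s * |cX z| + S.t * |cY z| = cT z) :
    0 < |cX z| := by
  have hT := cT_pos z
  have hY : S.t * |cY z| ≤ S.t * (S.t * cT z) := mul_le_mul_of_nonneg_left hz.2.1 S.t_pos.le
  have ht_sq : S.t * S.t < 1 := by nlinarith [S.t_pos, S.t_lt_one]
  have : 0 < S.s * |cX z| := by nlinarith
  exact pos_of_mul_pos_right this S.s_pos.le

lemma abs_cY_pos_of_eq {z : ℍ} (hz : z ∈ S.oct) (hcorner : S.s * |cX z| + S.t * |cY z| = cT z) :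
    0 < |cY z| := by
  have := S.swap.abs_cX_pos_of_eq (S.swapXY_mem_oct.2 hz) (by
    rwa [cX_swapXY, cY_swapXY, cT_swapXY, swap_s, swap_t, add_comm])
  rwa [cX_swapXY] at this

lemma isModeledAt_of_eq (x : S.gluing.dom)
    (hx : S.s * |cX x.1| + S.t * |cY x.1| = cT x.1) : IsModeledAt halfPlane (S.gluing.proj x) := by
  obtain ⟨k, a, b, ha, hb, hkX, hkY, hkT, hax, hby⟩ := exists_reflection_abs x.1
  obtain ⟨k', hk', hhalf⟩ := exists_apply_eq_I_and_mem_halfPlane_iff S.one_lt_sq_add_sq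
    (z := k x.1) (by rw [hkX, hkY, hkT, hax, hby, hx])
  have hX : 0 < a * cX x.1 := hax ▸ S.abs_cX_pos_of_eq x.2 hx
  have hY : 0 < b * cY x.1 := hby ▸ S.abs_cY_pos_of_eq x.2 hx
  refine S.isModeledAt_proj x (k.trans k') hk' ?_
  filter_upwards [(continuous_const.mul continuous_cX).continuousAt.eventually (lt_mem_nhds hX),
    (continuous_const.mul continuous_cY).continuousAt.eventually (lt_mem_nhds hY)] with u huX huY
  simp only [Pi.mul_apply] at huX huY
  have habsX : |cX u| = a * cX u := by rw [← abs_of_pos huX, abs_mul, ha, one_mul]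
  have habsY : |cY u| = b * cY u := by rw [← abs_of_pos huY, abs_mul, hb, one_mul]
  rw [IsometryEquiv.trans_apply, hhalf, hkX, hkY, hkT, ← habsX, ← habsY]
  rfl

end Shape

/-! ### Klein coordinates -/

/-- The point of the upper half-plane with given coordinates in the Klein model. -/
def klein (v : ℝ × ℝ) : ℍ :=
  ofCoords (v.1 / √(1 - v.1 ^ 2 - v.2 ^ 2)) (v.2 / √(1 - v.1 ^ 2 - v.2 ^ 2))

lemma cT_klein {v : ℝ × ℝ} (h : v.1 ^ 2 + v.2 ^ 2 < 1) :
    cT (klein v) = 1 / √(1 - v.1 ^ 2 - v.2 ^ 2) := by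
  have hpos : 0 < 1 - v.1 ^ 2 - v.2 ^ 2 := by linarith
  refine cT_ofCoords (by positivity) ?_
  rw [div_pow, div_pow, div_pow, Real.sq_sqrt hpos.le]
  field_simp
  ring

lemma cX_klein {v : ℝ × ℝ} (h : v.1 ^ 2 + v.2 ^ 2 < 1) :
    cX (klein v) = v.1 * cT (klein v) := by
  rw [cT_klein h, klein, cX_ofCoords]
  ring

lemma cY_klein {v : ℝ × ℝ} (h : v.1 ^ 2 + v.2 ^ 2 < 1) :
    cY (klein v) = v.2 * cT (klein v) := by
  rw [cT_klein h, klein, cY_ofCoords]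
  ring

lemma klein_div_cT (z : ℍ) : klein (cX z / cT z, cY z / cT z) = z := by
  have hT := cT_pos z
  have hsqrt : √(1 - (cX z / cT z) ^ 2 - (cY z / cT z) ^ 2) = 1 / cT z := by
    rw [Real.sqrt_eq_iff_mul_self_eq_of_pos (by positivity)]
    field_simp
    linear_combination -cT_sq z
  refine ext_cX_cY ?_ ?_
  · simp only [klein, cX_ofCoords, hsqrt]
    field_simp
  · simp only [klein, cY_ofCoords, hsqrt]
    field_simp

lemma continuousOn_klein : ContinuousOn klein {v | v.1 ^ 2 + v.2 ^ 2 < 1} := by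
  have hsqrt : ContinuousOn (fun v : ℝ × ℝ => √(1 - v.1 ^ 2 - v.2 ^ 2))
      {v | v.1 ^ 2 + v.2 ^ 2 < 1} := by
    fun_prop
  have hsqrt_ne : ∀ v ∈ {v : ℝ × ℝ | v.1 ^ 2 + v.2 ^ 2 < 1}, √(1 - v.1 ^ 2 - v.2 ^ 2) ≠ 0 := by
    intro v hv
    rw [Set.mem_ofPred_eq] at hv
    exact (Real.sqrt_pos.2 (by linarith)).ne'
  exact continuous_ofCoords.comp_continuousOn
    ((continuous_fst.continuousOn.div hsqrt hsqrt_ne).prodMk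
      (continuous_snd.continuousOn.div hsqrt hsqrt_ne))

lemma injOn_klein : Set.InjOn klein {v | v.1 ^ 2 + v.2 ^ 2 < 1} := by
  intro v hv w hw h
  have hX := cX_klein hv
  have hY := cY_klein hv
  rw [h, cX_klein hw] at hX
  rw [h, cY_klein hw] at hY
  have hT := (cT_pos (klein w)).ne'
  exact Prod.ext (mul_right_cancel₀ hT hX).symm (mul_right_cancel₀ hT hY).symm

lemma reflX_klein (v : ℝ × ℝ) : reflX (klein v) = klein (-v.1, v.2) :=
  ext_cX_cY (by simp [klein, neg_div]) (by simp [klein])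

lemma reflY_klein (v : ℝ × ℝ) : reflY (klein v) = klein (v.1, -v.2) :=
  ext_cX_cY (by simp [klein]) (by simp [klein, neg_div])

lemma reflY_reflY (z : ℍ) : reflY (reflY z) = z := ext_cX_cY (by simp) (by simp)

lemma reflY_swapXY (z : ℍ) : reflY (swapXY z) = swapXY (reflX z) :=
  ext_cX_cY (by simp) (by simp)

lemma reflX_swapXY (z : ℍ) : reflX (swapXY z) = swapXY (reflY z) :=
  ext_cX_cY (by simp) (by simp)

namespace Shape

variable (S : Shape)

/-- The octagon in Klein coordinates. -/
def kleinOct : Set (ℝ × ℝ) :=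
  {v | |v.1| ≤ S.s ∧ |v.2| ≤ S.t ∧ S.s * |v.1| + S.t * |v.2| ≤ 1}

lemma sq_add_sq_lt_one {v : ℝ × ℝ} (hv : v ∈ S.kleinOct) : v.1 ^ 2 + v.2 ^ 2 < 1 := by
  obtain ⟨hxs, hyt, hcorner⟩ := hv
  have hs := S.s_pos
  have ht := S.t_pos
  have hs1 := S.s_lt_one
  have hst := S.one_lt_sq_add_sq
  rw [← sq_abs v.1, ← sq_abs v.2]
  have hx := abs_nonneg v.1
  have hy := abs_nonneg v.2
  generalize |v.1| = x at *
  generalize |v.2| = y at *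
  rcases hxs.eq_or_lt with rfl | hxs
  · have hty : S.t * y ≤ 1 - S.s ^ 2 := by linarith
    have hpos : 0 < 1 - S.s ^ 2 := by nlinarith
    have hty_sq : (S.t * y) ^ 2 ≤ (1 - S.s ^ 2) ^ 2 := pow_le_pow_left₀ (by positivity) hty 2
    have : S.t ^ 2 * y ^ 2 < S.t ^ 2 * (1 - S.s ^ 2) := by nlinarith
    have := lt_of_mul_lt_mul_left this (by positivity)
    linarith
  · rcases hx.eq_or_lt with rfl | hx
    · nlinarith [S.t_lt_one]
    · nlinarith [mul_lt_mul_of_pos_right hxs hx, mul_le_mul_of_nonneg_right hyt hy]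

lemma klein_mem_oct {v : ℝ × ℝ} (hv : v ∈ S.kleinOct) : klein v ∈ S.oct := by
  have hlt := S.sq_add_sq_lt_one hv
  have hT := cT_pos (klein v)
  have hX : |cX (klein v)| = |v.1| * cT (klein v) := by
    rw [cX_klein hlt, abs_mul, abs_of_pos hT]
  have hY : |cY (klein v)| = |v.2| * cT (klein v) := by
    rw [cY_klein hlt, abs_mul, abs_of_pos hT]
  obtain ⟨hxs, hyt, hcorner⟩ := hv
  refine ⟨?_, ?_, ?_⟩
  · rw [hX]
    exact mul_le_mul_of_nonneg_right hxs hT.le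
  · rw [hY]
    exact mul_le_mul_of_nonneg_right hyt hT.le
  · rw [hX, hY]
    nlinarith

lemma div_cT_mem_kleinOct {z : ℍ} (hz : z ∈ S.oct) :
    (cX z / cT z, cY z / cT z) ∈ S.kleinOct := by
  have hT := cT_pos z
  obtain ⟨hX, hY, hcorner⟩ := hz
  refine ⟨?_, ?_, ?_⟩ <;> simp only [abs_div, abs_of_pos hT]
  · rwa [div_le_iff₀ hT]
  · rwa [div_le_iff₀ hT]
  · rw [← mul_div_assoc, ← mul_div_assoc, ← add_div, div_le_one hT]
    exact hcorner

/-- The parametrization of the octagon by Klein coordinates. -/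
def kleinPt (v : S.kleinOct) : S.gluing.dom := ⟨klein v.1, S.klein_mem_oct v.2⟩

lemma continuous_kleinPt : Continuous S.kleinPt :=
  Continuous.subtype_mk (continuousOn_klein.comp_continuous continuous_subtype_val
    fun v => S.sq_add_sq_lt_one v.2) _

lemma kleinPt_surjective : Function.Surjective S.kleinPt := fun z =>
  ⟨⟨_, S.div_cT_mem_kleinOct z.2⟩, Subtype.ext (klein_div_cT z.1)⟩

lemma trB_reflY_eq {z : ℍ} (hz : cY z = S.t * cT z) : S.trB (reflY z) = z := by
  rw [trB_apply, ← reflX_swapXY, S.swap.trA_reflX_eq (by simpa [swap_s] using hz), swapXY_swapXY]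

lemma abs_cX_eq_of_eq_trA {x y : ℍ} (hx : x ∈ S.oct) (hy : y ∈ S.oct) (h : x = S.trA y) :
    |cX x| = S.s * cT x ∧ y = reflX x := by
  have hgap := S.cX_sub_trA y
  rw [← h] at hgap
  have hXx := abs_le.1 hx.1
  have hXy := abs_le.1 hy.1
  have hwall : cX x = S.s * cT x := by linarith
  refine ⟨by rw [hwall, abs_of_nonneg (mul_pos S.s_pos (cT_pos x)).le], S.trA.injective ?_⟩
  rw [S.trA_reflX_eq hwall, ← h]

lemma eq_or_eq_refl_of_eq_gluing {z z' : ℍ} (hz : z ∈ S.oct) (hz' : z' ∈ S.oct) {g : ℍ ≃ᵢ ℍ}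
    (hg : g ∈ S.gluing.G) : z = g z' → z = z' ∨ (|cX z| = S.s * cT z ∧ z' = reflX z) ∨
      (|cY z| = S.t * cT z ∧ z' = reflY z) := by
  refine gluing_induction (P := fun S z z' g => z = g z' → z = z' ∨
    (|cX z| = S.s * cT z ∧ z' = reflX z) ∨ (|cY z| = S.t * cT z ∧ z' = reflY z))
    (fun _ _ _ _ _ => Or.inl)
    (fun S _ _ hx hy h => Or.inr (Or.inl (S.abs_cX_eq_of_eq_trA hx hy h))) ?_ ?_ S hz hz' hg
  · rintro S x y g h rfl
    rcases h (IsometryEquiv.apply_inv_self g x).symm with h | ⟨hX, h⟩ | ⟨hY, h⟩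
    · exact Or.inl h.symm
    · exact Or.inr (Or.inl ⟨by rw [h, cX_reflX, abs_neg, cT_reflX, hX], by rw [h, reflX_reflX]⟩)
    · exact Or.inr (Or.inr ⟨by rw [h, cY_reflY, abs_neg, cT_reflY, hY], by rw [h, reflY_reflY]⟩)
  · rintro S x y h hxy
    rw [trB_apply] at hxy
    rcases h (by rw [hxy, swapXY_swapXY]) with h | ⟨hX, h⟩ | ⟨hY, h⟩
    · exact Or.inl (swapXY.injective h)
    · rw [reflX_swapXY] at h
      exact Or.inr (Or.inr ⟨by simpa [swap_s] using hX, swapXY.injective h⟩)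
    · rw [reflY_swapXY] at h
      exact Or.inr (Or.inl ⟨by simpa [swap_t] using hY, swapXY.injective h⟩)

lemma exists_gluing_reflX {z : ℍ} (hz : |cX z| = S.s * cT z) :
    ∃ g ∈ S.gluing.G, z = g (reflX z) := by
  rcases abs_cases (cX z) with ⟨habs, -⟩ | ⟨habs, -⟩
  · exact ⟨_, Or.inr ⟨(false, true), rfl⟩, (S.trA_reflX_eq (habs ▸ hz)).symm⟩
  · have h := S.trA_reflX_eq (z := reflX z) (by rw [cX_reflX, cT_reflX, ← hz, habs])
    rw [reflX_reflX] at h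
    exact ⟨S.trA⁻¹, Or.inr ⟨(false, false), rfl⟩, by rw [← h, IsometryEquiv.inv_apply_self]⟩

lemma exists_gluing_reflY {z : ℍ} (hz : |cY z| = S.t * cT z) :
    ∃ g ∈ S.gluing.G, z = g (reflY z) := by
  rcases abs_cases (cY z) with ⟨habs, -⟩ | ⟨habs, -⟩
  · exact ⟨_, Or.inr ⟨(true, true), rfl⟩, (S.trB_reflY_eq (habs ▸ hz)).symm⟩
  · have h := S.trB_reflY_eq (z := reflY z) (by rw [cY_reflY, cT_reflY, ← hz, habs])
    rw [reflY_reflY] at h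
    exact ⟨S.trB⁻¹, Or.inr ⟨(true, false), rfl⟩, by rw [← h, IsometryEquiv.inv_apply_self]⟩

lemma proj_kleinPt_eq_iff (v w : S.kleinOct) :
    S.gluing.proj (S.kleinPt v) = S.gluing.proj (S.kleinPt w) ↔ v.1 = w.1 ∨
      (|v.1.1| = S.s ∧ w.1 = (-v.1.1, v.1.2)) ∨ (|v.1.2| = S.t ∧ w.1 = (v.1.1, -v.1.2)) := by
  have hv := S.sq_add_sq_lt_one v.2
  have hw := S.sq_add_sq_lt_one w.2
  have hT := cT_pos (klein v.1)
  have hX : |cX (klein v.1)| = S.s * cT (klein v.1) ↔ |v.1.1| = S.s := by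
    rw [cX_klein hv, abs_mul, abs_of_pos hT, mul_left_inj' hT.ne']
  have hY : |cY (klein v.1)| = S.t * cT (klein v.1) ↔ |v.1.2| = S.t := by
    rw [cY_klein hv, abs_mul, abs_of_pos hT, mul_left_inj' hT.ne']
  rw [S.gluing.proj_eq_iff]
  constructor
  · rintro ⟨g, hg, h⟩
    rcases S.eq_or_eq_refl_of_eq_gluing (S.kleinPt v).2 (S.kleinPt w).2 hg h with
      h | ⟨hwall, h⟩ | ⟨hwall, h⟩
    · exact Or.inl (injOn_klein hv hw h)
    · exact Or.inr (Or.inl ⟨hX.1 hwall,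
        injOn_klein hw (by simpa using hv) (h.trans (reflX_klein v.1))⟩)
    · exact Or.inr (Or.inr ⟨hY.1 hwall,
        injOn_klein hw (by simpa using hv) (h.trans (reflY_klein v.1))⟩)
  · rintro (h | ⟨hwall, h⟩ | ⟨hwall, h⟩)
    · exact ⟨1, S.gluing.one_mem, congrArg klein h⟩
    · obtain ⟨g, hg, hfix⟩ := S.exists_gluing_reflX (hX.2 hwall)
      exact ⟨g, hg, by rwa [reflX_klein, ← h] at hfix⟩
    · obtain ⟨g, hg, hfix⟩ := S.exists_gluing_reflY (hY.2 hwall)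
      exact ⟨g, hg, by rwa [reflY_klein, ← h] at hfix⟩

end Shape

/-! ### The profile function -/

/-- The clamp of a real number to `[-1/4, 1/4]`. -/
def clamp (u : ℝ) : ℝ := max (-(1 / 4)) (min (1 / 4) u)

/-- An odd increasing function on `[-1/2, 1/2]`, linear on `[-1/4, 1/4]` and quadratic outside.
The quadratic part turns a circle of radius `1/4` about a corner of the square `[-1/2, 1/2]²` into
a straight line, as needed for the marking. -/
def profile (a b u : ℝ) : ℝ :=
  4 * a * clamp u + b * (8 * (u - clamp u) - 16 * ((u - clamp u) * |u - clamp u|))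

lemma continuous_profile (a b : ℝ) : Continuous (profile a b) := by
  unfold profile clamp
  fun_prop

lemma clamp_neg (u : ℝ) : clamp (-u) = -clamp u := by
  unfold clamp
  rw [min_def, min_def, max_def, max_def]
  split_ifs <;> linarith

lemma profile_neg (a b u : ℝ) : profile a b (-u) = -profile a b u := by
  have : -u - clamp (-u) = -(u - clamp u) := by rw [clamp_neg]; ring
  rw [profile, this, abs_neg, clamp_neg, profile]
  ring

lemma profile_of_le {a b u : ℝ} (h0 : 0 ≤ u) (h : u ≤ 1 / 4) : profile a b u = 4 * a * u := by
  have : clamp u = u := by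
    rw [clamp, min_eq_right h, max_eq_right (by linarith)]
  rw [profile, this]
  simp

lemma profile_of_ge {a b u : ℝ} (h : 1 / 4 ≤ u) :
    profile a b u = a + b * (1 - 16 * (1 / 2 - u) ^ 2) := by
  have : clamp u = 1 / 4 := by
    rw [clamp, min_eq_left h, max_eq_right (by norm_num)]
  rw [profile, this, abs_of_nonneg (by linarith)]
  ring

lemma profile_half (a b : ℝ) : profile a b (1 / 2) = a + b := by
  rw [profile_of_ge (by norm_num)]
  ring

lemma profile_zero (a b : ℝ) : profile a b 0 = 0 := by
  rw [profile_of_le le_rfl (by norm_num), mul_zero]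

lemma strictMonoOn_profile_nonneg {a b : ℝ} (ha : 0 < a) (hb : 0 < b) :
    StrictMonoOn (profile a b) (Set.Icc 0 (1 / 2)) := by
  have hlin : StrictMonoOn (profile a b) (Set.Icc 0 (1 / 4)) := by
    intro u hu w hw huw
    rw [profile_of_le hu.1 hu.2, profile_of_le hw.1 hw.2]
    nlinarith
  have hquad : StrictMonoOn (profile a b) (Set.Icc (1 / 4) (1 / 2)) := by
    intro u hu w hw huw
    rw [profile_of_ge hu.1, profile_of_ge hw.1]
    have : (1 / 2 - w) ^ 2 < (1 / 2 - u) ^ 2 := by nlinarith [hw.2]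
    nlinarith
  rw [← Set.Icc_union_Icc_eq_Icc (show (0 : ℝ) ≤ 1 / 4 by norm_num)
    (show (1 / 4 : ℝ) ≤ 1 / 2 by norm_num)]
  exact hlin.union hquad (isGreatest_Icc (by norm_num)) (isLeast_Icc (by norm_num))

lemma strictMonoOn_profile {a b : ℝ} (ha : 0 < a) (hb : 0 < b) :
    StrictMonoOn (profile a b) (Set.Icc (-(1 / 2)) (1 / 2)) := by
  have hright := strictMonoOn_profile_nonneg ha hb
  have hleft : StrictMonoOn (profile a b) (Set.Icc (-(1 / 2)) 0) := by
    intro u hu w hw huw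
    have := hright (a := -w) (b := -u) ⟨by linarith [hw.2], by linarith [hw.1]⟩
      ⟨by linarith [hu.2], by linarith [hu.1]⟩ (by linarith)
    rwa [profile_neg, profile_neg, neg_lt_neg_iff] at this
  rw [← Set.Icc_union_Icc_eq_Icc (show -(1 / 2) ≤ (0 : ℝ) by norm_num)
    (show (0 : ℝ) ≤ 1 / 2 by norm_num)]
  exact hleft.union hright (isGreatest_Icc (by norm_num)) (isLeast_Icc (by norm_num))

lemma abs_profile {a b : ℝ} (ha : 0 < a) (hb : 0 < b) {u : ℝ} (hu : |u| ≤ 1 / 2) :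
    |profile a b u| = profile a b |u| := by
  have hnonneg : 0 ≤ profile a b |u| := by
    rw [← profile_zero a b]
    exact (strictMonoOn_profile_nonneg ha hb).monotoneOn ⟨le_rfl, by norm_num⟩
      ⟨abs_nonneg u, hu⟩ (abs_nonneg u)
  rcases abs_cases u with ⟨habs, -⟩ | ⟨habs, -⟩
  · rw [habs] at hnonneg ⊢
    exact abs_of_nonneg hnonneg
  · rw [habs] at hnonneg ⊢
    rw [← abs_of_nonneg hnonneg, profile_neg, abs_neg]

lemma surjOn_profile {a b : ℝ} :
    Set.SurjOn (profile a b) (Set.Icc (-(1 / 2)) (1 / 2)) (Set.Icc (-(a + b)) (a + b)) := by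
  have := intermediate_value_Icc (show (-(1 / 2) : ℝ) ≤ 1 / 2 by norm_num)
    (continuous_profile a b).continuousOn
  rwa [profile_neg, profile_half] at this

/-! ### The one-holed torus as a quotient of a cut square -/

/-- A square with the four quarter discs about its corners removed: a fundamental domain for
`OneHoledTorus` in which the boundary is centred at the corners. -/
def cutSquare : Set (ℝ × ℝ) :=
  {v | |v.1| ≤ 1 / 2 ∧ |v.2| ≤ 1 / 2 ∧
    (1 / 4 : ℝ) ^ 2 ≤ (1 / 2 - |v.1|) ^ 2 + (1 / 2 - |v.2|) ^ 2}

lemma norm_coe_add_half {u : ℝ} (hu : |u| ≤ 1 / 2) :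
    ‖((u + 1 / 2 : ℝ) : UnitAddCircle)‖ = 1 / 2 - |u| := by
  rcases abs_cases u with ⟨habs, hsign⟩ | ⟨habs, hsign⟩
  · have hshift : ((u + 1 / 2 : ℝ) : UnitAddCircle) = ((u - 1 / 2 : ℝ) : UnitAddCircle) := by
      rw [← AddCircle.coe_add_period (1 : ℝ) (u - 1 / 2)]
      congr 1
      ring
    have hnorm : |u - 1 / 2| = 1 / 2 - |u| := by
      rw [habs, abs_of_nonpos (by linarith)]
      ring
    rw [hshift, (AddCircle.norm_coe_eq_abs_iff (1 : ℝ) one_ne_zero).2, hnorm]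
    rw [hnorm, abs_one]
    linarith
  · have hnorm : |u + 1 / 2| = 1 / 2 - |u| := by
      rw [habs, abs_of_nonneg (by linarith)]
      ring
    rw [(AddCircle.norm_coe_eq_abs_iff (1 : ℝ) one_ne_zero).2, hnorm]
    rw [hnorm, abs_one]
    linarith

/-- The map from the cut square to the one-holed torus that glues opposite sides. -/
def wrap (v : cutSquare) : OneHoledTorus :=
  ⟨(((v.1.1 + 1 / 2 : ℝ) : UnitAddCircle), ((v.1.2 + 1 / 2 : ℝ) : UnitAddCircle)), by
    rw [norm_coe_add_half v.2.1, norm_coe_add_half v.2.2.1]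
    exact v.2.2.2⟩

lemma continuous_wrap : Continuous wrap := by
  refine Continuous.subtype_mk (Continuous.prodMk ?_ ?_) _
  · exact (AddCircle.continuous_mk' (1 : ℝ)).comp (by fun_prop)
  · exact (AddCircle.continuous_mk' (1 : ℝ)).comp (by fun_prop)

lemma wrap_mem_bdry_iff (v : cutSquare) :
    wrap v ∈ bdry ↔ (1 / 2 - |v.1.1|) ^ 2 + (1 / 2 - |v.1.2|) ^ 2 = (1 / 4 : ℝ) ^ 2 := by
  rw [← norm_coe_add_half v.2.1, ← norm_coe_add_half v.2.2.1]
  rfl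

lemma exists_coe_add_half (x : UnitAddCircle) :
    ∃ u : ℝ, |u| ≤ 1 / 2 ∧ ((u + 1 / 2 : ℝ) : UnitAddCircle) = x := by
  have : Fact ((0 : ℝ) < 1) := ⟨one_pos⟩
  obtain ⟨y, hy, rfl⟩ := AddCircle.coe_image_Ico_eq (1 : ℝ) 0 ▸ Set.mem_univ x
  refine ⟨y - 1 / 2, abs_le.2 ⟨by linarith [hy.1], by linarith [hy.2]⟩, by congr 1; ring⟩

lemma wrap_surjective : Function.Surjective wrap := by
  rintro ⟨⟨x, y⟩, h⟩
  obtain ⟨u, hu, rfl⟩ := exists_coe_add_half x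
  obtain ⟨v, hv, rfl⟩ := exists_coe_add_half y
  simp only [norm_coe_add_half hu, norm_coe_add_half hv] at h
  exact ⟨⟨(u, v), hu, hv, h⟩, rfl⟩

lemma coe_add_half_eq_iff {u w : ℝ} (hu : |u| ≤ 1 / 2) (hw : |w| ≤ 1 / 2) :
    ((u + 1 / 2 : ℝ) : UnitAddCircle) = ((w + 1 / 2 : ℝ) : UnitAddCircle) ↔
      u = w ∨ (|u| = 1 / 2 ∧ w = -u) := by
  have hu' := abs_le.1 hu
  have hw' := abs_le.1 hw
  rw [← sub_eq_zero, ← AddCircle.coe_sub, AddCircle.coe_eq_zero_iff]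
  constructor
  · rintro ⟨n, hn⟩
    rw [zsmul_eq_mul, mul_one] at hn
    have hlt : n < 2 := by
      have : (n : ℝ) < 2 := by linarith
      exact_mod_cast this
    have hgt : -2 < n := by
      have : (-2 : ℝ) < n := by linarith
      exact_mod_cast this
    obtain rfl | rfl | rfl : n = -1 ∨ n = 0 ∨ n = 1 := by lia
    · push_cast at hn
      have hu_eq : u = -(1 / 2) := by linarith
      exact Or.inr ⟨by rw [hu_eq]; norm_num, by linarith⟩
    · push_cast at hn
      exact Or.inl (by linarith)
    · push_cast at hn
      have hu_eq : u = 1 / 2 := by linarith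
      exact Or.inr ⟨by rw [hu_eq]; norm_num, by linarith⟩
  · rintro (rfl | ⟨hhalf, rfl⟩)
    · exact ⟨0, by simp⟩
    · rcases abs_cases u with ⟨habs, -⟩ | ⟨habs, -⟩
      · exact ⟨1, by simp only [one_zsmul]; linarith⟩
      · exact ⟨-1, by simp only [neg_smul, one_zsmul]; linarith⟩

lemma wrap_eq_iff (v w : cutSquare) : wrap v = wrap w ↔ v.1 = w.1 ∨
    (|v.1.1| = 1 / 2 ∧ w.1 = (-v.1.1, v.1.2)) ∨ (|v.1.2| = 1 / 2 ∧ w.1 = (v.1.1, -v.1.2)) := by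
  have hcoe : wrap v = wrap w ↔
      ((v.1.1 + 1 / 2 : ℝ) : UnitAddCircle) = ((w.1.1 + 1 / 2 : ℝ) : UnitAddCircle) ∧
      ((v.1.2 + 1 / 2 : ℝ) : UnitAddCircle) = ((w.1.2 + 1 / 2 : ℝ) : UnitAddCircle) :=
    Subtype.ext_iff.trans Prod.ext_iff
  rw [hcoe, coe_add_half_eq_iff v.2.1 w.2.1, coe_add_half_eq_iff v.2.2.1 w.2.2.1]
  constructor
  · rintro ⟨hfst | ⟨hhalf, hfst⟩, hsnd | ⟨hhalf', hsnd⟩⟩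
    · exact Or.inl (Prod.ext hfst hsnd)
    · exact Or.inr (Or.inr ⟨hhalf', Prod.ext hfst.symm hsnd⟩)
    · exact Or.inr (Or.inl ⟨hhalf, Prod.ext hfst hsnd.symm⟩)
    · exfalso
      have := v.2.2.2
      rw [hhalf, hhalf'] at this
      norm_num at this
  · rintro (h | ⟨hhalf, h⟩ | ⟨hhalf, h⟩)
    · exact ⟨Or.inl (congrArg Prod.fst h), Or.inl (congrArg Prod.snd h)⟩
    · exact ⟨Or.inr ⟨hhalf, congrArg Prod.fst h⟩, Or.inl (congrArg Prod.snd h).symm⟩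
    · exact ⟨Or.inl (congrArg Prod.fst h).symm, Or.inr ⟨hhalf, congrArg Prod.snd h⟩⟩

lemma isCompact_cutSquare : IsCompact cutSquare := by
  refine (isCompact_Icc (a := ((-(1 / 2), -(1 / 2)) : ℝ × ℝ))
    (b := (1 / 2, 1 / 2))).of_isClosed_subset ?_ ?_
  · have hfst : IsClosed {v : ℝ × ℝ | |v.1| ≤ 1 / 2} := isClosed_le (by fun_prop) (by fun_prop)
    have hsnd : IsClosed {v : ℝ × ℝ | |v.2| ≤ 1 / 2} := isClosed_le (by fun_prop) (by fun_prop)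
    have hcorner : IsClosed {v : ℝ × ℝ |
        (1 / 4 : ℝ) ^ 2 ≤ (1 / 2 - |v.1|) ^ 2 + (1 / 2 - |v.2|) ^ 2} :=
      isClosed_le (by fun_prop) (by fun_prop)
    exact hfst.inter (hsnd.inter hcorner)
  · rintro ⟨u, v⟩ ⟨hu, hv, -⟩
    exact ⟨⟨(abs_le.1 hu).1, (abs_le.1 hv).1⟩, ⟨(abs_le.1 hu).2, (abs_le.1 hv).2⟩⟩

instance : CompactSpace cutSquare := isCompact_iff_compactSpace.1 isCompact_cutSquare

instance : T2Space OneHoledTorus :=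
  inferInstanceAs (T2Space
    {p : UnitAddCircle × UnitAddCircle // (1 / 4 : ℝ) ^ 2 ≤ ‖p.1‖ ^ 2 + ‖p.2‖ ^ 2})

instance : CompactSpace OneHoledTorus :=
  ⟨wrap_surjective.range_eq ▸ isCompact_range continuous_wrap⟩

lemma isQuotientMap_wrap : Topology.IsQuotientMap wrap :=
  continuous_wrap.isClosedMap.isQuotientMap continuous_wrap wrap_surjective

namespace Shape

variable (S : Shape)

/-! ### The marking -/

/-- The first Klein coordinate as a function of the first coordinate of the cut square. -/
def px (u : ℝ) : ℝ := profile ((1 - S.t ^ 2) / S.s) (S.excess / S.s) u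

/-- The second Klein coordinate as a function of the second coordinate of the cut square. -/
def py (u : ℝ) : ℝ := S.swap.px u

lemma excess_swap : S.swap.excess = S.excess := by
  unfold excess
  rw [swap_s, swap_t, add_comm]

lemma one_sub_t_sq_div_s_pos : 0 < (1 - S.t ^ 2) / S.s :=
  div_pos (by nlinarith [S.t_pos, S.t_lt_one]) S.s_pos

lemma excess_div_s_pos : 0 < S.excess / S.s := div_pos S.excess_pos S.s_pos

lemma one_sub_t_sq_div_s_add_excess_div_s : (1 - S.t ^ 2) / S.s + S.excess / S.s = S.s := by
  have := S.s_pos.ne'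
  unfold excess
  field_simp
  ring

lemma continuous_px : Continuous S.px := continuous_profile _ _

lemma continuous_py : Continuous S.py := S.swap.continuous_px

lemma px_neg (u : ℝ) : S.px (-u) = -S.px u := profile_neg _ _ _

lemma py_neg (u : ℝ) : S.py (-u) = -S.py u := S.swap.px_neg u

lemma px_half : S.px (1 / 2) = S.s := by
  rw [px, profile_half, one_sub_t_sq_div_s_add_excess_div_s]

lemma strictMonoOn_px : StrictMonoOn S.px (Set.Icc (-(1 / 2)) (1 / 2)) :=
  strictMonoOn_profile S.one_sub_t_sq_div_s_pos S.excess_div_s_pos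

lemma px_inj {u w : ℝ} (hu : |u| ≤ 1 / 2) (hw : |w| ≤ 1 / 2) : S.px u = S.px w ↔ u = w :=
  S.strictMonoOn_px.injOn.eq_iff (abs_le.1 hu) (abs_le.1 hw)

lemma py_inj {u w : ℝ} (hu : |u| ≤ 1 / 2) (hw : |w| ≤ 1 / 2) : S.py u = S.py w ↔ u = w :=
  S.swap.px_inj hu hw

lemma abs_px {u : ℝ} (hu : |u| ≤ 1 / 2) : |S.px u| = S.px |u| :=
  abs_profile S.one_sub_t_sq_div_s_pos S.excess_div_s_pos hu

lemma abs_py {u : ℝ} (hu : |u| ≤ 1 / 2) : |S.py u| = S.py |u| := S.swap.abs_px hu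

lemma abs_px_le {u : ℝ} (hu : |u| ≤ 1 / 2) : |S.px u| ≤ S.s := by
  rw [S.abs_px hu, ← S.px_half]
  exact S.strictMonoOn_px.monotoneOn ⟨by linarith [abs_nonneg u], hu⟩ ⟨by norm_num, le_rfl⟩ hu

lemma abs_py_le {u : ℝ} (hu : |u| ≤ 1 / 2) : |S.py u| ≤ S.t := S.swap.abs_px_le hu

lemma abs_px_eq_iff {u : ℝ} (hu : |u| ≤ 1 / 2) : |S.px u| = S.s ↔ |u| = 1 / 2 := by
  rw [S.abs_px hu, ← S.px_half]
  exact S.px_inj (by rwa [abs_abs]) (by norm_num)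

lemma abs_py_eq_iff {u : ℝ} (hu : |u| ≤ 1 / 2) : |S.py u| = S.t ↔ |u| = 1 / 2 :=
  S.swap.abs_px_eq_iff hu

lemma exists_px_eq {x : ℝ} (hx : |x| ≤ S.s) : ∃ u, |u| ≤ 1 / 2 ∧ S.px u = x := by
  rw [← S.one_sub_t_sq_div_s_add_excess_div_s] at hx
  obtain ⟨u, hu, hux⟩ := surjOn_profile (abs_le.1 hx)
  exact ⟨u, abs_le.2 hu, hux⟩

lemma exists_py_eq {x : ℝ} (hx : |x| ≤ S.t) : ∃ u, |u| ≤ 1 / 2 ∧ S.py u = x :=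
  S.swap.exists_px_eq hx

lemma s_mul_px_of_ge {u : ℝ} (h : 1 / 4 ≤ u) :
    S.s * S.px u = S.s ^ 2 - S.excess * (16 * (1 / 2 - u) ^ 2) := by
  have := S.s_pos.ne'
  rw [px, profile_of_ge h]
  unfold excess
  field_simp
  ring

lemma s_mul_px_of_lt {u : ℝ} (h0 : 0 ≤ u) (h : u < 1 / 4) : S.s * S.px u < 1 - S.t ^ 2 := by
  have := S.s_pos
  rw [px, profile_of_le h0 h.le]
  rw [show S.s * (4 * ((1 - S.t ^ 2) / S.s) * u) = (1 - S.t ^ 2) * (4 * u) by field_simp]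
  have : 0 < 1 - S.t ^ 2 := by nlinarith [S.t_pos, S.t_lt_one]
  nlinarith

lemma mul_abs_px_add_mul_abs_py_eq_or_lt {u v : ℝ} (hu : |u| ≤ 1 / 2) (hv : |v| ≤ 1 / 2) :
    (S.s * |S.px u| + S.t * |S.py v| - 1 =
      16 * S.excess * ((1 / 4) ^ 2 - ((1 / 2 - |u|) ^ 2 + (1 / 2 - |v|) ^ 2))) ∨
    (S.s * |S.px u| + S.t * |S.py v| < 1 ∧
      (1 / 4 : ℝ) ^ 2 < (1 / 2 - |u|) ^ 2 + (1 / 2 - |v|) ^ 2) := by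
  have hpx := mul_le_mul_of_nonneg_left (S.abs_px_le hu) S.s_pos.le
  have hpy := mul_le_mul_of_nonneg_left (S.abs_py_le hv) S.t_pos.le
  rw [S.abs_px hu, S.abs_py hv] at *
  have hu0 := abs_nonneg u
  have hv0 := abs_nonneg v
  generalize |u| = u at *
  generalize |v| = v at *
  rcases lt_or_ge u (1 / 4) with hu4 | hu4
  · have := S.s_mul_px_of_lt hu0 hu4
    exact Or.inr ⟨by nlinarith, by nlinarith [sq_nonneg (1 / 2 - v)]⟩
  have hswap : S.swap.s * S.swap.px v = S.t * S.py v := rfl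
  rcases lt_or_ge v (1 / 4) with hv4 | hv4
  · have := S.swap.s_mul_px_of_lt hv0 hv4
    rw [hswap, swap_t] at this
    exact Or.inr ⟨by nlinarith, by nlinarith [sq_nonneg (1 / 2 - u)]⟩
  · have hu_eq := S.s_mul_px_of_ge hu4
    have hv_eq := S.swap.s_mul_px_of_ge hv4
    rw [hswap, swap_s, excess_swap] at hv_eq
    have hexcess : S.excess = S.s ^ 2 + S.t ^ 2 - 1 := rfl
    exact Or.inl (by linear_combination hu_eq + hv_eq - hexcess)

lemma mul_abs_px_add_mul_abs_py_le_one_iff {u v : ℝ} (hu : |u| ≤ 1 / 2) (hv : |v| ≤ 1 / 2) :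
    S.s * |S.px u| + S.t * |S.py v| ≤ 1 ↔
      (1 / 4 : ℝ) ^ 2 ≤ (1 / 2 - |u|) ^ 2 + (1 / 2 - |v|) ^ 2 := by
  have hexcess := S.excess_pos
  rcases S.mul_abs_px_add_mul_abs_py_eq_or_lt hu hv with heq | ⟨hlt, hlt'⟩
  · constructor <;> intro h <;> nlinarith
  · exact ⟨fun _ => hlt'.le, fun _ => hlt.le⟩

lemma mul_abs_px_add_mul_abs_py_eq_one_iff {u v : ℝ} (hu : |u| ≤ 1 / 2) (hv : |v| ≤ 1 / 2) :
    S.s * |S.px u| + S.t * |S.py v| = 1 ↔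
      (1 / 2 - |u|) ^ 2 + (1 / 2 - |v|) ^ 2 = (1 / 4 : ℝ) ^ 2 := by
  rcases S.mul_abs_px_add_mul_abs_py_eq_or_lt hu hv with heq | ⟨hlt, hlt'⟩
  · rw [← sub_eq_zero, heq, mul_eq_zero_iff_left (by linarith [S.excess_pos]), sub_eq_zero, eq_comm]
  · exact ⟨fun h => absurd h hlt.ne, fun h => absurd h hlt'.ne'⟩

/-- The map from the cut square to the octagon in Klein coordinates. -/
def toKlein (v : cutSquare) : S.kleinOct :=
  ⟨(S.px v.1.1, S.py v.1.2), S.abs_px_le v.2.1, S.abs_py_le v.2.2.1,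
    (S.mul_abs_px_add_mul_abs_py_le_one_iff v.2.1 v.2.2.1).2 v.2.2.2⟩

lemma continuous_toKlein : Continuous S.toKlein := by
  refine Continuous.subtype_mk (Continuous.prodMk ?_ ?_) _
  · exact S.continuous_px.comp (by fun_prop)
  · exact S.continuous_py.comp (by fun_prop)

lemma toKlein_surjective : Function.Surjective S.toKlein := by
  rintro ⟨⟨x, y⟩, hx, hy, hcorner⟩
  obtain ⟨u, hu, rfl⟩ := S.exists_px_eq hx
  obtain ⟨v, hv, rfl⟩ := S.exists_py_eq hy
  exact ⟨⟨(u, v), hu, hv, (S.mul_abs_px_add_mul_abs_py_le_one_iff hu hv).1 hcorner⟩, rfl⟩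

/-- The projection of the octagon in Klein coordinates to the surface. -/
def kproj (v : S.kleinOct) : S.Surface := S.gluing.proj (S.kleinPt v)

lemma continuous_kproj : Continuous S.kproj := S.gluing.continuous_proj.comp S.continuous_kleinPt

lemma kproj_surjective : Function.Surjective S.kproj :=
  S.gluing.proj_surjective.comp S.kleinPt_surjective

lemma kproj_toKlein_eq_iff (v w : cutSquare) :
    S.kproj (S.toKlein v) = S.kproj (S.toKlein w) ↔ wrap v = wrap w := by
  rw [kproj, kproj, proj_kleinPt_eq_iff, wrap_eq_iff]
  simp only [toKlein, S.abs_px_eq_iff v.2.1, S.abs_py_eq_iff v.2.2.1, Prod.ext_iff, ← px_neg,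
    ← py_neg]
  have hneg₁ : |-v.1.1| ≤ 1 / 2 := by rw [abs_neg]; exact v.2.1
  have hneg₂ : |-v.1.2| ≤ 1 / 2 := by rw [abs_neg]; exact v.2.2.1
  rw [S.px_inj v.2.1 w.2.1, S.py_inj v.2.2.1 w.2.2.1, S.px_inj w.2.1 hneg₁,
    S.py_inj w.2.2.1 v.2.2.1, S.px_inj w.2.1 v.2.1, S.py_inj w.2.2.1 hneg₂]

/-- The map from the one-holed torus to the surface that the map of fundamental domains
induces. -/
def mark (p : OneHoledTorus) : S.Surface :=
  S.kproj (S.toKlein (Function.surjInv wrap_surjective p))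

lemma mark_wrap (v : cutSquare) : S.mark (wrap v) = S.kproj (S.toKlein v) :=
  (S.kproj_toKlein_eq_iff _ _).2 (Function.surjInv_eq wrap_surjective _)

lemma continuous_mark : Continuous S.mark := by
  rw [isQuotientMap_wrap.continuous_iff]
  rw [show S.mark ∘ wrap = S.kproj ∘ S.toKlein from funext S.mark_wrap]
  exact S.continuous_kproj.comp S.continuous_toKlein

lemma mark_bijective : Function.Bijective S.mark := by
  constructor
  · intro p p' h
    obtain ⟨v, rfl⟩ := wrap_surjective p
    obtain ⟨v', rfl⟩ := wrap_surjective p'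
    rw [mark_wrap, mark_wrap] at h
    exact (S.kproj_toKlein_eq_iff _ _).1 h
  · intro x
    obtain ⟨k, rfl⟩ := S.kproj_surjective x
    obtain ⟨v, rfl⟩ := S.toKlein_surjective k
    exact ⟨wrap v, S.mark_wrap v⟩

/-- The marking of the surface, a homeomorphism by compactness. -/
def markHomeo : OneHoledTorus ≃ₜ S.Surface :=
  Continuous.homeoOfEquivCompactToT2 (f := Equiv.ofBijective S.mark S.mark_bijective)
    S.continuous_mark

lemma markHomeo_apply (p : OneHoledTorus) : S.markHomeo p = S.mark p := rfl

lemma mul_abs_cX_add_mul_abs_cY_klein_eq_iff {v : ℝ × ℝ} (hv : v ∈ S.kleinOct) :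
    S.s * |cX (klein v)| + S.t * |cY (klein v)| = cT (klein v) ↔
      S.s * |v.1| + S.t * |v.2| = 1 := by
  have hlt := S.sq_add_sq_lt_one hv
  have hT := cT_pos (klein v)
  rw [cX_klein hlt, cY_klein hlt, abs_mul, abs_mul, abs_of_pos hT, ← mul_assoc, ← mul_assoc,
    ← add_mul, mul_eq_right₀ hT.ne']

lemma wrap_mem_bdry_iff_klein (v : cutSquare) : wrap v ∈ bdry ↔
    S.s * |cX (klein (S.toKlein v).1)| + S.t * |cY (klein (S.toKlein v).1)|
      = cT (klein (S.toKlein v).1) := by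
  rw [wrap_mem_bdry_iff, S.mul_abs_cX_add_mul_abs_cY_klein_eq_iff (S.toKlein v).2,
    ← S.mul_abs_px_add_mul_abs_py_eq_one_iff v.2.1 v.2.2.1]
  rfl

end Shape

/-! ### The length of the boundary -/

section

variable {α E F : Type*} [LinearOrder α] [PseudoEMetricSpace E] [PseudoEMetricSpace F]
  {f : α → E} {g : α → F} {s : Set α}

lemma eVariationOn_le_of_edist_le (h : ∀ x ∈ s, ∀ y ∈ s, edist (f x) (f y) ≤ edist (g x) (g y)) :
    eVariationOn f s ≤ eVariationOn g s := by
  unfold eVariationOn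
  exact iSup_mono fun p => Finset.sum_le_sum fun i _ => h _ (p.2.2.2 _) _ (p.2.2.2 _)

lemma eVariationOn_congr_edist (h : ∀ x ∈ s, ∀ y ∈ s, edist (f x) (f y) = edist (g x) (g y)) :
    eVariationOn f s = eVariationOn g s :=
  le_antisymm (eVariationOn_le_of_edist_le fun x hx y hy => (h x hx y hy).le)
    (eVariationOn_le_of_edist_le fun x hx y hy => (h x hx y hy).ge)

end

lemma eVariationOn_of_monotone_or_antitone {f : ℝ → ℝ} {a b : ℝ} (hab : a ≤ b)
    (h : MonotoneOn f (Set.Icc a b) ∨ AntitoneOn f (Set.Icc a b)) :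
    eVariationOn f (Set.Icc a b) = ENNReal.ofReal |f a - f b| := by
  have of_monotone : ∀ g : ℝ → ℝ, MonotoneOn g (Set.Icc a b) →
      eVariationOn g (Set.Icc a b) = ENNReal.ofReal |g a - g b| := by
    intro g hg
    have ha : a ∈ Set.Icc a b := ⟨le_rfl, hab⟩
    have hb : b ∈ Set.Icc a b := ⟨hab, le_rfl⟩
    have hvar := hg.eVariationOn_eq ha hb
    rw [Set.inter_self] at hvar
    rw [hvar, abs_sub_comm, abs_of_nonneg (sub_nonneg.2 (hg ha hb hab))]
  rcases h with hmono | hanti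
  · exact of_monotone f hmono
  · have hneg := of_monotone (fun x => -f x) hanti.neg
    rw [neg_sub_neg, abs_sub_comm] at hneg
    rw [← hneg]
    refine eVariationOn_congr_edist fun x _ y _ => ?_
    rw [edist_neg_neg]

lemma fold_klein (v : ℝ × ℝ) : fold (klein v) = klein (|v.1|, |v.2|) :=
  ext_cX_cY (by simp [klein, abs_div, abs_of_nonneg (Real.sqrt_nonneg _)])
    (by simp [klein, abs_div, abs_of_nonneg (Real.sqrt_nonneg _)])

lemma cT_klein_eq_div_sqrt {v : ℝ × ℝ} {a c : ℝ} (ha : 0 < a) (hc : 0 < c)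
    (h : 1 - v.1 ^ 2 - v.2 ^ 2 = a / c ^ 2) : cT (klein v) = c / √a := by
  have hpos : 0 < a / c ^ 2 := by positivity
  rw [cT_klein (by linarith), h, Real.sqrt_div ha.le, Real.sqrt_sq hc.le, one_div_div]

lemma cosh_dist_klein {v w : ℝ × ℝ} (hv : v.1 ^ 2 + v.2 ^ 2 < 1) (hw : w.1 ^ 2 + w.2 ^ 2 < 1) :
    cosh (dist (klein v) (klein w)) =
      (1 - v.1 * w.1 - v.2 * w.2) * (cT (klein v) * cT (klein w)) := by
  rw [cosh_dist_eq, cX_klein hv, cY_klein hv, cX_klein hw, cY_klein hw]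
  ring

lemma abs_div_two_add_div_four {σ c : ℝ} (hσ : σ = 1 ∨ σ = -1) (h : σ * c ≤ 0) (hc : |c| ≤ 1) :
    |σ / 2 + c / 4| = 1 / 2 - |c| / 4 := by
  rcases hσ with rfl | rfl
  · have hnonpos : c ≤ 0 := by linarith
    rw [abs_of_nonpos hnonpos] at hc ⊢
    rw [abs_of_nonneg (by linarith)]
    ring
  · have hnonneg : 0 ≤ c := by linarith
    rw [abs_of_nonneg hnonneg] at hc ⊢
    rw [abs_of_nonpos (by linarith)]
    ring

lemma coe_div_two_add_div_four_add_half {σ c : ℝ} (hσ : σ = 1 ∨ σ = -1) :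
    ((σ / 2 + c / 4 + 1 / 2 : ℝ) : UnitAddCircle) = ((c / 4 : ℝ) : UnitAddCircle) := by
  rcases hσ with rfl | rfl
  · rw [← AddCircle.coe_add_period (1 : ℝ) (c / 4)]
    congr 1
    ring
  · congr 1
    ring

lemma exists_sign_mul_cos_nonpos_and_mul_sin_nonpos {a : ℝ} (h : Real.cos a * Real.sin a = 0) :
    ∃ σ τ : ℝ, (σ = 1 ∨ σ = -1) ∧ (τ = 1 ∨ τ = -1) ∧
      ∀ θ ∈ Set.Icc a (a + Real.pi / 2), σ * Real.cos θ ≤ 0 ∧ τ * Real.sin θ ≤ 0 := by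
  have hone := Real.sin_sq_add_cos_sq a
  refine ⟨Real.sin a - Real.cos a, -(Real.cos a + Real.sin a), mul_self_eq_one_iff.1 ?_,
    mul_self_eq_one_iff.1 ?_, fun θ hθ => ?_⟩
  · linear_combination hone - 2 * h
  · linear_combination hone + 2 * h
  · obtain ⟨φ, rfl⟩ : ∃ φ, θ = a + φ := ⟨θ - a, by ring⟩
    have hcos : 0 ≤ Real.cos φ :=
      Real.cos_nonneg_of_mem_Icc ⟨by linarith [hθ.1, Real.pi_pos], by linarith [hθ.2]⟩
    have hsin : 0 ≤ Real.sin φ :=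
      Real.sin_nonneg_of_mem_Icc ⟨by linarith [hθ.1], by linarith [hθ.2, Real.pi_pos]⟩
    have hcos_le : 0 ≤ Real.sin a ^ 2 * Real.sin φ + Real.cos a ^ 2 * Real.cos φ := by positivity
    have hsin_le : 0 ≤ Real.sin a ^ 2 * Real.cos φ + Real.cos a ^ 2 * Real.sin φ := by positivity
    constructor
    · rw [Real.cos_add]
      linear_combination hcos_le + (Real.cos φ + Real.sin φ) * h
    · rw [Real.sin_add]
      linear_combination hsin_le - (Real.cos φ + Real.sin φ) * h

lemma monotoneOn_or_antitoneOn_cos_sq {a : ℝ} (h : Real.cos a * Real.sin a = 0) :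
    MonotoneOn (fun θ => Real.cos θ ^ 2) (Set.Icc a (a + Real.pi / 2)) ∨
      AntitoneOn (fun θ => Real.cos θ ^ 2) (Set.Icc a (a + Real.pi / 2)) := by
  have hone := Real.sin_sq_add_cos_sq a
  have hcos : ∀ θ, Real.cos θ = Real.cos a * Real.cos (θ - a) - Real.sin a * Real.sin (θ - a) :=
    fun θ => by rw [← Real.cos_add, add_sub_cancel]
  have hpi := Real.pi_pos
  rcases mul_eq_zero.1 h with hcos_a | hsin_a
  · have hsq : ∀ θ, Real.cos θ ^ 2 = Real.sin (θ - a) ^ 2 := fun θ => by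
      rw [hcos, hcos_a]
      linear_combination Real.sin (θ - a) ^ 2 * (hone - Real.cos a * hcos_a)
    refine Or.inl fun x hx y hy hxy => ?_
    change Real.cos x ^ 2 ≤ Real.cos y ^ 2
    rw [hsq x, hsq y]
    refine pow_le_pow_left₀ (Real.sin_nonneg_of_mem_Icc ⟨by linarith [hx.1], by linarith [hx.2]⟩)
      (Real.sin_le_sin_of_le_of_le_pi_div_two ?_ ?_ ?_) 2
    all_goals linarith [hx.1, hy.2]
  · have hsq : ∀ θ, Real.cos θ ^ 2 = Real.cos (θ - a) ^ 2 := fun θ => by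
      rw [hcos, hsin_a]
      linear_combination Real.cos (θ - a) ^ 2 * (hone - Real.sin a * hsin_a)
    refine Or.inr fun x hx y hy hxy => ?_
    change Real.cos y ^ 2 ≤ Real.cos x ^ 2
    rw [hsq x, hsq y]
    refine pow_le_pow_left₀ (Real.cos_nonneg_of_mem_Icc ⟨by linarith [hy.1], by linarith [hy.2]⟩)
      (Real.cos_le_cos_of_nonneg_of_le_pi ?_ ?_ ?_) 2
    all_goals linarith [hx.1, hy.2]

namespace Shape

variable (S : Shape)

/-- The signed arc length along the boundary geodesic `s X + t Y = T`, measured from the point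
where it is closest to the centre of the octagon. -/
def edgePos (z : ℍ) : ℝ :=
  arsinh ((S.s * cY z - S.t * cX z) / √(S.s ^ 2 + S.t ^ 2))

lemma cosh_edgePos {z : ℍ} (hz : S.s * cX z + S.t * cY z = cT z) :
    cosh (S.edgePos z) = √S.excess * cT z / √(S.s ^ 2 + S.t ^ 2) := by
  have he := S.excess_pos
  have hR : 0 < S.s ^ 2 + S.t ^ 2 := by have := S.s_pos; positivity
  have hT := cT_pos z
  rw [edgePos, Real.cosh_arsinh, ← Real.sqrt_sq (by positivity : 0 ≤ √S.excess * cT z /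
    √(S.s ^ 2 + S.t ^ 2))]
  congr 1
  rw [div_pow, div_pow, mul_pow, Real.sq_sqrt hR.le, Real.sq_sqrt he.le]
  field_simp
  unfold excess
  linear_combination (-(S.s * cX z + S.t * cY z) - cT z) * hz - (S.s ^ 2 + S.t ^ 2) * cT_sq z

lemma dist_eq_abs_edgePos_sub {z w : ℍ} (hz : S.s * cX z + S.t * cY z = cT z)
    (hw : S.s * cX w + S.t * cY w = cT w) : dist z w = |S.edgePos z - S.edgePos w| := by
  refine dist_eq_abs_of_cosh_dist_eq ?_
  have hexcess := S.excess_pos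
  have hnorm : 0 < S.s ^ 2 + S.t ^ 2 := by have := S.s_pos; positivity
  have hcosh : √S.excess * cT z / √(S.s ^ 2 + S.t ^ 2) * (√S.excess * cT w / √(S.s ^ 2 + S.t ^ 2))
      = S.excess * cT z * cT w / (S.s ^ 2 + S.t ^ 2) := by
    rw [div_mul_div_comm, Real.mul_self_sqrt hnorm.le]
    congr 1
    rw [mul_mul_mul_comm, Real.mul_self_sqrt hexcess.le]
    ring
  rw [Real.cosh_sub, S.cosh_edgePos hz, S.cosh_edgePos hw, edgePos, edgePos, Real.sinh_arsinh,
    Real.sinh_arsinh, cosh_dist_eq, hcosh, div_mul_div_comm, Real.mul_self_sqrt hnorm.le, excess]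
  field_simp
  linear_combination -cT w * hz - (S.s * cX z + S.t * cY z) * hw

lemma tanh_edgePos {z : ℍ} (hz : S.s * cX z + S.t * cY z = cT z) :
    tanh (S.edgePos z) = (S.s * cY z - S.t * cX z) / cT z / √S.excess := by
  have hexcess := S.excess_pos
  have hnorm : 0 < S.s ^ 2 + S.t ^ 2 := by have := S.s_pos; positivity
  have hT := cT_pos z
  rw [Real.tanh_eq_sinh_div_cosh, S.cosh_edgePos hz, edgePos, Real.sinh_arsinh]
  field_simp

lemma edgePos_le_edgePos {z w : ℍ} (hz : S.s * cX z + S.t * cY z = cT z)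
    (hw : S.s * cX w + S.t * cY w = cT w)
    (h : (S.s * cY z - S.t * cX z) / cT z ≤ (S.s * cY w - S.t * cX w) / cT w) :
    S.edgePos z ≤ S.edgePos w := by
  rw [← Real.artanh_tanh (S.edgePos z), ← Real.artanh_tanh (S.edgePos w)]
  refine Real.artanh_le_artanh (Real.neg_one_lt_tanh _) (Real.tanh_lt_one _) ?_
  rw [S.tanh_edgePos hz, S.tanh_edgePos hw]
  exact div_le_div_of_nonneg_right h (Real.sqrt_nonneg _)

/-- The boundary edge of the octagon in the first quadrant, in Klein coordinates. It runs from the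
wall `X = s T` at `κ = 0` to the wall `Y = t T` at `κ = 1`. -/
def edge (κ : ℝ) : ℝ × ℝ := (S.s - S.excess * κ / S.s, S.t - S.excess * (1 - κ) / S.t)

lemma edge_fst_nonneg {κ : ℝ} (h : κ ≤ 1) : 0 ≤ (S.edge κ).1 := by
  have hexcess := S.excess_pos
  have hle : S.excess ≤ S.s ^ 2 := by unfold excess; nlinarith [S.t_pos, S.t_lt_one]
  simp only [edge]
  rw [sub_nonneg, div_le_iff₀ S.s_pos]
  nlinarith

lemma edge_snd_nonneg {κ : ℝ} (h : 0 ≤ κ) : 0 ≤ (S.edge κ).2 := by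
  have hexcess := S.excess_pos
  have hle : S.excess ≤ S.t ^ 2 := by unfold excess; nlinarith [S.s_pos, S.s_lt_one]
  simp only [edge]
  rw [sub_nonneg, div_le_iff₀ S.t_pos]
  nlinarith

lemma mul_edge_fst_add_mul_edge_snd (κ : ℝ) : S.s * (S.edge κ).1 + S.t * (S.edge κ).2 = 1 := by
  have hs := S.s_pos.ne'
  have ht := S.t_pos.ne'
  simp only [edge, excess]
  field_simp
  ring

lemma edge_mem_kleinOct {κ : ℝ} (h0 : 0 ≤ κ) (h1 : κ ≤ 1) : S.edge κ ∈ S.kleinOct := by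
  have hfst : 0 ≤ S.excess * κ / S.s := div_nonneg (mul_nonneg S.excess_pos.le h0) S.s_pos.le
  have hsnd : 0 ≤ S.excess * (1 - κ) / S.t :=
    div_nonneg (mul_nonneg S.excess_pos.le (sub_nonneg.2 h1)) S.t_pos.le
  rw [kleinOct, Set.mem_ofPred_eq, abs_of_nonneg (S.edge_fst_nonneg h1),
    abs_of_nonneg (S.edge_snd_nonneg h0)]
  exact ⟨sub_le_self _ hfst, sub_le_self _ hsnd, (S.mul_edge_fst_add_mul_edge_snd κ).le⟩

lemma mul_cX_add_mul_cY_klein_edge {κ : ℝ} (h0 : 0 ≤ κ) (h1 : κ ≤ 1) :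
    S.s * cX (klein (S.edge κ)) + S.t * cY (klein (S.edge κ)) = cT (klein (S.edge κ)) := by
  have hlt := S.sq_add_sq_lt_one (S.edge_mem_kleinOct h0 h1)
  rw [cX_klein hlt, cY_klein hlt]
  linear_combination cT (klein (S.edge κ)) * S.mul_edge_fst_add_mul_edge_snd κ

lemma monotoneOn_edgePos_klein_edge :
    MonotoneOn (fun κ => S.edgePos (klein (S.edge κ))) (Set.Icc 0 1) := by
  intro κ hκ κ' hκ' h
  have hslope : ∀ κ ∈ Set.Icc (0 : ℝ) 1,
      (S.s * cY (klein (S.edge κ)) - S.t * cX (klein (S.edge κ))) / cT (klein (S.edge κ))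
        = S.s * (S.edge κ).2 - S.t * (S.edge κ).1 := by
    intro κ hκ
    have hlt := S.sq_add_sq_lt_one (S.edge_mem_kleinOct hκ.1 hκ.2)
    have hT := (cT_pos (klein (S.edge κ))).ne'
    rw [cX_klein hlt, cY_klein hlt]
    field_simp
  refine S.edgePos_le_edgePos (S.mul_cX_add_mul_cY_klein_edge hκ.1 hκ.2)
    (S.mul_cX_add_mul_cY_klein_edge hκ'.1 hκ'.2) ?_
  rw [hslope κ hκ, hslope κ' hκ']
  have hs := S.s_pos
  have ht := S.t_pos
  have hexcess := S.excess_pos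
  simp only [edge]
  gcongr

lemma cosh_p_sq_mul : cosh S.p ^ 2 * (1 - S.s ^ 2) = 1 := by
  have hsinh : sinh S.p ^ 2 = (S.s * cosh S.p) ^ 2 := by rw [S.sinh_p]
  linear_combination Real.cosh_sq S.p + hsinh

lemma cT_klein_edge_zero : cT (klein (S.edge 0)) = S.t * cosh S.p / √S.excess := by
  have hs := S.s_pos
  have ht := S.t_pos
  have hcosh := Real.cosh_pos S.p
  refine cT_klein_eq_div_sqrt S.excess_pos (mul_pos ht hcosh) ?_
  have hunit := S.cosh_p_sq_mul
  simp only [edge, excess]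
  field_simp
  linear_combination S.s ^ 2 * (S.s ^ 2 + S.t ^ 2 - 1) * hunit

lemma cT_klein_edge_one : cT (klein (S.edge 1)) = S.s * cosh S.q / √S.excess := by
  have hs := S.s_pos
  have ht := S.t_pos
  have hcosh := Real.cosh_pos S.q
  refine cT_klein_eq_div_sqrt S.excess_pos (mul_pos hs hcosh) ?_
  have hunit : cosh S.q ^ 2 * (1 - S.t ^ 2) = 1 := S.swap.cosh_p_sq_mul
  simp only [edge, excess]
  field_simp
  linear_combination S.t ^ 2 * (S.s ^ 2 + S.t ^ 2 - 1) * hunit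

lemma cosh_dist_klein_edge_zero_one :
    cosh (dist (klein (S.edge 0)) (klein (S.edge 1))) = sinh S.p * sinh S.q := by
  have hsinh_q : sinh S.q = S.t * cosh S.q := S.swap.sinh_p
  have hs := S.s_pos.ne'
  have ht := S.t_pos.ne'
  have hexcess := S.excess_pos
  have hinner : 1 - (S.edge 0).1 * (S.edge 1).1 - (S.edge 0).2 * (S.edge 1).2 = S.excess := by
    simp only [edge, excess]
    field_simp
    ring
  rw [cosh_dist_klein (S.sq_add_sq_lt_one (S.edge_mem_kleinOct le_rfl zero_le_one))
    (S.sq_add_sq_lt_one (S.edge_mem_kleinOct zero_le_one le_rfl)), hinner, S.cT_klein_edge_zero,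
    S.cT_klein_edge_one, S.sinh_p, hsinh_q, div_mul_div_comm, Real.mul_self_sqrt hexcess.le]
  field_simp

lemma px_div_two_add_div_four {σ c : ℝ} (hσ : σ = 1 ∨ σ = -1) (h : σ * c ≤ 0) (hc : |c| ≤ 1) :
    S.px (σ / 2 + c / 4) = σ * (S.s - S.excess * c ^ 2 / S.s) := by
  have hs := S.s_pos.ne'
  have hpx : S.px (1 / 2 - |c| / 4) = S.s - S.excess * c ^ 2 / S.s := by
    have hmul := S.s_mul_px_of_ge (u := 1 / 2 - |c| / 4) (by linarith)
    rw [sub_sub_cancel, div_pow, sq_abs] at hmul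
    generalize S.px (1 / 2 - |c| / 4) = x at hmul ⊢
    field_simp
    linear_combination hmul
  rcases hσ with rfl | rfl
  · rw [← hpx, one_mul, abs_of_nonpos (by linarith)]
    congr 1
    ring
  · rw [← hpx, neg_one_mul, ← px_neg, abs_of_nonneg (by linarith)]
    congr 1
    ring

lemma py_div_two_add_div_four {σ c : ℝ} (hσ : σ = 1 ∨ σ = -1) (h : σ * c ≤ 0) (hc : |c| ≤ 1) :
    S.py (σ / 2 + c / 4) = σ * (S.t - S.excess * c ^ 2 / S.t) := by
  rw [py, S.swap.px_div_two_add_div_four hσ h hc, excess_swap, swap_s]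

lemma exists_wrap_eq_boundaryLoop {σ τ θ : ℝ} (hσ : σ = 1 ∨ σ = -1) (hτ : τ = 1 ∨ τ = -1)
    (hcos : σ * Real.cos θ ≤ 0) (hsin : τ * Real.sin θ ≤ 0) :
    ∃ v : cutSquare, wrap v = boundaryLoop (Circle.exp θ) ∧
      (S.toKlein v).1 = (σ * (S.edge (Real.cos θ ^ 2)).1, τ * (S.edge (Real.cos θ ^ 2)).2) := by
  have hcos_le := Real.abs_cos_le_one θ
  have hsin_le := Real.abs_sin_le_one θ
  have hfst := abs_div_two_add_div_four hσ hcos hcos_le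
  have hsnd := abs_div_two_add_div_four hτ hsin hsin_le
  refine ⟨⟨(σ / 2 + Real.cos θ / 4, τ / 2 + Real.sin θ / 4), ?_, ?_, ?_⟩, ?_, ?_⟩
  · rw [hfst]
    linarith [abs_nonneg (Real.cos θ)]
  · rw [hsnd]
    linarith [abs_nonneg (Real.sin θ)]
  · simp only [hfst, hsnd, sub_sub_cancel, div_pow, sq_abs]
    linarith [Real.sin_sq_add_cos_sq θ]
  · refine Subtype.ext (Prod.ext ?_ ?_)
    · change ((σ / 2 + Real.cos θ / 4 + 1 / 2 : ℝ) : UnitAddCircle)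
        = (((Circle.exp θ : ℂ).re / 4 : ℝ) : UnitAddCircle)
      rw [coe_div_two_add_div_four_add_half hσ, Circle.coe_exp, Complex.exp_ofReal_mul_I_re]
    · change ((τ / 2 + Real.sin θ / 4 + 1 / 2 : ℝ) : UnitAddCircle)
        = (((Circle.exp θ : ℂ).im / 4 : ℝ) : UnitAddCircle)
      rw [coe_div_two_add_div_four_add_half hτ, Circle.coe_exp, Complex.exp_ofReal_mul_I_im]
  · refine Prod.ext (S.px_div_two_add_div_four hσ hcos hcos_le) ?_
    exact (S.py_div_two_add_div_four hτ hsin hsin_le).trans (by rw [Real.sin_sq, edge])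

lemma dist_kproj_eq {v w : S.kleinOct} (hfst : 0 ≤ v.1.1 * w.1.1) (hsnd : 0 ≤ v.1.2 * w.1.2) :
    dist (S.kproj v) (S.kproj w) = dist (klein (|v.1.1|, |v.1.2|)) (klein (|w.1.1|, |w.1.2|)) := by
  have hv := S.sq_add_sq_lt_one v.2
  have hw := S.sq_add_sq_lt_one w.2
  have hT : 0 ≤ cT (klein v.1) * cT (klein w.1) := (mul_pos (cT_pos _) (cT_pos _)).le
  have hX : 0 ≤ cX (klein v.1) * cX (klein w.1) := by
    rw [cX_klein hv, cX_klein hw, mul_mul_mul_comm]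
    exact mul_nonneg hfst hT
  have hY : 0 ≤ cY (klein v.1) * cY (klein w.1) := by
    rw [cY_klein hv, cY_klein hw, mul_mul_mul_comm]
    exact mul_nonneg hsnd hT
  rw [← fold_klein, ← fold_klein, dist_fold_eq hX hY]
  exact S.dist_proj_eq (x := S.kleinPt v) (y := S.kleinPt w) hX hY

lemma edist_mark_boundaryLoop {σ τ θ θ' : ℝ} (hσ : σ = 1 ∨ σ = -1) (hτ : τ = 1 ∨ τ = -1)
    (h : σ * Real.cos θ ≤ 0 ∧ τ * Real.sin θ ≤ 0)
    (h' : σ * Real.cos θ' ≤ 0 ∧ τ * Real.sin θ' ≤ 0) :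
    edist (S.mark (boundaryLoop (Circle.exp θ))) (S.mark (boundaryLoop (Circle.exp θ'))) =
      edist (S.edgePos (klein (S.edge (Real.cos θ ^ 2))))
        (S.edgePos (klein (S.edge (Real.cos θ' ^ 2)))) := by
  obtain ⟨v, hv, hv_edge⟩ := S.exists_wrap_eq_boundaryLoop hσ hτ h.1 h.2
  obtain ⟨w, hw, hw_edge⟩ := S.exists_wrap_eq_boundaryLoop hσ hτ h'.1 h'.2
  have abs_sign_mul : ∀ {ρ x : ℝ}, ρ = 1 ∨ ρ = -1 → 0 ≤ x → |ρ * x| = x := by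
    rintro ρ x (rfl | rfl) hx <;> simpa using hx
  have sign_mul_nonneg : ∀ {ρ x y : ℝ}, ρ = 1 ∨ ρ = -1 → 0 ≤ x → 0 ≤ y →
      0 ≤ ρ * x * (ρ * y) := by
    rintro ρ x y (rfl | rfl) hx hy <;> simpa using mul_nonneg hx hy
  have hle := Real.cos_sq_le_one θ
  have hle' := Real.cos_sq_le_one θ'
  have hnonneg := sq_nonneg (Real.cos θ)
  have hnonneg' := sq_nonneg (Real.cos θ')
  rw [← hv, ← hw, mark_wrap, mark_wrap, edist_dist, edist_dist, Real.dist_eq,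
    ← S.dist_eq_abs_edgePos_sub (S.mul_cX_add_mul_cY_klein_edge hnonneg hle)
      (S.mul_cX_add_mul_cY_klein_edge hnonneg' hle'), S.dist_kproj_eq, hv_edge, hw_edge,
    abs_sign_mul hσ (S.edge_fst_nonneg hle), abs_sign_mul hτ (S.edge_snd_nonneg hnonneg),
    abs_sign_mul hσ (S.edge_fst_nonneg hle'), abs_sign_mul hτ (S.edge_snd_nonneg hnonneg')]
  · rw [hv_edge, hw_edge]
    exact sign_mul_nonneg hσ (S.edge_fst_nonneg hle) (S.edge_fst_nonneg hle')
  · rw [hv_edge, hw_edge]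
    exact sign_mul_nonneg hτ (S.edge_snd_nonneg hnonneg) (S.edge_snd_nonneg hnonneg')

lemma eVariationOn_mark_boundaryLoop_quarter {a : ℝ} (ha : Real.cos a * Real.sin a = 0) :
    eVariationOn (fun θ => S.mark (boundaryLoop (Circle.exp θ))) (Set.Icc a (a + Real.pi / 2))
      = ENNReal.ofReal (dist (klein (S.edge 0)) (klein (S.edge 1))) := by
  obtain ⟨σ, τ, hσ, hτ, hsign⟩ := exists_sign_mul_cos_nonpos_and_mul_sin_nonpos ha
  have hmaps : Set.MapsTo (fun θ => Real.cos θ ^ 2) (Set.Icc a (a + Real.pi / 2))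
      (Set.Icc 0 1) := fun θ _ => ⟨sq_nonneg _, Real.cos_sq_le_one θ⟩
  have hone := Real.sin_sq_add_cos_sq a
  rw [eVariationOn_congr_edist (g := fun θ => S.edgePos (klein (S.edge (Real.cos θ ^ 2))))
    fun x hx y hy => S.edist_mark_boundaryLoop hσ hτ (hsign x hx) (hsign y hy),
    eVariationOn_of_monotone_or_antitone
      (f := fun θ => S.edgePos (klein (S.edge (Real.cos θ ^ 2)))) (by linarith [Real.pi_pos])
      ((monotoneOn_or_antitoneOn_cos_sq ha).imp
        (fun hmono => S.monotoneOn_edgePos_klein_edge.comp hmono hmaps)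
        fun hanti => S.monotoneOn_edgePos_klein_edge.comp_AntitoneOn hanti hmaps),
    S.dist_eq_abs_edgePos_sub (S.mul_cX_add_mul_cY_klein_edge le_rfl zero_le_one)
      (S.mul_cX_add_mul_cY_klein_edge zero_le_one le_rfl), Real.cos_add_pi_div_two, neg_sq]
  rcases mul_eq_zero.1 ha with hcos | hsin
  · rw [hcos, zero_pow two_ne_zero] at hone ⊢
    rw [add_zero] at hone
    rw [hone]
  · rw [hsin, zero_pow two_ne_zero] at hone ⊢
    rw [zero_add] at hone
    rw [hone, abs_sub_comm]

lemma eVariationOn_mark_boundaryLoop_Icc_zero (n : ℕ) :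
    eVariationOn (fun θ => S.mark (boundaryLoop (Circle.exp θ))) (Set.Icc 0 (n * (Real.pi / 2)))
      = n * ENNReal.ofReal (dist (klein (S.edge 0)) (klein (S.edge 1))) := by
  have hpi := Real.pi_pos
  induction n with
  | zero => simp
  | succ n ih =>
    have hquarter : Real.cos (n * (Real.pi / 2)) * Real.sin (n * (Real.pi / 2)) = 0 := by
      have hdouble := Real.sin_two_mul (n * (Real.pi / 2))
      rw [show 2 * (n * (Real.pi / 2)) = n * Real.pi by ring, Real.sin_nat_mul_pi] at hdouble
      linarith
    have hsplit := eVariationOn.Icc_add_Icc (fun θ => S.mark (boundaryLoop (Circle.exp θ)))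
      (s := Set.univ) (a := 0) (b := n * (Real.pi / 2)) (c := n * (Real.pi / 2) + Real.pi / 2)
      (by positivity) (by linarith) (Set.mem_univ _)
    simp only [Set.univ_inter] at hsplit
    rw [Nat.cast_succ, Nat.cast_succ, add_one_mul, add_one_mul, ← hsplit, ih,
      S.eVariationOn_mark_boundaryLoop_quarter hquarter]

lemma loopLength_boundaryLoop : loopLength (fun z => S.markHomeo (boundaryLoop z)) =
    4 * ENNReal.ofReal (dist (klein (S.edge 0)) (klein (S.edge 1))) := by
  have hquarters := S.eVariationOn_mark_boundaryLoop_Icc_zero 4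
  rw [Nat.cast_ofNat, show (4 : ℝ) * (Real.pi / 2) = 2 * Real.pi by ring] at hquarters
  exact hquarters

/-- The marked hyperbolic torus of a given shape. The shape determines the boundary length `b`, to
which `h` asserts equality. -/
def toMarkedTorus (b : ℝ) (hb : 0 ≤ b)
    (h : cosh (b / 4) = sinh S.p * sinh S.q) : MarkedTorus b where
  carrier := S.Surface
  marking := S.markHomeo
  exists_short_path := fun x y _ => S.gluing.exists_path_le_dist_add S.exists_path_of_gluing x y
  interior_hyperbolic p hp := by
    obtain ⟨v, rfl⟩ := wrap_surjective p
    rw [markHomeo_apply, mark_wrap]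
    refine S.isModeledAt_of_lt _ (lt_of_le_of_ne (S.kleinPt (S.toKlein v)).2.2.2 ?_)
    rwa [S.wrap_mem_bdry_iff_klein] at hp
  boundary_geodesic p hp := by
    obtain ⟨v, rfl⟩ := wrap_surjective p
    rw [markHomeo_apply, mark_wrap]
    refine S.isModeledAt_of_eq _ ?_
    rwa [S.wrap_mem_bdry_iff_klein] at hp
  boundary_length := by
    have hdist := dist_eq_abs_of_cosh_dist_eq (S.cosh_dist_klein_edge_zero_one.trans h.symm)
    rw [abs_of_nonneg (by linarith)] at hdist
    rw [S.loopLength_boundaryLoop, hdist, ← ENNReal.ofReal_ofNat 4,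
      ← ENNReal.ofReal_mul (by norm_num), mul_div_cancel₀ _ four_ne_zero]

end Shape

/-! ### A Lipschitz map between the tori of a shape and of the swapped shape -/

lemma sinh_le_two_mul {d : ℝ} (hd₀ : 0 ≤ d) (hd₁ : d ≤ 1) : sinh d ≤ 2 * d := by
  have hexp := (le_abs_self _).trans
    (Real.abs_exp_sub_one_le (x := d) (by rwa [abs_of_nonneg hd₀]))
  rw [abs_of_nonneg hd₀] at hexp
  have hexp_neg := Real.add_one_le_exp (-d)
  rw [Real.sinh_eq]
  linarith

lemma sinh_dist_sq (z w : ℍ) : sinh (dist z w) ^ 2 =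
    (cX z * cT w - cX w * cT z) ^ 2 + (cY z * cT w - cY w * cT z) ^ 2
      - (cX z * cY w - cX w * cY z) ^ 2 := by
  rw [Real.sinh_sq, cosh_dist_eq]
  linear_combination (cT w ^ 2 - cX w ^ 2 - cY w ^ 2) * cT_sq z + cT_sq w

lemma abs_cX_div_cT_sub_le_sinh_dist (z w : ℍ) :
    |cX z / cT z - cX w / cT w| ≤ sinh (dist z w) := by
  have hTz := cT_pos z
  have hTw := cT_pos w
  refine abs_le_of_sq_le_sq ?_ (Real.sinh_nonneg_iff.2 dist_nonneg)
  rw [div_sub_div _ _ hTz.ne' hTw.ne', div_pow, div_le_iff₀ (by positivity),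
    mul_comm (cT z) (cX w)]
  set a := cX z * cT w - cX w * cT z
  set b := cY z * cT w - cY w * cT z
  have hsum : cT z ^ 2 * sinh (dist z w) ^ 2 = a ^ 2 + b ^ 2 + (cX z * a + cY z * b) ^ 2 := by
    rw [sinh_dist_sq]
    linear_combination (a ^ 2 + b ^ 2) * cT_sq z
  calc a ^ 2 ≤ cT z ^ 2 * sinh (dist z w) ^ 2 := by
        rw [hsum]
        linarith [sq_nonneg b, sq_nonneg (cX z * a + cY z * b)]
    _ ≤ cT z ^ 2 * sinh (dist z w) ^ 2 * cT w ^ 2 :=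
        le_mul_of_one_le_right (by positivity) (one_le_pow₀ (one_le_cT w))
    _ = sinh (dist z w) ^ 2 * (cT z * cT w) ^ 2 := by ring

lemma abs_cX_div_cT_sub_le_two_mul_dist (z w : ℍ) :
    |cX z / cT z - cX w / cT w| ≤ 2 * dist z w := by
  rcases le_total (dist z w) 1 with h | h
  · exact (abs_cX_div_cT_sub_le_sinh_dist z w).trans (sinh_le_two_mul dist_nonneg h)
  · have abs_le_one : ∀ u : ℍ, |cX u / cT u| ≤ 1 := fun u => by
      rw [abs_div, abs_of_pos (cT_pos u), div_le_one (cT_pos u)]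
      exact (abs_cX_lt_cT u).le
    linarith [abs_sub (cX z / cT z) (cX w / cT w), abs_le_one z, abs_le_one w]

lemma abs_cY_div_cT_sub_le_two_mul_dist (z w : ℍ) :
    |cY z / cT z - cY w / cT w| ≤ 2 * dist z w := by
  simpa [swapXY.isometry.dist_eq] using
    abs_cX_div_cT_sub_le_two_mul_dist (swapXY z) (swapXY w)

lemma klein_tanh_zero (a : ℝ) : klein (tanh a, 0) = ofCoords (sinh a) 0 := by
  have hcosh := Real.cosh_pos a
  have hsq : 1 - tanh a ^ 2 - (0 : ℝ) ^ 2 = (1 / cosh a) ^ 2 := by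
    rw [Real.tanh_eq_sinh_div_cosh]
    field_simp
    linear_combination Real.cosh_sq a
  rw [klein, hsq, Real.sqrt_sq (by positivity), zero_div, Real.tanh_eq_sinh_div_cosh,
    div_div_div_cancel_right₀ hcosh.ne', div_one]

lemma swapXY_klein (v : ℝ × ℝ) : swapXY (klein v) = klein (v.2, v.1) := by
  have : 1 - v.1 ^ 2 - v.2 ^ 2 = 1 - v.2 ^ 2 - v.1 ^ 2 := sub_right_comm _ _ _
  exact ext_cX_cY (by simp [klein, this]) (by simp [klein, this])

lemma dist_klein_tanh_zero (a b : ℝ) :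
    dist (klein (tanh a, 0)) (klein (tanh b, 0)) = |a - b| := by
  rw [klein_tanh_zero, klein_tanh_zero,
    dist_eq_abs_arsinh_cX_sub (cY_ofCoords _ _) (cY_ofCoords _ _), cX_ofCoords, cX_ofCoords,
    Real.arsinh_sinh, Real.arsinh_sinh]

lemma dist_klein_zero_tanh (a b : ℝ) :
    dist (klein (0, tanh a)) (klein (0, tanh b)) = |a - b| := by
  rw [← dist_klein_tanh_zero, ← swapXY_klein (tanh a, 0), ← swapXY_klein (tanh b, 0),
    swapXY.isometry.dist_eq]

lemma dist_klein_tanh_le {a b a' b' : ℝ} (h : a = 0 ∨ b = 0) (h' : a' = 0 ∨ b' = 0) :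
    dist (klein (tanh a, tanh b)) (klein (tanh a', tanh b')) ≤ |a - a'| + |b - b'| := by
  have through_origin : ∀ a b : ℝ,
      dist (klein (tanh a, 0)) (klein (0, tanh b)) ≤ |a| + |b| := fun a b => by
    have hfst := dist_klein_tanh_zero a 0
    have hsnd := dist_klein_zero_tanh 0 b
    rw [Real.tanh_zero, sub_zero] at hfst
    rw [Real.tanh_zero, zero_sub, abs_neg] at hsnd
    exact (dist_triangle _ (klein (0, 0)) _).trans_eq (by rw [hfst, hsnd])
  rcases h with rfl | rfl <;> rcases h' with rfl | rfl <;> rw [Real.tanh_zero]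
  · simp [dist_klein_zero_tanh]
  · rw [dist_comm]
    simpa using through_origin a' b
  · simpa using through_origin a b'
  · simp [dist_klein_tanh_zero]

lemma monotone_tanh : Monotone tanh := fun a b h =>
  (Real.artanh_le_artanh_iff (Real.tanh_bijOn.mapsTo trivial)
    (Real.tanh_bijOn.mapsTo trivial)).1 (by rwa [Real.artanh_tanh, Real.artanh_tanh])

lemma continuous_tanh : Continuous tanh := by
  simp only [funext Real.tanh_eq_sinh_div_cosh]
  exact Real.continuous_sinh.div Real.continuous_cosh fun x => (Real.cosh_pos x).ne'

lemma abs_tanh (a : ℝ) : |tanh a| = tanh |a| := by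
  rcases le_total 0 a with h | h
  · rw [abs_of_nonneg h, abs_of_nonneg (Real.tanh_zero ▸ monotone_tanh h)]
  · rw [abs_of_nonpos h, Real.tanh_neg, abs_of_nonpos (Real.tanh_zero ▸ monotone_tanh h)]

lemma abs_tanh_mul {q : ℝ} (hq : 0 ≤ q) (r : ℝ) : |tanh (q * r)| = tanh (q * |r|) := by
  rw [abs_tanh, abs_mul, abs_of_nonneg hq]

/-- The odd function that vanishes on `[-c, c]` and is affine from `c` to `m` with value `1`
at `m`. -/
def ramp (c m u : ℝ) : ℝ := (u - max (-c) (min c u)) / (m - c)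

lemma continuous_ramp (c m : ℝ) : Continuous (ramp c m) := by
  unfold ramp
  fun_prop

lemma ramp_neg {c : ℝ} (hc : 0 ≤ c) (m u : ℝ) : ramp c m (-u) = -ramp c m u := by
  unfold ramp
  rw [← neg_div]
  congr 1
  rw [min_def, min_def, max_def, max_def]
  split_ifs <;> linarith

lemma ramp_of_abs_le {c m u : ℝ} (h : |u| ≤ c) : ramp c m u = 0 := by
  have h := abs_le.1 h
  rw [ramp, min_eq_right h.2, max_eq_right h.1, sub_self, zero_div]

lemma ramp_self {c m : ℝ} (hc : 0 ≤ c) (h : c < m) : ramp c m m = 1 := by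
  rw [ramp, min_eq_left h.le, max_eq_right (by linarith)]
  exact div_self (by linarith)

lemma abs_ramp_sub_le {c m : ℝ} (hc : 0 ≤ c) (h : c < m) (u w : ℝ) :
    |ramp c m u - ramp c m w| ≤ |u - w| / (m - c) := by
  rw [ramp, ramp, ← sub_div, abs_div, abs_of_pos (sub_pos.2 h)]
  refine div_le_div_of_nonneg_right ?_ (sub_pos.2 h).le
  rw [min_def, min_def, max_def, max_def]
  split_ifs <;> rcases abs_cases (u - w) with ⟨habs, hsign⟩ | ⟨habs, hsign⟩ <;>
    rw [habs, abs_le] <;> constructor <;> linarith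

lemma abs_ramp_eq_one {c m u : ℝ} (hc : 0 ≤ c) (h : c < m) (hu : |u| = m) :
    |ramp c m u| = 1 := by
  rcases eq_or_eq_neg_of_abs_eq hu with rfl | rfl
  · rw [ramp_self hc h, abs_one]
  · rw [ramp_neg hc, ramp_self hc h, abs_neg, abs_one]

lemma abs_ramp_le_one {c m u : ℝ} (hc : 0 ≤ c) (h : c < m) (hu : |u| ≤ m) :
    |ramp c m u| ≤ 1 := by
  have hu := abs_le.1 hu
  rw [ramp, abs_div, abs_of_pos (sub_pos.2 h), div_le_one (sub_pos.2 h), min_def, max_def, abs_le]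
  split_ifs <;> constructor <;> linarith

lemma curveLength_le_mul_of_homotopic {b b' : ℝ} {h : MarkedTorus b} {h' : MarkedTorus b'}
    {K : NNReal} {f : h.carrier → h'.carrier} (hf : LipschitzWith K f)
    (hhom : (ContinuousMap.comp ⟨f, hf.continuous⟩
      (h.marking : C(OneHoledTorus, h.carrier))).Homotopic h'.marking)
    (γ : C(Circle, OneHoledTorus)) : curveLength h' γ ≤ K * curveLength h γ := by
  have le_mul_loopLength : ∀ c : C(Circle, OneHoledTorus), γ.Homotopic c →
      curveLength h' γ ≤ K * loopLength fun z => h.marking (c z) := by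
    intro c hc
    let F : C(OneHoledTorus, OneHoledTorus) := ⟨fun p => h'.marking.symm (f (h.marking p)),
      h'.marking.symm.continuous.comp (hf.continuous.comp h.marking.continuous)⟩
    have hF : F.Homotopic (ContinuousMap.id _) := by
      have := (ContinuousMap.Homotopic.refl
        (h'.marking.symm : C(h'.carrier, OneHoledTorus))).comp hhom
      rwa [show (h'.marking.symm : C(h'.carrier, OneHoledTorus)).comp h'.marking =
        ContinuousMap.id _ from ContinuousMap.ext h'.marking.symm_apply_apply] at this
    have hγ : γ.Homotopic (F.comp c) :=
      hc.trans (hF.comp (ContinuousMap.Homotopic.refl c)).symm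
    refine (iInf₂_le _ hγ).trans ?_
    simp only [F, ContinuousMap.comp_apply, ContinuousMap.coe_mk, Homeomorph.apply_symm_apply]
    exact (hf.lipschitzOnWith (s := Set.univ)).comp_eVariationOn_le
      (g := fun t : ℝ => h.marking (c (Circle.exp t))) (Set.mapsTo_univ _ _)
  rw [curveLength.eq_def h, iInf_subtype', ENNReal.mul_iInf' (fun h => absurd h ENNReal.coe_ne_top)
    fun _ => ⟨γ, ContinuousMap.Homotopic.refl γ⟩]
  exact le_iInf fun c => le_mul_loopLength c.1 c.2

namespace Shape

lemma toKlein_fst_eq_neg (S : Shape) {v w : cutSquare} (h : w.1 = (-v.1.1, v.1.2)) :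
    (S.toKlein w).1 = (-(S.toKlein v).1.1, (S.toKlein v).1.2) := by
  simp only [toKlein, h, px_neg]

lemma toKlein_snd_eq_neg (S : Shape) {v w : cutSquare} (h : w.1 = (v.1.1, -v.1.2)) :
    (S.toKlein w).1 = ((S.toKlein v).1.1, -(S.toKlein v).1.2) := by
  simp only [toKlein, h, py_neg]

lemma tanh_mul_ramp_px (S : Shape) {c u : ℝ} (hc₀ : 0 ≤ c) (hc : c < S.s) (hu : |u| = 1 / 2) :
    tanh (S.q * ramp c S.s (S.px u)) = S.swap.px u := by
  rcases eq_or_eq_neg_of_abs_eq hu with rfl | rfl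
  · rw [px_half, px_half, ramp_self hc₀ hc, mul_one]
    rfl
  · rw [px_neg, px_neg, px_half, px_half, ramp_neg hc₀, ramp_self hc₀ hc, mul_neg_one,
      Real.tanh_neg]
    rfl

lemma convex_kleinOct (S : Shape) : Convex ℝ S.kleinOct := by
  have hfst : ConvexOn ℝ Set.univ fun v : ℝ × ℝ => |v.1| :=
    (convexOn_norm convex_univ).comp_linearMap (LinearMap.fst ℝ ℝ ℝ)
  have hsnd : ConvexOn ℝ Set.univ fun v : ℝ × ℝ => |v.2| :=
    (convexOn_norm convex_univ).comp_linearMap (LinearMap.snd ℝ ℝ ℝ)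
  simpa [kleinOct, Set.ofPred_and] using (hfst.convex_le S.s).inter ((hsnd.convex_le S.t).inter
    (((hfst.smul S.s_pos.le).add (hsnd.smul S.t_pos.le)).convex_le 1))

/-- Cut-off values `c`, `d` for the two Klein coordinates such that no point of the octagon exceeds
both. -/
structure Bands (S : Shape) where
  c : ℝ
  d : ℝ
  c_nonneg : 0 ≤ c
  d_nonneg : 0 ≤ d
  c_lt : c < S.s
  d_lt : d < S.t
  one_le : 1 ≤ S.s * c + S.t * d

namespace Bands

variable {S : Shape} (N : S.Bands)

lemma ramp_eq_zero {v : ℝ × ℝ} (hv : v ∈ S.kleinOct) :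
    ramp N.c S.s v.1 = 0 ∨ ramp N.d S.t v.2 = 0 := by
  rcases le_or_gt |v.1| N.c with h | h
  · exact Or.inl (ramp_of_abs_le h)
  rcases le_or_gt |v.2| N.d with h' | h'
  · exact Or.inr (ramp_of_abs_le h')
  linarith [hv.2.2, N.one_le, mul_lt_mul_of_pos_left h S.s_pos,
    mul_lt_mul_of_pos_left h' S.t_pos]

/-- The map of octagons, in Klein coordinates, that collapses the octagon to the two axes and
stretches the bands at the walls. -/
def collapse (v : S.kleinOct) : S.swap.kleinOct :=
  ⟨(tanh (S.q * ramp N.c S.s v.1.1), tanh (S.p * ramp N.d S.t v.1.2)), by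
    have hfst : |tanh (S.q * ramp N.c S.s v.1.1)| ≤ S.swap.s := by
      rw [abs_tanh_mul S.q_pos.le]
      exact monotone_tanh (mul_le_of_le_one_right S.q_pos.le
        (abs_ramp_le_one N.c_nonneg N.c_lt v.2.1))
    have hsnd : |tanh (S.p * ramp N.d S.t v.1.2)| ≤ S.swap.t := by
      rw [abs_tanh_mul S.p_pos.le]
      exact monotone_tanh (mul_le_of_le_one_right S.p_pos.le
        (abs_ramp_le_one N.d_nonneg N.d_lt v.2.2.1))
    refine ⟨hfst, hsnd, ?_⟩
    have hs := S.swap.s_lt_one.le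
    have ht := S.swap.t_lt_one.le
    rcases N.ramp_eq_zero v.2 with h | h <;>
      simp only [h, mul_zero, Real.tanh_zero, abs_zero, zero_add, add_zero]
    · exact mul_le_one₀ ht (abs_nonneg _) (hsnd.trans ht)
    · exact mul_le_one₀ hs (abs_nonneg _) (hfst.trans hs)⟩

lemma continuous_collapse : Continuous N.collapse := by
  refine Continuous.subtype_mk (Continuous.prodMk ?_ ?_) _
  · exact continuous_tanh.comp (continuous_const.mul ((continuous_ramp _ _).comp (by fun_prop)))
  · exact continuous_tanh.comp (continuous_const.mul ((continuous_ramp _ _).comp (by fun_prop)))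

lemma abs_collapse_fst {v : S.kleinOct} (h : |v.1.1| = S.s) :
    |(N.collapse v).1.1| = S.swap.s := by
  change |tanh (S.q * ramp N.c S.s v.1.1)| = tanh S.q
  rw [abs_tanh_mul S.q_pos.le, abs_ramp_eq_one N.c_nonneg N.c_lt h, mul_one]

lemma abs_collapse_snd {v : S.kleinOct} (h : |v.1.2| = S.t) :
    |(N.collapse v).1.2| = S.swap.t := by
  change |tanh (S.p * ramp N.d S.t v.1.2)| = tanh S.p
  rw [abs_tanh_mul S.p_pos.le, abs_ramp_eq_one N.d_nonneg N.d_lt h, mul_one]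

lemma collapse_neg_fst {v w : S.kleinOct} (h : w.1 = (-v.1.1, v.1.2)) :
    (N.collapse w).1 = (-(N.collapse v).1.1, (N.collapse v).1.2) := by
  simp only [collapse, h, ramp_neg N.c_nonneg, mul_neg, Real.tanh_neg]

lemma collapse_neg_snd {v w : S.kleinOct} (h : w.1 = (v.1.1, -v.1.2)) :
    (N.collapse w).1 = ((N.collapse v).1.1, -(N.collapse v).1.2) := by
  simp only [collapse, h, ramp_neg N.d_nonneg, mul_neg, Real.tanh_neg]

lemma kproj_collapse_eq {v w : S.kleinOct} (h : S.kproj v = S.kproj w) :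
    S.swap.kproj (N.collapse v) = S.swap.kproj (N.collapse w) := by
  rw [kproj, kproj, proj_kleinPt_eq_iff] at h ⊢
  rcases h with h | ⟨hwall, hneg⟩ | ⟨hwall, hneg⟩
  · left
    rw [Subtype.ext h]
  · exact Or.inr (Or.inl ⟨N.abs_collapse_fst hwall, N.collapse_neg_fst hneg⟩)
  · exact Or.inr (Or.inr ⟨N.abs_collapse_snd hwall, N.collapse_neg_snd hneg⟩)

/-- The Lipschitz map of surfaces induced by `collapse`. -/
def surfaceMap (x : S.Surface) : S.swap.Surface :=
  S.swap.kproj (N.collapse (Function.surjInv S.kproj_surjective x))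

lemma surfaceMap_kproj (v : S.kleinOct) :
    N.surfaceMap (S.kproj v) = S.swap.kproj (N.collapse v) :=
  N.kproj_collapse_eq (Function.surjInv_eq S.kproj_surjective _)

/-- The Lipschitz constant of `surfaceMap`. -/
def lipschitzConst : ℝ := 2 * (S.q / (S.s - N.c) + S.p / (S.t - N.d))

lemma lipschitzConst_pos : 0 < N.lipschitzConst := by
  have hfst := div_pos S.q_pos (sub_pos.2 N.c_lt)
  have hsnd := div_pos S.p_pos (sub_pos.2 N.d_lt)
  unfold lipschitzConst
  linarith

lemma dist_surfaceMap_proj_le (x y : S.gluing.dom) :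
    dist (N.surfaceMap (S.gluing.proj x)) (N.surfaceMap (S.gluing.proj y))
      ≤ N.lipschitzConst * dist x.1 y.1 := by
  have proj_eq_kproj : ∀ x : S.gluing.dom,
      S.gluing.proj x = S.kproj ⟨_, S.div_cT_mem_kleinOct x.2⟩ := fun x =>
    congrArg S.gluing.proj (Subtype.ext (klein_div_cT x.1).symm)
  rw [proj_eq_kproj x, proj_eq_kproj y, surfaceMap_kproj, surfaceMap_kproj]
  have axis : ∀ x : S.gluing.dom, S.q * ramp N.c S.s (cX x.1 / cT x.1) = 0 ∨
      S.p * ramp N.d S.t (cY x.1 / cT x.1) = 0 := fun x =>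
    (N.ramp_eq_zero (S.div_cT_mem_kleinOct x.2)).imp (mul_eq_zero_of_right _)
      (mul_eq_zero_of_right _)
  have hfst := (abs_ramp_sub_le N.c_nonneg N.c_lt _ _).trans (div_le_div_of_nonneg_right
    (abs_cX_div_cT_sub_le_two_mul_dist x.1 y.1) (sub_pos.2 N.c_lt).le)
  have hsnd := (abs_ramp_sub_le N.d_nonneg N.d_lt _ _).trans (div_le_div_of_nonneg_right
    (abs_cY_div_cT_sub_le_two_mul_dist x.1 y.1) (sub_pos.2 N.d_lt).le)
  refine (S.swap.gluing.dist_proj_le_dist _ _).trans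
    ((dist_klein_tanh_le (axis x) (axis y)).trans ?_)
  rw [← mul_sub, ← mul_sub, abs_mul, abs_mul, abs_of_pos S.q_pos, abs_of_pos S.p_pos]
  refine (add_le_add (mul_le_mul_of_nonneg_left hfst S.q_pos.le)
    (mul_le_mul_of_nonneg_left hsnd S.p_pos.le)).trans_eq ?_
  unfold lipschitzConst
  ring

lemma lipschitzWith_surfaceMap : LipschitzWith N.lipschitzConst.toNNReal N.surfaceMap := by
  have hC := N.lipschitzConst_pos
  refine LipschitzWith.of_dist_le_mul fun x y => ?_
  rw [Real.coe_toNNReal _ hC.le]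
  obtain ⟨x, rfl⟩ := S.gluing.proj_surjective x
  obtain ⟨y, rfl⟩ := S.gluing.proj_surjective y
  rw [← div_le_iff₀' hC]
  refine S.gluing.le_dist_proj (ρ := fun x y =>
    dist (N.surfaceMap (S.gluing.proj x)) (N.surfaceMap (S.gluing.proj y)) / N.lipschitzConst)
    (fun x y z => ?_) (fun x y g hg => ?_) x y
  · rw [← add_div]
    exact div_le_div_of_nonneg_right (dist_triangle _ _ _) hC.le
  · obtain ⟨w, hw, w', hw', hglue, hsum⟩ := S.exists_crossing x.2 y.2 hg
    have hproj : S.gluing.proj ⟨w, hw⟩ = S.gluing.proj ⟨w', hw'⟩ :=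
      S.gluing.proj_eq_iff.2 ⟨g, hg, hglue⟩
    have hfrom := N.dist_surfaceMap_proj_le x ⟨w, hw⟩
    have hto := N.dist_surfaceMap_proj_le ⟨w', hw'⟩ y
    rw [← hproj] at hto
    rw [div_le_iff₀' hC, hsum, mul_add]
    exact (dist_triangle _ _ _).trans (add_le_add hfrom hto)

/-- The straight-line homotopy from `collapse` to the marking of the swapped shape, on the cut
square. -/
def track (x : unitInterval × cutSquare) : S.swap.kleinOct :=
  ⟨(1 - (x.1 : ℝ)) • (N.collapse (S.toKlein x.2)).1 + (x.1 : ℝ) • (S.swap.toKlein x.2).1,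
    S.swap.convex_kleinOct (N.collapse _).2 (S.swap.toKlein x.2).2
      (by linarith [x.1.2.2]) x.1.2.1 (by ring)⟩

lemma continuous_track : Continuous N.track := by
  have hcollapse : Continuous fun x : unitInterval × cutSquare => (N.collapse (S.toKlein x.2)).1 :=
    continuous_subtype_val.comp
      ((N.continuous_collapse.comp S.continuous_toKlein).comp continuous_snd)
  have htoKlein : Continuous fun x : unitInterval × cutSquare => (S.swap.toKlein x.2).1 :=
    continuous_subtype_val.comp (S.swap.continuous_toKlein.comp continuous_snd)
  have htime : Continuous fun x : unitInterval × cutSquare => (x.1 : ℝ) :=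
    continuous_subtype_val.comp continuous_fst
  exact Continuous.subtype_mk
    (((continuous_const.sub htime).smul hcollapse).add (htime.smul htoKlein)) _

lemma collapse_toKlein_fst {v : cutSquare} (h : |v.1.1| = 1 / 2) :
    (N.collapse (S.toKlein v)).1.1 = (S.swap.toKlein v).1.1 :=
  S.tanh_mul_ramp_px N.c_nonneg N.c_lt h

lemma collapse_toKlein_snd {v : cutSquare} (h : |v.1.2| = 1 / 2) :
    (N.collapse (S.toKlein v)).1.2 = (S.swap.toKlein v).1.2 :=
  S.swap.tanh_mul_ramp_px N.d_nonneg N.d_lt h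

lemma kproj_track_eq (τ : unitInterval) {v w : cutSquare} (h : wrap v = wrap w) :
    S.swap.kproj (N.track (τ, v)) = S.swap.kproj (N.track (τ, w)) := by
  rw [wrap_eq_iff] at h
  rw [kproj, kproj, proj_kleinPt_eq_iff]
  rcases h with h | ⟨hwall, hneg⟩ | ⟨hwall, hneg⟩
  · left
    rw [Subtype.ext h]
  · right; left
    constructor
    · simp only [track, Prod.fst_add, Prod.smul_fst, smul_eq_mul, N.collapse_toKlein_fst hwall]
      rw [← add_mul, sub_add_cancel, one_mul]
      exact (S.swap.abs_px_eq_iff v.2.1).2 hwall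
    · simp only [track, N.collapse_neg_fst (S.toKlein_fst_eq_neg hneg),
        S.swap.toKlein_fst_eq_neg hneg]
      ext <;> simp
      ring
  · right; right
    constructor
    · simp only [track, Prod.snd_add, Prod.smul_snd, smul_eq_mul, N.collapse_toKlein_snd hwall]
      rw [← add_mul, sub_add_cancel, one_mul]
      exact (S.swap.abs_py_eq_iff v.2.2.1).2 hwall
    · simp only [track, N.collapse_neg_snd (S.toKlein_snd_eq_neg hneg),
        S.swap.toKlein_snd_eq_neg hneg]
      ext <;> simp
      ring

lemma surfaceMap_comp_mark_homotopic :
    (ContinuousMap.comp ⟨N.surfaceMap, N.lipschitzWith_surfaceMap.continuous⟩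
      (S.markHomeo : C(OneHoledTorus, S.Surface))).Homotopic S.swap.markHomeo := by
  let H : unitInterval × OneHoledTorus → S.swap.Surface := fun x =>
    S.swap.kproj (N.track (x.1, Function.surjInv wrap_surjective x.2))
  have H_wrap : ∀ τ v, H (τ, wrap v) = S.swap.kproj (N.track (τ, v)) := fun τ v =>
    N.kproj_track_eq τ (Function.surjInv_eq wrap_surjective _)
  have hquot : Topology.IsQuotientMap (Prod.map (id : unitInterval → unitInterval) wrap) := by
    have hc : Continuous (Prod.map (id : unitInterval → unitInterval) wrap) :=
      continuous_id.prodMap continuous_wrap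
    exact hc.isClosedMap.isQuotientMap hc (Function.surjective_id.prodMap wrap_surjective)
  have hcont : Continuous H := by
    rw [hquot.continuous_iff]
    have : H ∘ Prod.map id wrap = S.swap.kproj ∘ N.track := funext fun x => H_wrap x.1 x.2
    rw [this]
    exact S.swap.continuous_kproj.comp N.continuous_track
  refine ⟨⟨⟨H, hcont⟩, fun p => ?_, fun p => ?_⟩⟩
  · obtain ⟨v, rfl⟩ := wrap_surjective p
    change H (0, wrap v) = N.surfaceMap (S.mark (wrap v))
    rw [H_wrap, mark_wrap, surfaceMap_kproj]
    congr 1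
    exact Subtype.ext (by simp [track])
  · obtain ⟨v, rfl⟩ := wrap_surjective p
    change H (1, wrap v) = S.swap.mark (wrap v)
    rw [H_wrap, mark_wrap]
    congr 1
    exact Subtype.ext (by simp [track])

lemma curveLength_swap_le {b : ℝ} (hb : 0 ≤ b)
    (h : cosh (b / 4) = sinh S.p * sinh S.q) (γ : C(Circle, OneHoledTorus)) :
    curveLength (S.swap.toMarkedTorus b hb (h.trans (mul_comm _ _))) γ
      ≤ ENNReal.ofReal N.lipschitzConst * curveLength (S.toMarkedTorus b hb h) γ :=
  curveLength_le_mul_of_homotopic (h := S.toMarkedTorus b hb h)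
    (h' := S.swap.toMarkedTorus b hb (h.trans (mul_comm _ _))) N.lipschitzWith_surfaceMap
    N.surfaceMap_comp_mark_homotopic γ

end Bands

end Shape

/-! ### An essential arc -/

/-- The segment `{1 / 2} × [-1 / 4, 1 / 4]` of the right side of the cut square, parametrised by
the unit interval. -/
def verticalSegment (t : unitInterval) : cutSquare :=
  ⟨(1 / 2, (t : ℝ) / 2 - 1 / 4), by
    have habs : |(t : ℝ) / 2 - 1 / 4| ≤ 1 / 4 :=
      abs_le.2 ⟨by linarith [t.2.1], by linarith [t.2.2]⟩
    have hsq := pow_le_pow_left₀ (by norm_num : (0 : ℝ) ≤ 1 / 4)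
      (by linarith : (1 / 4 : ℝ) ≤ 1 / 2 - |(t : ℝ) / 2 - 1 / 4|) 2
    refine ⟨by norm_num, by linarith, ?_⟩
    change (1 / 4 : ℝ) ^ 2 ≤ (1 / 2 - |(1 / 2 : ℝ)|) ^ 2 + (1 / 2 - |(t : ℝ) / 2 - 1 / 4|) ^ 2
    linarith [sq_nonneg (1 / 2 - |(1 / 2 : ℝ)|)]⟩

/-- The arc from the boundary to itself traced out by `verticalSegment`; it distinguishes the two
metrics. -/
def verticalArc : C(unitInterval, OneHoledTorus) where
  toFun t := wrap (verticalSegment t)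
  continuous_toFun := continuous_wrap.comp (Continuous.subtype_mk (by fun_prop) _)

lemma verticalArc_snd (t : unitInterval) :
    (verticalArc t).1.2 = (((t : ℝ) / 2 + 1 / 4 : ℝ) : UnitAddCircle) := by
  change (((t : ℝ) / 2 - 1 / 4 + 1 / 2 : ℝ) : UnitAddCircle) = _
  congr 1
  ring

lemma injective_verticalArc : Function.Injective verticalArc := by
  intro t t' heq
  have ht := t.2
  rcases (wrap_eq_iff _ _).1 heq with h | ⟨-, h⟩ | ⟨hwall, -⟩
  · have hsnd := congrArg Prod.snd h
    simp only [verticalSegment] at hsnd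
    exact Subtype.ext (by linarith)
  · have hfst := congrArg Prod.fst h
    norm_num [verticalSegment] at hfst
  · have habs : |(t : ℝ) / 2 - 1 / 4| ≤ 1 / 4 := abs_le.2 ⟨by linarith [ht.1], by linarith [ht.2]⟩
    simp only [verticalSegment] at hwall
    linarith

lemma verticalArc_zero_mem_bdry : verticalArc 0 ∈ bdry := by
  refine (wrap_mem_bdry_iff _).2 ?_
  norm_num [verticalSegment, abs_of_pos]

lemma verticalArc_one_mem_bdry : verticalArc 1 ∈ bdry := by
  refine (wrap_mem_bdry_iff _).2 ?_
  norm_num [verticalSegment, abs_of_pos]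

lemma norm_snd_le_of_mem_bdry {p : OneHoledTorus} (hp : p ∈ bdry) : ‖p.1.2‖ ≤ 1 / 4 := by
  have hsum : ‖p.1.1‖ ^ 2 + ‖p.1.2‖ ^ 2 = (1 / 4 : ℝ) ^ 2 := hp
  refine (pow_le_pow_iff_left₀ (norm_nonneg _) (by norm_num) two_ne_zero).1 ?_
  linarith [sq_nonneg ‖p.1.1‖]

lemma norm_coe_sub_intCast {x : ℝ} {n : ℤ} (hx : |x - n| ≤ 1 / 2) :
    ‖(x : UnitAddCircle)‖ = |x - n| := by
  have hn : ((n : ℝ) : UnitAddCircle) = 0 := (AddCircle.coe_eq_zero_iff (1 : ℝ)).2 ⟨n, by simp⟩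
  rw [← sub_zero (x : UnitAddCircle), ← hn, ← AddCircle.coe_sub,
    (AddCircle.norm_coe_eq_abs_iff (1 : ℝ) one_ne_zero).2 (by rwa [abs_one])]

lemma abs_sub_intCast_le_of_norm_coe_le {X : Type*} [TopologicalSpace X] [PreconnectedSpace X]
    {φ : X → ℝ} (hφ : Continuous φ) {r : ℝ} (hr : r < 1 / 2)
    (hnorm : ∀ x, ‖(φ x : UnitAddCircle)‖ ≤ r) {n : ℤ} {x₀ : X} (hx₀ : |φ x₀ - n| ≤ r) (x : X) :
    |φ x - n| ≤ r := by
  by_contra! hx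
  obtain ⟨y, hy⟩ : ∃ y, |φ y - n| = min |φ x - n| (1 / 2) :=
    mem_range_of_exists_le_of_exists_ge (f := fun y => |φ y - n|) (by fun_prop)
      ⟨x₀, hx₀.trans (le_min hx.le hr.le)⟩ ⟨x, min_le_left _ _⟩
  have hnorm_y := norm_coe_sub_intCast (hy ▸ min_le_right _ _ : |φ y - n| ≤ 1 / 2)
  have hlt : r < |φ y - n| := hy ▸ lt_min hx hr
  linarith [hnorm y]

lemma exists_lift_of_boundaryHomotopic {c : C(unitInterval, OneHoledTorus)}
    (h : BoundaryHomotopic verticalArc c) : ∃ Γ : C(unitInterval, ℝ),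
      (∀ t, (Γ t : UnitAddCircle) = (c t).1.2) ∧ |Γ 0| ≤ 1 / 4 ∧ |Γ 1 - 1| ≤ 1 / 4 := by
  obtain ⟨F⟩ := h
  let snd : C(OneHoledTorus, UnitAddCircle) := ⟨fun p => p.1.2,
    continuous_snd.comp continuous_subtype_val⟩
  let H : C(unitInterval × unitInterval, UnitAddCircle) := snd.comp F.toContinuousMap
  let f : C(unitInterval, ℝ) := ⟨fun t => (t : ℝ) / 2 + 1 / 4, by fun_prop⟩
  have cov := AddCircle.isCoveringMap_coe (1 : ℝ)
  have H_zero : ∀ t, H (0, t) = (f t : UnitAddCircle) := fun t => by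
    change (F (0, t)).1.2 = _
    rw [F.apply_zero]
    exact verticalArc_snd t
  let L := cov.liftHomotopy H f H_zero
  have coe_L : ∀ x, (L x : UnitAddCircle) = (F x).1.2 :=
    congrFun (cov.liftHomotopy_lifts H f H_zero)
  have L_zero : ∀ t, L (0, t) = (t : ℝ) / 2 + 1 / 4 := cov.liftHomotopy_zero H f H_zero
  have hbdry : ∀ τ, F (τ, 0) ∈ bdry ∧ F (τ, 1) ∈ bdry := fun τ => F.prop τ
  refine ⟨⟨fun t => L (1, t), by fun_prop⟩, fun t => ?_, ?_, ?_⟩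
  · change (L (1, t) : UnitAddCircle) = _
    rw [coe_L, F.apply_one]
  · simpa using abs_sub_intCast_le_of_norm_coe_le (φ := fun τ => L (τ, 0)) (n := 0) (x₀ := 0)
      (by fun_prop) (by norm_num : (1 / 4 : ℝ) < 1 / 2)
      (fun τ => (coe_L _).symm ▸ norm_snd_le_of_mem_bdry (hbdry τ).1)
      (by rw [L_zero]; norm_num [abs_of_pos]) 1
  · simpa using abs_sub_intCast_le_of_norm_coe_le (φ := fun τ => L (τ, 1)) (n := 1) (x₀ := 0)
      (by fun_prop) (by norm_num : (1 / 4 : ℝ) < 1 / 2)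
      (fun τ => (coe_L _).symm ▸ norm_snd_le_of_mem_bdry (hbdry τ).2)
      (by rw [L_zero]; norm_num [abs_of_pos]) 1

lemma isEssentialSimpleArc_verticalArc : IsEssentialSimpleArc verticalArc := by
  refine ⟨injective_verticalArc, verticalArc_zero_mem_bdry, verticalArc_one_mem_bdry, ?_⟩
  rintro ⟨c, hc, hbdry⟩
  obtain ⟨Γ, hΓ, hΓ_zero, hΓ_one⟩ := exists_lift_of_boundaryHomotopic hc
  have hΓ_one' := abs_sub_intCast_le_of_norm_coe_le (n := 0) Γ.continuous
    (by norm_num : (1 / 4 : ℝ) < 1 / 2)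
    (fun t => by rw [hΓ]; exact norm_snd_le_of_mem_bdry (hbdry t)) (by simpa using hΓ_zero) 1
  rw [Int.cast_zero, sub_zero] at hΓ_one'
  linarith [(abs_le.1 hΓ_one).1, (abs_le.1 hΓ_one').2]

lemma exists_snd_eq_half {c : C(unitInterval, OneHoledTorus)}
    (h : BoundaryHomotopic verticalArc c) :
    ∃ t, (c t).1.2 = ((1 / 2 : ℝ) : UnitAddCircle) := by
  obtain ⟨Γ, hΓ, hΓ_zero, hΓ_one⟩ := exists_lift_of_boundaryHomotopic h
  obtain ⟨t, ht⟩ := mem_range_of_exists_le_of_exists_ge Γ.continuous (c := 1 / 2)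
    ⟨0, by linarith [(abs_le.1 hΓ_zero).2]⟩ ⟨1, by linarith [(abs_le.1 hΓ_one).1]⟩
  exact ⟨t, by rw [← hΓ, ht]⟩

/-! ### The length of the arc -/

namespace Shape

variable (S : Shape)

/-- The smallest value of `|cY|` on the boundary sides of the octagon; its inverse hyperbolic sine
is the distance from these sides to the first coordinate axis. -/
def height : ℝ := √((1 - S.s ^ 2) / S.excess)

lemma one_sub_s_sq_pos : 0 < 1 - S.s ^ 2 := by
  nlinarith [S.s_pos, S.s_lt_one]

lemma height_pos : 0 < S.height := Real.sqrt_pos.2 (div_pos S.one_sub_s_sq_pos S.excess_pos)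

lemma sq_mul_excess_mul_sq {X Y T : ℝ} (hT : T ^ 2 = 1 + X ^ 2 + Y ^ 2)
    (h : S.s * X + S.t * Y = T) :
    S.s ^ 2 * (S.excess * Y ^ 2) =
      S.s ^ 2 * (1 - S.s ^ 2) + ((1 - S.s ^ 2) * T - S.t * Y) ^ 2 := by
  unfold excess
  linear_combination (1 - S.s ^ 2) * (S.s ^ 2 * hT + (S.s * X - S.t * Y + T) * h)

lemma height_le_abs_cY {z : ℍ} (hz : S.s * |cX z| + S.t * |cY z| = cT z) :
    S.height ≤ |cY z| := by
  have hid := S.sq_mul_excess_mul_sq (by rw [sq_abs, sq_abs]; exact cT_sq z) hz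
  have hs := S.s_pos
  refine Real.sqrt_le_iff.2 ⟨abs_nonneg _, (div_le_iff₀' S.excess_pos).2 ?_⟩
  refine le_of_mul_le_mul_left ?_ (by positivity : 0 < S.s ^ 2)
  linarith [sq_nonneg ((1 - S.s ^ 2) * cT z - S.t * |cY z|)]

lemma abs_cY_le_height {z : ℍ} (hwall : |cX z| = S.s * cT z)
    (hz : S.s * |cX z| + S.t * |cY z| = cT z) : |cY z| ≤ S.height := by
  have hid := S.sq_mul_excess_mul_sq (by rw [sq_abs, sq_abs]; exact cT_sq z) hz
  have hs := S.s_pos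
  have hsquare : (1 - S.s ^ 2) * cT z - S.t * |cY z| = 0 := by
    rw [hwall] at hz
    linarith
  rw [hsquare, zero_pow two_ne_zero, add_zero] at hid
  refine Real.le_sqrt_of_sq_le ((le_div_iff₀' S.excess_pos).2 ?_)
  exact (mul_left_cancel₀ (by positivity) hid).le

lemma py_zero : S.py 0 = 0 := profile_zero _ _

lemma cY_klein_toKlein_eq_zero {v : cutSquare}
    (hv : (wrap v).1.2 = ((1 / 2 : ℝ) : UnitAddCircle)) : cY (klein (S.toKlein v).1) = 0 := by
  have hcoe : ((v.1.2 + 1 / 2 : ℝ) : UnitAddCircle) = ((0 + 1 / 2 : ℝ) : UnitAddCircle) := by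
    rw [zero_add]
    exact hv
  have hsnd : v.1.2 = 0 := by
    rcases (coe_add_half_eq_iff v.2.2.1 (by norm_num)).1 hcoe with hzero | ⟨-, hneg⟩
    · exact hzero
    · linarith
  rw [cY_klein (S.sq_add_sq_lt_one (S.toKlein v).2)]
  change S.py v.1.2 * _ = 0
  rw [hsnd, py_zero, zero_mul]

lemma arsinh_height_le_dist_mark {x y : OneHoledTorus} (hx : x ∈ bdry)
    (hy : y.1.2 = ((1 / 2 : ℝ) : UnitAddCircle)) :
    arsinh S.height ≤ dist (S.mark x) (S.mark y) := by
  obtain ⟨v, rfl⟩ := wrap_surjective x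
  obtain ⟨w, rfl⟩ := wrap_surjective y
  have hv := S.height_le_abs_cY ((S.wrap_mem_bdry_iff_klein v).1 hx)
  rw [mark_wrap, mark_wrap]
  calc arsinh S.height
      ≤ arsinh |cY (klein (S.toKlein v).1)| := Real.arsinh_le_arsinh.2 hv
    _ = arsinh (cY (fold (klein (S.toKlein v).1)))
          - arsinh (cY (fold (klein (S.toKlein w).1))) := by
        rw [cY_fold, cY_fold, S.cY_klein_toKlein_eq_zero hy, abs_zero, Real.arsinh_zero, sub_zero]
    _ ≤ dist (fold (klein (S.toKlein v).1)) (fold (klein (S.toKlein w).1)) :=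
        (le_abs_self _).trans (abs_arsinh_cY_sub_le_dist _ _)
    _ ≤ _ := S.dist_fold_le_dist_proj (S.kleinPt (S.toKlein v)) (S.kleinPt (S.toKlein w))

lemma le_arcLength_verticalArc {b : ℝ} (hb : 0 ≤ b)
    (h : cosh (b / 4) = sinh S.p * sinh S.q) :
    ENNReal.ofReal (arsinh S.height) ≤ arcLength (S.toMarkedTorus b hb h) verticalArc := by
  refine le_iInf₂ fun c hc => ?_
  have hc_zero : c 0 ∈ bdry := by
    obtain ⟨G⟩ := hc
    simpa using (G.prop 1).1
  obtain ⟨t, ht⟩ := exists_snd_eq_half hc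
  refine le_trans ?_ (eVariationOn.edist_le _ (Set.mem_univ 0) (Set.mem_univ t))
  change _ ≤ edist (S.mark (c 0)) (S.mark (c t))
  rw [edist_dist]
  exact ENNReal.ofReal_le_ofReal (S.arsinh_height_le_dist_mark hc_zero ht)

lemma cosh_arsinh_cY {z : ℍ} (hz : cX z = S.s * cT z) :
    cosh (arsinh (cY z)) = √(1 - S.s ^ 2) * cT z := by
  have hs := S.one_sub_s_sq_pos
  have hT := cT_pos z
  rw [Real.cosh_arsinh, ← Real.sqrt_sq (by positivity : 0 ≤ √(1 - S.s ^ 2) * cT z), mul_pow,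
    Real.sq_sqrt hs.le]
  congr 1
  linear_combination -cT_sq z - (cX z + S.s * cT z) * hz

lemma dist_eq_abs_arsinh_cY_sub_of_wall {z w : ℍ} (hz : cX z = S.s * cT z)
    (hw : cX w = S.s * cT w) : dist z w = |arsinh (cY z) - arsinh (cY w)| := by
  refine dist_eq_abs_of_cosh_dist_eq ?_
  rw [Real.cosh_sub, S.cosh_arsinh_cY hz, S.cosh_arsinh_cY hw, Real.sinh_arsinh,
    Real.sinh_arsinh, cosh_dist_eq, hz, hw]
  linear_combination -cT z * cT w * Real.mul_self_sqrt S.one_sub_s_sq_pos.le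

lemma arsinh_cY_le_of_wall {z w : ℍ} (hz : cX z = S.s * cT z) (hw : cX w = S.s * cT w)
    (h : cY z * cT w ≤ cY w * cT z) : arsinh (cY z) ≤ arsinh (cY w) := by
  rw [← sub_nonneg, ← Real.sinh_nonneg_iff, Real.sinh_sub, S.cosh_arsinh_cY hz,
    S.cosh_arsinh_cY hw, Real.sinh_arsinh, Real.sinh_arsinh]
  linarith [mul_le_mul_of_nonneg_left h (Real.sqrt_nonneg (1 - S.s ^ 2))]

/-- The lift of `verticalArc` to a wall of the octagon of `S`. -/
def wallPath (t : unitInterval) : ℍ := klein (S.toKlein (verticalSegment t)).1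

lemma cX_wallPath (t : unitInterval) : cX (S.wallPath t) = S.s * cT (S.wallPath t) := by
  rw [wallPath, cX_klein (S.sq_add_sq_lt_one (S.toKlein (verticalSegment t)).2)]
  congr 1
  exact S.px_half

lemma cY_wallPath (t : unitInterval) :
    cY (S.wallPath t) = S.py ((t : ℝ) / 2 - 1 / 4) * cT (S.wallPath t) :=
  cY_klein (S.sq_add_sq_lt_one (S.toKlein (verticalSegment t)).2)

lemma monotone_arsinh_cY_wallPath : Monotone fun t => arsinh (cY (S.wallPath t)) := by
  intro t t' hle
  refine S.arsinh_cY_le_of_wall (S.cX_wallPath t) (S.cX_wallPath t') ?_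
  rw [cY_wallPath, cY_wallPath, mul_assoc, mul_assoc, mul_comm (cT (S.wallPath t'))]
  refine mul_le_mul_of_nonneg_right ?_ (mul_pos (cT_pos _) (cT_pos _)).le
  have hle' : (t : ℝ) ≤ t' := hle
  exact S.swap.strictMonoOn_px.monotoneOn
    ⟨by linarith [t.2.1], by linarith [t.2.2]⟩
    ⟨by linarith [t'.2.1], by linarith [t'.2.2]⟩ (by linarith)

lemma abs_cY_wallPath_le {t : unitInterval} (ht : verticalArc t ∈ bdry) :
    |cY (S.wallPath t)| ≤ S.height := by
  refine S.abs_cY_le_height ?_ ((S.wrap_mem_bdry_iff_klein _).1 ht)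
  rw [S.cX_wallPath, abs_of_pos (mul_pos S.s_pos (cT_pos _))]

lemma pathLength_mark_verticalArc_le :
    pathLength (fun t => S.mark (verticalArc t))
      ≤ eVariationOn (fun t => arsinh (cY (S.wallPath t))) Set.univ := by
  refine eVariationOn_le_of_edist_le fun t _ t' _ => ?_
  change edist (S.mark (wrap (verticalSegment t))) (S.mark (wrap (verticalSegment t'))) ≤ _
  rw [mark_wrap, mark_wrap, edist_dist, edist_dist, Real.dist_eq,
    ← S.dist_eq_abs_arsinh_cY_sub_of_wall (S.cX_wallPath t) (S.cX_wallPath t')]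
  exact ENNReal.ofReal_le_ofReal (S.gluing.dist_proj_le_dist _ _)

lemma arcLength_verticalArc_le {b : ℝ} (hb : 0 ≤ b)
    (h : cosh (b / 4) = sinh S.p * sinh S.q) :
    arcLength (S.toMarkedTorus b hb h) verticalArc
      ≤ ENNReal.ofReal (2 * arsinh S.height) := by
  have hrefl : BoundaryHomotopic verticalArc verticalArc :=
    ContinuousMap.HomotopicWith.refl _ ⟨verticalArc_zero_mem_bdry, verticalArc_one_mem_bdry⟩
  refine (iInf₂_le verticalArc hrefl).trans (S.pathLength_mark_verticalArc_le.trans ?_)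
  rw [eVariationOn_unitInterval_of_monotone S.monotone_arsinh_cY_wallPath]
  refine ENNReal.ofReal_le_ofReal ?_
  have hupper := Real.arsinh_le_arsinh.2
    (abs_le.1 (S.abs_cY_wallPath_le verticalArc_one_mem_bdry)).2
  have hlower := Real.arsinh_le_arsinh.2
    (abs_le.1 (S.abs_cY_wallPath_le verticalArc_zero_mem_bdry)).1
  rw [Real.arsinh_neg] at hlower
  linarith

end Shape

/-! ### Comparison of the two metrics -/

lemma curveMetric_lt_arcMetric_of_le {b : ℝ} {h₀ h₁ : MarkedTorus b} {C ℓ₀ ℓ₁ : ℝ}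
    (hℓ₀ : 0 < ℓ₀) (hC : 0 < C) (hlt : C < ℓ₁ / ℓ₀)
    (hcurve : ∀ γ, curveLength h₁ γ ≤ ENNReal.ofReal C * curveLength h₀ γ)
    {a : C(unitInterval, OneHoledTorus)} (ha : IsEssentialSimpleArc a)
    (h₀a : arcLength h₀ a ≤ ENNReal.ofReal ℓ₀) (h₁a : ENNReal.ofReal ℓ₁ ≤ arcLength h₁ a) :
    curveMetric (⟦h₀⟧ : Teich b) ⟦h₁⟧ < arcMetric (⟦h₀⟧ : Teich b) ⟦h₁⟧ := by
  have hratio : ENNReal.ofReal C < arcLength h₁ a / arcLength h₀ a := by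
    calc ENNReal.ofReal C < ENNReal.ofReal (ℓ₁ / ℓ₀) :=
          (ENNReal.ofReal_lt_ofReal_iff (hC.trans hlt)).2 hlt
      _ = ENNReal.ofReal ℓ₁ / ENNReal.ofReal ℓ₀ := ENNReal.ofReal_div_of_pos hℓ₀
      _ ≤ _ := ENNReal.div_le_div h₁a h₀a
  calc curveMetric (⟦h₀⟧ : Teich b) ⟦h₁⟧
      ≤ ENNReal.log (ENNReal.ofReal C) :=
        iSup₂_le fun γ _ => ENNReal.log_monotone (ENNReal.div_le_of_le_mul (hcurve γ))
    _ < ENNReal.log (arcLength h₁ a / arcLength h₀ a) := ENNReal.log_strictMono hratio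
    _ ≤ arcMetric (⟦h₀⟧ : Teich b) ⟦h₁⟧ := le_sup_of_le_left (le_iSup₂_of_le a ha le_rfl)

lemma Shape.Bands.curveMetric_lt_arcMetric {S : Shape} (N : S.Bands) {b : ℝ} (hb : 0 ≤ b)
    (h : cosh (b / 4) = sinh S.p * sinh S.q)
    (hlt : N.lipschitzConst < arsinh S.swap.height / (2 * arsinh S.height)) :
    let h₀ : Teich b := ⟦S.toMarkedTorus b hb h⟧
    let h₁ : Teich b := ⟦S.swap.toMarkedTorus b hb (h.trans (mul_comm _ _))⟧
    curveMetric h₀ h₁ < arcMetric h₀ h₁ :=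
  curveMetric_lt_arcMetric_of_le (mul_pos two_pos (Real.arsinh_pos_iff.2 S.height_pos))
    N.lipschitzConst_pos hlt (N.curveLength_swap_le hb h) isEssentialSimpleArc_verticalArc
    (S.arcLength_verticalArc_le hb h) (S.swap.le_arcLength_verticalArc hb _)

lemma half_exp_le_cosh (x : ℝ) : Real.exp x / 2 ≤ cosh x := by
  rw [Real.cosh_eq]
  linarith [Real.exp_pos (-x)]

lemma linear_lt_cosh_div {p : ℝ} (hp : 100 ≤ p) : 28 + 10 * p < cosh p / 8 := by
  have hcubic := Real.pow_div_factorial_le_exp p (by linarith) 3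
  have hcosh := half_exp_le_cosh p
  norm_num [Nat.factorial] at hcubic
  nlinarith [mul_le_mul hp hp (by norm_num) (by linarith)]

lemma le_arsinh_three_quarters_mul_cosh {x a : ℝ} (h : a + 1 ≤ x) :
    a ≤ arsinh (3 / 4 * cosh x) := by
  rw [← Real.sinh_le_sinh, Real.sinh_arsinh, Real.sinh_eq]
  have hmono : Real.exp a * Real.exp 1 ≤ Real.exp x := by
    rw [← Real.exp_add]
    exact Real.exp_le_exp.2 h
  have hexp_one : Real.exp a * (1 + 1) ≤ Real.exp a * Real.exp 1 :=
    mul_le_mul_of_nonneg_left (Real.add_one_le_exp 1) (Real.exp_pos a).le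
  linarith [half_exp_le_cosh x, Real.exp_pos a, Real.exp_pos (-a)]

lemma tanh_arsinh_four_thirds : tanh (arsinh (4 / 3)) = 4 / 5 := by
  rw [Real.tanh_arsinh, show (1 : ℝ) + (4 / 3) ^ 2 = (5 / 3) ^ 2 by norm_num,
    Real.sqrt_sq (by norm_num)]
  norm_num

lemma arsinh_le_self {x : ℝ} (hx : 0 ≤ x) : arsinh x ≤ x := by
  simpa only [Real.sinh_arsinh] using Real.self_le_sinh_iff.2 (Real.arsinh_nonneg_iff.2 hx)

lemma half_le_arsinh_three_quarters : 1 / 2 ≤ arsinh (3 / 4) := by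
  have hlog : arsinh (3 / 4) = Real.log 2 := by
    rw [arsinh, show (1 : ℝ) + (3 / 4) ^ 2 = (5 / 4) ^ 2 by norm_num,
      Real.sqrt_sq (by norm_num)]
    norm_num
  linarith [Real.log_two_gt_d9]

lemma four_fifths_le_tanh {p : ℝ} (hp : 4 / 3 ≤ p) : 4 / 5 ≤ tanh p := by
  rw [← tanh_arsinh_four_thirds]
  exact monotone_tanh ((arsinh_le_self (by norm_num)).trans hp)

/-- The shape with `tanh q = 4 / 5` and a long first side `p`: its vertical arc is short, while
that of the swapped shape is not. -/
def longShape (p : ℝ) (hp : 4 / 3 ≤ p) : Shape where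
  p := p
  q := arsinh (4 / 3)
  p_pos := by linarith
  q_pos := Real.arsinh_pos_iff.2 (by norm_num)
  one_lt := by
    rw [tanh_arsinh_four_thirds]
    nlinarith [four_fifths_le_tanh hp]

section LongShape

variable {p : ℝ} (hp : 4 / 3 ≤ p)

lemma longShape_t : (longShape p hp).t = 4 / 5 := tanh_arsinh_four_thirds

lemma four_fifths_le_longShape_s : 4 / 5 ≤ (longShape p hp).s := four_fifths_le_tanh hp

/-- Cut-off values for `longShape`, with `4 / 5 * c + 4 / 5 * d = 1`. -/
def longBands : (longShape p hp).Bands where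
  c := 13 / 20
  d := 3 / 5
  c_nonneg := by norm_num
  d_nonneg := by norm_num
  c_lt := by linarith [four_fifths_le_longShape_s hp]
  d_lt := by rw [longShape_t]; norm_num
  one_le := by rw [longShape_t]; linarith [four_fifths_le_longShape_s hp]

lemma lipschitzConst_longBands_le : (longBands hp).lipschitzConst ≤ 28 + 10 * p := by
  have hfst : arsinh (4 / 3) / ((longShape p hp).s - 13 / 20) ≤ 14 := by
    have hs := four_fifths_le_longShape_s hp
    rw [div_le_iff₀ (by linarith)]
    linarith [arsinh_le_self (x := 4 / 3) (by norm_num)]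
  have hsnd : p / ((longShape p hp).t - 3 / 5) = 5 * p := by
    rw [longShape_t]
    ring
  change 2 * (arsinh (4 / 3) / ((longShape p hp).s - 13 / 20)
    + p / ((longShape p hp).t - 3 / 5)) ≤ _
  linarith

lemma height_longShape_le : (longShape p hp).height ≤ 2 / cosh p := by
  have hcosh_sq : 0 < cosh p ^ 2 := pow_pos (Real.cosh_pos p) 2
  have hunit : cosh p ^ 2 * (1 - (longShape p hp).s ^ 2) = 1 := (longShape p hp).cosh_p_sq_mul
  have hexcess : 1 / 4 ≤ (longShape p hp).excess := by
    rw [Shape.excess, longShape_t]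
    nlinarith [four_fifths_le_longShape_s hp]
  refine Real.sqrt_le_iff.2 ⟨div_nonneg two_pos.le (Real.cosh_pos p).le, ?_⟩
  rw [div_le_iff₀ (longShape p hp).excess_pos, div_pow, div_mul_eq_mul_div,
    le_div_iff₀' hcosh_sq, hunit]
  linarith

lemma half_le_arsinh_height_swap_longShape : 1 / 2 ≤ arsinh (longShape p hp).swap.height := by
  refine half_le_arsinh_three_quarters.trans (Real.arsinh_le_arsinh.2 ?_)
  refine Real.le_sqrt_of_sq_le ?_
  rw [le_div_iff₀ (longShape p hp).swap.excess_pos, Shape.excess, Shape.swap_s, Shape.swap_t,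
    longShape_t]
  nlinarith [(longShape p hp).s_lt_one, (longShape p hp).s_pos]

lemma cosh_div_le_arsinh_height_div :
    cosh p / 8 ≤ arsinh (longShape p hp).swap.height / (2 * arsinh (longShape p hp).height) := by
  have hheight := (longShape p hp).height_pos
  have harsinh := Real.arsinh_pos_iff.2 hheight
  calc cosh p / 8 = (1 / 2) / (2 * (2 / cosh p)) := by
        field_simp
        norm_num
    _ ≤ _ := by
        gcongr
        · exact (Real.arsinh_pos_iff.2 (longShape p hp).swap.height_pos).le
        · exact half_le_arsinh_height_swap_longShape hp
        · exact (arsinh_le_self hheight.le).trans (height_longShape_le hp)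

end LongShape

end TorusMetrics

end

theorem mainTheorem5 :
    ∃ B : ℝ, 0 < B ∧ ∀ b : ℝ, B ≤ b →
      ∃ h₀ h₁ : TorusMetrics.Teich b,
        TorusMetrics.curveMetric h₀ h₁ < TorusMetrics.arcMetric h₀ h₁ := by
  refine ⟨404, by norm_num, fun b hb => ?_⟩
  let p := Real.arsinh (3 / 4 * Real.cosh (b / 4))
  have hp : 100 ≤ p := TorusMetrics.le_arsinh_three_quarters_mul_cosh (by linarith)
  have hp' : 4 / 3 ≤ p := by linarith
  have hboundary : Real.cosh (b / 4) = Real.sinh p * Real.sinh (Real.arsinh (4 / 3)) := by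
    rw [Real.sinh_arsinh, Real.sinh_arsinh]
    ring
  have hlt : (TorusMetrics.longBands hp').lipschitzConst < Real.cosh p / 8 :=
    (TorusMetrics.lipschitzConst_longBands_le hp').trans_lt (TorusMetrics.linear_lt_cosh_div hp)
  exact ⟨_, _, (TorusMetrics.longBands hp').curveMetric_lt_arcMetric (by linarith) hboundary
    (hlt.trans_le (TorusMetrics.cosh_div_le_arsinh_height_div hp'))⟩
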